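/- Let $\Omega'\subset\mathbb C^n$ be an open polydisc centred at $0$, let $A\subset\Omega'$ be an analytic curve, and let $\omega$ be a smooth Kähler form on $\Omega'$ with Kähler metric $g(v,w)=\omega(v,Jw)$, normalised so that $g_0$ is the standard scalar product $\operatorname{Re}\langle\cdot,\cdot\rangle$ of $\mathbb C^n$. Let $X'$ be a relatively open subset of $A$ whose only singular point is $0$, let $\Delta'\subset\mathbb C$ be an open set containing the closed unit disc, and let $\phi:\Delta'\to X'$ be the normalisation map, of the form $$\phi(z)=z^m\psi(z),\qquad \psi=(\psi_1,\dots,\psi_n):\Delta'\to\mathbb C^n \text{ holomorphic},\qquad \psi_1\equiv 1,\qquad \psi_j(0)=0\ (j>1),$$ with $m\ge 1$ (so $X'$ is analytically irreducible at $0$ and $m$ is its multiplicity there). Let $\Delta=\{|z|<1\}$, and suppose that $X:=\phi(\Delta)=A\cap\Omega$ for an open set $\Omega$ with compact closure in $\Omega'$. Write $X_{\mathrm{reg}}$ for the set of regular points of $X$. Let $d$ be the intrinsic distance of $(X,\omega|_X)$: $d(x,y)$ is the infimum of the lengths $\int_{\alpha^{-1}(X_{\mathrm{reg}})}|\dot\alpha(t)|_g\,dt$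 over piecewise $C^1$ paths $\alpha:[0,1]\to X$ with $\alpha(0)=x$, $\alpha(1)=y$. A path $\gamma:[0,L]\to X$ is a unit speed geodesic if every $t\in[0,L]$ has a compact neighbourhood $[a,b]$ in $[0,L]$ such that $d(\gamma(s),\gamma(s'))=|s-s'|$ for all $s,s'\in[a,b]$. Then there is a constant $c_3$, depending only on the data above, such that for every $L>0$ and every unit speed geodesic $\gamma:[0,L]\to X$ with $\gamma((0,L])\subset X_{\mathrm{reg}}$, the path $\gamma$ is differentiable on $[0,L]$ as a map into $\mathbb C^n$ (one-sidedly at the end points) and $$\|\dot\gamma\|_{C^{0,1/m}}=\sup_{t\in[0,L]}|\dot\gamma(t)|+\sup_{\substack{s,t\in[0,L]\\ s\ne t}}\frac{|\dot\gamma(t)-\dot\gamma(s)|}{|t-s|^{1/m}}\le c_3,$$ where $|\cdot|$ is the Euclidean norm of $\mathbb C^n$. -/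

import Mathlib

open Set Topology MeasureTheory
open scoped NNReal ENNReal

/-- The point `x` of `Y` is regular when `Y` is, near `x`, a one-dimensional complex submanifold of
`ℂⁿ`: some open neighbourhood `U` of `x` meets `Y` in the image of a holomorphic map `p` of one
variable that has a holomorphic left inverse `h` on `U` (so `p` is an embedding). -/
def regularPart {n : ℕ} (Y : Set (EuclideanSpace ℂ (Fin n))) : Set (EuclideanSpace ℂ (Fin n)) :=
  {x | x ∈ Y ∧ ∃ (U : Set (EuclideanSpace ℂ (Fin n))) (D : Set ℂ)
      (p : ℂ → EuclideanSpace ℂ (Fin n)) (h : EuclideanSpace ℂ (Fin n) → ℂ),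
      IsOpen U ∧ x ∈ U ∧ IsOpen D ∧ DifferentiableOn ℂ p D ∧ DifferentiableOn ℂ h U ∧
      p '' D = Y ∩ U ∧ ∀ w ∈ D, h (p w) = w}

/-- The singular points of `Y`. -/
def singularPart {n : ℕ} (Y : Set (EuclideanSpace ℂ (Fin n))) : Set (EuclideanSpace ℂ (Fin n)) :=
  Y \ regularPart Y

/-- The open polydisc centred at `0` with polyradius `r`. -/
def polydisc {n : ℕ} (r : Fin n → ℝ) : Set (EuclideanSpace ℂ (Fin n)) :=
  {z | ∀ i, ‖z i‖ < r i}

/-- `A` is an analytic subset of the open set `W`: near each point of `W` it is the set of common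
zeros of finitely many holomorphic functions. -/
def IsAnalyticSubset {n : ℕ} (W A : Set (EuclideanSpace ℂ (Fin n))) : Prop :=
  A ⊆ W ∧ ∀ x ∈ W, ∃ U : Set (EuclideanSpace ℂ (Fin n)), IsOpen U ∧ x ∈ U ∧ U ⊆ W ∧
    ∃ (N : ℕ) (f : Fin N → EuclideanSpace ℂ (Fin n) → ℂ),
      (∀ j, DifferentiableOn ℂ (f j) U) ∧ A ∩ U = {z | z ∈ U ∧ ∀ j, f j z = 0}

/-- An analytic curve in `W`: an analytic subset of (pure) dimension one, that is, one in which
the points where it is a one-dimensional complex submanifold are dense. -/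
def IsAnalyticCurve {n : ℕ} (W A : Set (EuclideanSpace ℂ (Fin n))) : Prop :=
  IsAnalyticSubset W A ∧ A ⊆ closure (regularPart A)

/-- The bilinear form `g_x(v, w) = ω_x(v, J w)`, where `J` is multiplication by `i`. -/
noncomputable def kahlerMetric {n : ℕ}
    (ω : EuclideanSpace ℂ (Fin n) → EuclideanSpace ℂ (Fin n) [⋀^Fin 2]→L[ℝ] ℝ)
    (x v w : EuclideanSpace ℂ (Fin n)) : ℝ :=
  ω x ![v, Complex.I • w]

/-- A smooth Kähler form on the open set `W`: a smooth closed real two-form, invariant under `J`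
(type `(1,1)`), and positive. -/
structure IsKahlerForm {n : ℕ} (W : Set (EuclideanSpace ℂ (Fin n)))
    (ω : EuclideanSpace ℂ (Fin n) → EuclideanSpace ℂ (Fin n) [⋀^Fin 2]→L[ℝ] ℝ) : Prop where
  smooth : ContDiffOn ℝ ((⊤ : ℕ∞) : WithTop ℕ∞) ω W
  closed : ∀ x ∈ W, extDeriv ω x = 0
  invariant : ∀ x ∈ W, ∀ v w, ω x ![Complex.I • v, Complex.I • w] = ω x ![v, w]
  positive : ∀ x ∈ W, ∀ v, v ≠ 0 → 0 < kahlerMetric ω x v v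

/-- `φ : D → Y` is the normalisation map of the analytic curve `Y` by the (smooth) plane domain
`D`: a proper surjective holomorphic map such that the preimage of the regular part is dense in `D`
and is mapped biholomorphically onto the regular part. The last field expresses that the inverse is
well defined and is locally the restriction of a holomorphic function of `n` variables. -/
structure IsNormalizationMap {n : ℕ} (D : Set ℂ) (Y : Set (EuclideanSpace ℂ (Fin n)))
    (φ : ℂ → EuclideanSpace ℂ (Fin n)) : Prop where
  isOpen : IsOpen D
  holomorphic : DifferentiableOn ℂ φ D
  image_eq : φ '' D = Y
  proper : ∀ K, K ⊆ Y → IsCompact K → IsCompact (D ∩ φ ⁻¹' K)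
  dense : D ⊆ closure (D ∩ φ ⁻¹' regularPart Y)
  inverse : ∀ x ∈ regularPart Y, ∃ (U : Set (EuclideanSpace ℂ (Fin n)))
    (h : EuclideanSpace ℂ (Fin n) → ℂ), IsOpen U ∧ x ∈ U ∧ DifferentiableOn ℂ h U ∧
      ∀ z ∈ D, φ z ∈ U → φ z ∈ regularPart Y → h (φ z) = z

/-- Piecewise `C¹` paths `[0,1] → ℂⁿ`: continuous, and `C¹` (up to the end points) on each of the
finitely many intervals of a partition of `[0,1]`. -/
def IsPiecewiseC1 {n : ℕ} (α : ℝ → EuclideanSpace ℂ (Fin n)) : Prop :=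
  ContinuousOn α (Icc 0 1) ∧ ∃ (N : ℕ) (t : Fin (N + 1) → ℝ), Monotone t ∧ t 0 = 0 ∧
    t (Fin.last N) = 1 ∧ ∀ i : Fin N, ContDiffOn ℝ 1 α (Icc (t i.castSucc) (t i.succ))

/-- The length of a path `α : [0,1] → X`: the integral over `α⁻¹(X_reg)` of the `g`-norm of the
velocity. -/
noncomputable def pathLength {n : ℕ}
    (ω : EuclideanSpace ℂ (Fin n) → EuclideanSpace ℂ (Fin n) [⋀^Fin 2]→L[ℝ] ℝ)
    (X : Set (EuclideanSpace ℂ (Fin n))) (α : ℝ → EuclideanSpace ℂ (Fin n)) : ℝ :=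
  ∫ t in Icc (0 : ℝ) 1 ∩ α ⁻¹' regularPart X,
    Real.sqrt (kahlerMetric ω (α t) (deriv α t) (deriv α t))

/-- The intrinsic distance of `(X, ω)`: the infimum of the lengths of the piecewise `C¹` paths in
`X` from `x` to `y`. -/
noncomputable def intrinsicDist {n : ℕ}
    (ω : EuclideanSpace ℂ (Fin n) → EuclideanSpace ℂ (Fin n) [⋀^Fin 2]→L[ℝ] ℝ)
    (X : Set (EuclideanSpace ℂ (Fin n))) (x y : EuclideanSpace ℂ (Fin n)) : ℝ :=
  sInf {l | ∃ α : ℝ → EuclideanSpace ℂ (Fin n), IsPiecewiseC1 α ∧ (∀ t ∈ Icc (0 : ℝ) 1, α t ∈ X) ∧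
    α 0 = x ∧ α 1 = y ∧ l = pathLength ω X α}

/-- A unit speed geodesic `γ : [0,L] → X`: each `t ∈ [0,L]` has a compact neighbourhood `[a,b]` in
`[0,L]` on which `γ` is a unit speed shortest path, `d(γ(s), γ(s')) = |s - s'|`. (This equality
for all `s`, `s'` in `[a,b]` entails that the `d`-length of `γ` on `[a,b]` is
`b - a = d(γ(a), γ(b))`.) -/
def IsUnitSpeedGeodesic {n : ℕ}
    (ω : EuclideanSpace ℂ (Fin n) → EuclideanSpace ℂ (Fin n) [⋀^Fin 2]→L[ℝ] ℝ)
    (X : Set (EuclideanSpace ℂ (Fin n))) (L : ℝ) (γ : ℝ → EuclideanSpace ℂ (Fin n)) : Prop :=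
  (∀ t ∈ Icc 0 L, γ t ∈ X) ∧
    ∀ t ∈ Icc 0 L, ∃ a b : ℝ, Icc a b ⊆ Icc 0 L ∧ Icc a b ∈ 𝓝[Icc 0 L] t ∧
      ∀ s ∈ Icc a b, ∀ s' ∈ Icc a b, intrinsicDist ω X (γ s) (γ s') = |s - s'|

/-- The `C^{0,r}` norm of `f` on `s`: the supremum of the Euclidean norm plus the best Hölder
constant of exponent `r`. -/
noncomputable def holderNormOn {n : ℕ} (r : ℝ≥0) (s : Set ℝ)
    (f : ℝ → EuclideanSpace ℂ (Fin n)) : ℝ≥0∞ :=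
  (⨆ t ∈ s, ‖f t‖ₑ) + eHolderNorm r (s.domRestrict f)

/-!
Put `φ = z^m ψ`. The tangent field `T = ψ + (z / m) ψ'` has first coordinate `1`, it spans the
tangent lines of `X`, and `Λ(z) = |T(z)|_g` is bounded above and below and Lipschitz on the disc.
The form `ω(v, J v)` is conformal, so a path `α` in `X` has `g`-speed `Λ |α̇₀|`, where
`x₀ = z^m` is the first coordinate. Away from `0` a branch of the `m`-th root turns `x₀` into a
chart, in which the intrinsic metric is the flat metric times the conformal factor `Λ`
(`IsBranchedCurve.isConformalDist`). As `Λ` is Lipschitz in `z`, its gradient with respect to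
`w = z^m` is at most a constant times `|z|^(1-m) = |w|^(1/m-1)`.

No geodesic equation is needed. Let `w` be the first coordinate of a geodesic. Comparing `w` with
its deformation `w + ε (tent) v` bounds the second difference `w(t+h) + w(t-h) - 2 w(t)` by the
gradient of the conformal factor times `h²`, for small `h`
(`IsConformalDist.norm_secondDifference_le`). The comparison only uses the infinitesimal behaviour
of the distance: the distance from a fixed point to the deformed curve is estimated through its
Dini derivative (`IsConformalDist.dist_pushed_sub_le`). The geodesic `γ`, a function of `w` with
second derivative of order `|w|^(1/m-1)`, therefore has second differences at most
`K |w|^(1/m-1) h²` (`IsBranchedCurve.eventually_norm_secondDifference_le`).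

A continuous function with nonnegative second differences is convex
(`convexOn_Icc_of_secondDifference_nonneg`), so these bounds make `γ` differentiable with locally
Lipschitz derivative, the local Lipschitz constant being of order `|w|^(1/m-1)`. Near the singular
point `|w|²` is uniformly convex along the geodesic, because `w` has speed bounded below and
`|w| |w|^(1/m-1)` is small; hence `|w(t)|` is at least a constant times `|t - τ|`, where `τ` is the
time of closest approach (`exists_mul_abs_sub_le_norm`). Integrating `|t - τ|^(1/m-1)` gives the
Hölder estimate with exponent `1/m` (`IsBentBy.norm_deriv_sub_le`), with constants that depend
neither on the geodesic nor on its length. By completeness the derivative extends to the end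
points (`differentiableWithinAt_and_norm_derivWithin_sub_le`).
-/

/-! ### Convexity and second differences -/

/-- A continuous function whose symmetric second differences are nonnegative at each interior
point, for all small steps (how small may depend on the point), is convex. -/
theorem convexOn_Icc_of_secondDifference_nonneg {f : ℝ → ℝ} {a b : ℝ}
    (hf : ContinuousOn f (Icc a b))
    (h2 : ∀ t ∈ Ioo a b, ∀ᶠ h in 𝓝[>] (0 : ℝ), 0 ≤ f (t + h) + f (t - h) - 2 * f t) :
    ConvexOn ℝ (Icc a b) f := by
  refine LinearOrder.convexOn_of_lt (convex_Icc a b) ?_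
  intro x hx y hy hxy α β hα hβ hαβ
  by_contra! hcon
  set z := α • x + β • y with hz
  simp only [smul_eq_mul] at hcon hz
  have hβ' : β = 1 - α := by linarith
  have hzx : z - x = β * (y - x) := by rw [hz, hβ']; ring
  have hyz : y - z = α * (y - x) := by rw [hz, hβ']; ring
  have hyx : 0 < y - x := by linarith
  set k := (f y - f x) / (y - x) with hk
  have hky : k * (y - x) = f y - f x := by rw [hk]; field_simp
  set gap := f z - (α * f x + β * f y) with hgap
  have hgap0 : 0 < gap := by rw [hgap]; linarith
  have hq : 0 < (z - x) * (y - z) := by rw [hzx, hyz]; positivity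
  set e := gap / ((z - x) * (y - z) + 1) with he
  have he0 : 0 < e := by positivity
  have heg : e * ((z - x) * (y - z)) < gap := by
    rw [he, div_mul_eq_mul_div, div_lt_iff₀ (by positivity)]
    nlinarith
  -- Subtract the chord and add a small convex parabola; an interior maximum is impossible.
  set F : ℝ → ℝ := fun s => f s - (f x + k * (s - x)) + e * ((s - x) * (s - y)) with hF
  have hFz : 0 < F z := by
    have h1 : k * (z - x) = β * (f y - f x) := by
      rw [hzx, ← hky]; ring
    have : F z = gap - e * ((z - x) * (y - z)) := by
      simp only [hF, h1, hgap]; rw [hβ']; ring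
    linarith
  have hFx : F x = 0 := by simp [hF]
  have hFy : F y = 0 := by simp only [hF]; rw [hky]; ring
  have hsub : Icc x y ⊆ Icc a b := Icc_subset_Icc hx.1 hy.2
  have hFc : ContinuousOn F (Icc x y) := by
    have := hf.mono hsub
    fun_prop
  have hzm : z ∈ Icc x y := ⟨by nlinarith [mul_pos hβ hyx], by nlinarith [mul_pos hα hyx]⟩
  obtain ⟨t, ht, hmax⟩ := isCompact_Icc.exists_isMaxOn ⟨z, hzm⟩ hFc
  have hFt : 0 < F t := lt_of_lt_of_le hFz (hmax hzm)
  have htx : x < t := lt_of_le_of_ne ht.1 (fun hh => by rw [← hh, hFx] at hFt; exact lt_irrefl _ hFt)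
  have hty : t < y := lt_of_le_of_ne ht.2 (fun hh => by rw [hh, hFy] at hFt; exact lt_irrefl _ hFt)
  have hev : ∀ᶠ h in 𝓝[>] (0 : ℝ), h ∈ Ioo 0 (min (t - x) (y - t)) :=
    Ioo_mem_nhdsGT (lt_min (by linarith) (by linarith))
  obtain ⟨h, hh1, hh2⟩ := ((h2 t ⟨hx.1.trans_lt htx, hty.trans_le hy.2⟩).and hev).exists
  have hm1 : h < t - x := hh2.2.trans_le (min_le_left _ _)
  have hm2 : h < y - t := hh2.2.trans_le (min_le_right _ _)
  have e1 : F (t + h) ≤ F t := hmax (show t + h ∈ Icc x y from ⟨by linarith [hh2.1], by linarith⟩)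
  have e2 : F (t - h) ≤ F t := hmax (show t - h ∈ Icc x y from ⟨by linarith, by linarith [hh2.1]⟩)
  have : F (t + h) + F (t - h) - 2 * F t = f (t + h) + f (t - h) - 2 * f t + 2 * e * h ^ 2 := by
    simp only [hF]; ring
  nlinarith [mul_pos he0 (pow_pos hh2.1 2)]

/-- If `k t² / 2 ± f` are both convex then `f` is differentiable. -/
theorem differentiableAt_of_convexOn_of_convexOn {f : ℝ → ℝ} {a b k : ℝ}
    (h1 : ConvexOn ℝ (Icc a b) (fun t => k / 2 * t ^ 2 + f t))
    (h2 : ConvexOn ℝ (Icc a b) (fun t => k / 2 * t ^ 2 - f t)) {t : ℝ} (ht : t ∈ Ioo a b) :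
    DifferentiableAt ℝ f t := by
  have hint : t ∈ interior (Icc a b) := by rwa [interior_Icc]
  have hB : HasDerivAt (fun t : ℝ => k / 2 * t ^ 2) (k * t) t := by
    refine ((hasDerivAt_pow 2 t).const_mul (k / 2)).congr_deriv ?_
    norm_num
    ring
  have hr1 := h1.hasDerivWithinAt_rightDeriv_of_mem_interior hint
  have hl1 := h1.hasDerivWithinAt_leftDeriv_of_mem_interior hint
  have hr2 := h2.hasDerivWithinAt_rightDeriv_of_mem_interior hint
  have hl2 := h2.hasDerivWithinAt_leftDeriv_of_mem_interior hint
  have hle1 := h1.leftDeriv_le_rightDeriv_of_mem_interior hint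
  have hle2 := h2.leftDeriv_le_rightDeriv_of_mem_interior hint
  set r1 := derivWithin (fun t => k / 2 * t ^ 2 + f t) (Ioi t) t
  set l1 := derivWithin (fun t => k / 2 * t ^ 2 + f t) (Iio t) t
  set r2 := derivWithin (fun t => k / 2 * t ^ 2 - f t) (Ioi t) t
  set l2 := derivWithin (fun t => k / 2 * t ^ 2 - f t) (Iio t) t
  have f1 : HasDerivWithinAt f (r1 - k * t) (Ioi t) t :=
    (hr1.sub hB.hasDerivWithinAt).congr (fun x _ => by simp) (by simp)
  have f2 : HasDerivWithinAt f (k * t - r2) (Ioi t) t :=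
    (hB.hasDerivWithinAt.sub hr2).congr (fun x _ => by simp) (by simp)
  have f3 : HasDerivWithinAt f (l1 - k * t) (Iio t) t :=
    (hl1.sub hB.hasDerivWithinAt).congr (fun x _ => by simp) (by simp)
  have f4 : HasDerivWithinAt f (k * t - l2) (Iio t) t :=
    (hB.hasDerivWithinAt.sub hl2).congr (fun x _ => by simp) (by simp)
  have u1 := (uniqueDiffWithinAt_Ioi t).eq_deriv _ f1 f2
  have u2 := (uniqueDiffWithinAt_Iio t).eq_deriv _ f3 f4
  have heq : r1 - k * t = l1 - k * t := by linarith
  have f3' := hasDerivWithinAt_Iio_iff_Iic.1 f3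
  rw [← heq] at f3'
  have := (hasDerivWithinAt_Ioi_iff_Ici.1 f1).union f3'
  rw [union_comm, Iic_union_Ici] at this
  exact (hasDerivWithinAt_univ.1 this).differentiableAt

theorem abs_deriv_sub_deriv_le_of_convexOn_of_convexOn {f : ℝ → ℝ} {a b k : ℝ}
    (h1 : ConvexOn ℝ (Icc a b) (fun t => k / 2 * t ^ 2 + f t))
    (h2 : ConvexOn ℝ (Icc a b) (fun t => k / 2 * t ^ 2 - f t)) {s t : ℝ} (hs : s ∈ Ioo a b)
    (ht : t ∈ Ioo a b) (hst : s ≤ t) :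
    |deriv f t - deriv f s| ≤ k * (t - s) := by
  have hB : ∀ t : ℝ, HasDerivAt (fun t : ℝ => k / 2 * t ^ 2) (k * t) t := fun t => by
    refine ((hasDerivAt_pow 2 t).const_mul (k / 2)).congr_deriv ?_
    norm_num
    ring
  have hd : ∀ t ∈ Ioo a b, HasDerivAt f (deriv f t) t := fun t ht =>
    (differentiableAt_of_convexOn_of_convexOn h1 h2 ht).hasDerivAt
  have m1 := (h1.subset Ioo_subset_Icc_self (convex_Ioo a b)).monotoneOn_deriv
    (fun t ht => ((hB t).add (hd t ht)).differentiableAt) hs ht hst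
  have m2 := (h2.subset Ioo_subset_Icc_self (convex_Ioo a b)).monotoneOn_deriv
    (fun t ht => ((hB t).sub (hd t ht)).differentiableAt) hs ht hst
  have d1 : ∀ t ∈ Ioo a b, deriv (fun t => k / 2 * t ^ 2 + f t) t = k * t + deriv f t :=
    fun t ht => ((hB t).add (hd t ht)).deriv
  have d2 : ∀ t ∈ Ioo a b, deriv (fun t => k / 2 * t ^ 2 - f t) t = k * t - deriv f t :=
    fun t ht => ((hB t).sub (hd t ht)).deriv
  rw [d1 s hs, d1 t ht] at m1
  rw [d2 s hs, d2 t ht] at m2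
  rw [abs_le]; constructor <;> linarith

section SecondDifference

variable {F : Type*} [NormedAddCommGroup F] [NormedSpace ℝ F]

theorem convexOn_of_norm_secondDifference_le {γ : ℝ → F} {a b k : ℝ}
    (hγ : ContinuousOn γ (Icc a b))
    (h2 : ∀ t ∈ Ioo a b, ∀ᶠ h in 𝓝[>] (0 : ℝ),
      ‖γ (t + h) + γ (t - h) - (2 : ℝ) • γ t‖ ≤ k * h ^ 2) (ℓ : StrongDual ℝ F) :
    ConvexOn ℝ (Icc a b) (fun t => (‖ℓ‖ * k) / 2 * t ^ 2 + ℓ (γ t)) := by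
  refine convexOn_Icc_of_secondDifference_nonneg (by fun_prop) fun t ht => ?_
  filter_upwards [h2 t ht] with h hh
  have h1 : |ℓ (γ (t + h) + γ (t - h) - (2 : ℝ) • γ t)| ≤ ‖ℓ‖ * (k * h ^ 2) :=
    (ℓ.le_opNorm _).trans (by gcongr)
  simp only [map_add, map_sub, map_smul, smul_eq_mul] at h1
  nlinarith [(abs_le.1 h1).1]

variable [FiniteDimensional ℝ F]

/-- A continuous curve with second differences `O(h²)` is differentiable. -/
theorem differentiableAt_of_norm_secondDifference_le {γ : ℝ → F} {a b k : ℝ}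
    (hγ : ContinuousOn γ (Icc a b))
    (h2 : ∀ t ∈ Ioo a b, ∀ᶠ h in 𝓝[>] (0 : ℝ),
      ‖γ (t + h) + γ (t - h) - (2 : ℝ) • γ t‖ ≤ k * h ^ 2) {t : ℝ} (ht : t ∈ Ioo a b) :
    DifferentiableAt ℝ γ t := by
  have key : ∀ ℓ : StrongDual ℝ F, DifferentiableAt ℝ (fun s => ℓ (γ s)) t := by
    intro ℓ
    have c1 := convexOn_of_norm_secondDifference_le hγ h2 ℓ
    have c2 := convexOn_of_norm_secondDifference_le hγ h2 (-ℓ)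
    simp only [norm_neg, neg_apply, ← sub_eq_add_neg] at c2
    exact differentiableAt_of_convexOn_of_convexOn c1 c2 ht
  have h3 : DifferentiableAt ℝ (fun s => toEuclidean (γ s)) t := by
    rw [differentiableAt_euclidean]
    intro i
    exact key ((EuclideanSpace.proj i).comp (toEuclidean : F ≃L[ℝ] _).toContinuousLinearMap)
  have := (toEuclidean : F ≃L[ℝ] _).symm.differentiableAt.comp t h3
  exact this.congr_of_eventuallyEq (.of_forall fun s => by simp)

/-- A continuous curve whose second differences are at most `k h²` has `k`-Lipschitz derivative. -/
theorem norm_deriv_sub_deriv_le_of_norm_secondDifference_le {γ : ℝ → F} {a b k : ℝ}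
    (hγ : ContinuousOn γ (Icc a b)) (hk : 0 ≤ k)
    (h2 : ∀ t ∈ Ioo a b, ∀ᶠ h in 𝓝[>] (0 : ℝ),
      ‖γ (t + h) + γ (t - h) - (2 : ℝ) • γ t‖ ≤ k * h ^ 2) {s t : ℝ} (hs : s ∈ Ioo a b)
    (ht : t ∈ Ioo a b) (hst : s ≤ t) :
    ‖deriv γ t - deriv γ s‖ ≤ k * (t - s) := by
  obtain ⟨ℓ, hℓ, hℓ2⟩ := exists_dual_vector'' ℝ (deriv γ t - deriv γ s)
  have c1 := convexOn_of_norm_secondDifference_le hγ h2 ℓ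
  have c2 := convexOn_of_norm_secondDifference_le hγ h2 (-ℓ)
  simp only [norm_neg, neg_apply, ← sub_eq_add_neg] at c2
  have := abs_deriv_sub_deriv_le_of_convexOn_of_convexOn c1 c2 hs ht hst
  have hd : ∀ t ∈ Ioo a b, deriv (fun s => ℓ (γ s)) t = ℓ (deriv γ t) := fun t ht =>
    (ℓ.hasFDerivAt.comp_hasDerivAt t
      (differentiableAt_of_norm_secondDifference_le hγ h2 ht).hasDerivAt).deriv
  rw [hd s hs, hd t ht, ← map_sub, hℓ2] at this
  simp only [RCLike.ofReal_real_eq_id, id_eq, abs_norm] at this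
  refine this.trans ?_
  have : 0 ≤ k * (t - s) := mul_nonneg hk (by linarith)
  nlinarith

end SecondDifference

/-! ### Growth of curves from infinitesimal bounds -/

section Growth

variable {F : Type*} [NormedAddCommGroup F]

/-- A continuous map whose pointwise right increments are dominated by the derivative of `B` has
increments dominated by those of `B`. -/
theorem norm_sub_le_sub_of_right_increment_le {f : ℝ → F} {B B' : ℝ → ℝ} {a b : ℝ} (hab : a ≤ b)
    (hf : ContinuousOn f (Icc a b)) (hB : ContinuousOn B (Icc a b))
    (hB' : ∀ x ∈ Ico a b, HasDerivWithinAt B (B' x) (Ici x) x)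
    (hinc : ∀ x ∈ Ico a b, ∀ᶠ z in 𝓝[>] x, ‖f z - f x‖ ≤ B' x * (z - x)) :
    ‖f b - f a‖ ≤ B b - B a := by
  refine image_le_of_liminf_slope_right_le_deriv_boundary (f := fun x => ‖f x - f a‖)
    (B := fun x => B x - B a) (B' := B') (a := a) (b := b) (by fun_prop) (by simp) (by fun_prop)
    (fun x hx => (hB' x hx).sub_const _) ?_ (right_mem_Icc.2 hab)
  intro x hx r hr
  refine Filter.Eventually.frequently ?_
  filter_upwards [hinc x hx, self_mem_nhdsWithin] with z hz hzx
  have hzx' : 0 < z - x := sub_pos.2 hzx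
  rw [slope_def_field, div_lt_iff₀ hzx']
  have h1 : ‖f z - f a‖ ≤ ‖f z - f x‖ + ‖f x - f a‖ := by
    simpa using norm_sub_le_norm_sub_add_norm_sub (f z) (f x) (f a)
  nlinarith

theorem norm_sub_le_rpow_of_left_pole {f : ℝ → F} {Q p c a b : ℝ} (hp : 0 < p) (hca : c < a)
    (hab : a ≤ b) (hf : ContinuousOn f (Icc a b))
    (hinc : ∀ x ∈ Ico a b, ∀ᶠ z in 𝓝[>] x, ‖f z - f x‖ ≤ Q * |x - c| ^ (p - 1) * (z - x)) :
    ‖f b - f a‖ ≤ Q / p * ((b - c) ^ p - (a - c) ^ p) := by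
  have hd : ∀ x, c < x → HasDerivAt (fun x => Q / p * (x - c) ^ p) (Q * |x - c| ^ (p - 1)) x := by
    intro x hx
    have h0 : x - c ≠ 0 := by linarith
    refine ((((hasDerivAt_id x).sub_const c).rpow_const (p := p) (Or.inl h0)).const_mul
      (Q / p)).congr_deriv ?_
    rw [abs_of_pos (by linarith)]
    simp only [id]
    field_simp
  have := norm_sub_le_sub_of_right_increment_le hab hf (B := fun x => Q / p * (x - c) ^ p)
    (fun x hx => (hd x (hca.trans_le hx.1)).continuousAt.continuousWithinAt)
    (fun x hx => (hd x (hca.trans_le hx.1)).hasDerivWithinAt) hinc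
  linarith [mul_sub (Q / p) ((b - c) ^ p) ((a - c) ^ p)]

theorem norm_sub_le_rpow_of_right_pole {f : ℝ → F} {Q p c a b : ℝ} (hp : 0 < p) (hbc : b ≤ c)
    (hab : a ≤ b) (hf : ContinuousOn f (Icc a b))
    (hinc : ∀ x ∈ Ico a b, ∀ᶠ z in 𝓝[>] x, ‖f z - f x‖ ≤ Q * |x - c| ^ (p - 1) * (z - x)) :
    ‖f b - f a‖ ≤ Q / p * ((c - a) ^ p - (c - b) ^ p) := by
  have hd : ∀ x, x < c → HasDerivAt (fun x => -(Q / p * (c - x) ^ p)) (Q * |x - c| ^ (p - 1)) x := by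
    intro x hx
    have h0 : c - x ≠ 0 := by linarith
    refine ((((hasDerivAt_id x).const_sub c).rpow_const (p := p) (Or.inl h0)).const_mul
      (Q / p)).neg.congr_deriv ?_
    rw [abs_of_neg (by linarith), neg_sub]
    simp only [id]
    field_simp
  have hcont : Continuous fun x : ℝ => -(Q / p * (c - x) ^ p) := by
    have : Continuous fun x : ℝ => (c - x) ^ p :=
      (continuous_const.sub continuous_id).rpow_const fun x => Or.inr hp.le
    fun_prop
  have := norm_sub_le_sub_of_right_increment_le hab hf (B := fun x => -(Q / p * (c - x) ^ p))
    hcont.continuousOn (fun x hx => (hd x (hx.2.trans_le hbc)).hasDerivWithinAt) hinc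
  linarith [mul_sub (Q / p) ((c - a) ^ p) ((c - b) ^ p)]

/-- If the local Lipschitz constant of `f` at `x` is at most `Q |x - c|^(p-1)`, an integrable
singularity, then `f` is `p`-Hölder. -/
theorem norm_sub_le_rpow_of_pole {f : ℝ → F} {Q p c a b : ℝ} (hQ : 0 ≤ Q) (hp : 0 < p)
    (hc : c ∈ Icc a b) (hf : ContinuousOn f (Icc a b))
    (hinc : ∀ x ∈ Ico a b, x ≠ c →
      ∀ᶠ z in 𝓝[>] x, ‖f z - f x‖ ≤ Q * |x - c| ^ (p - 1) * (z - x)) :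
    ‖f b - f a‖ ≤ 2 * (Q / p) * (b - a) ^ p := by
  have hQp : 0 ≤ Q / p := by positivity
  have h1 : ‖f c - f a‖ ≤ Q / p * (b - a) ^ p := by
    have := norm_sub_le_rpow_of_right_pole hp le_rfl hc.1 (hf.mono (Icc_subset_Icc_right hc.2))
      (fun x hx => hinc x ⟨hx.1, hx.2.trans_le hc.2⟩ hx.2.ne)
    refine this.trans (mul_le_mul_of_nonneg_left ?_ hQp)
    rw [sub_self, Real.zero_rpow hp.ne', sub_zero]
    exact Real.rpow_le_rpow (by linarith [hc.1]) (by linarith [hc.2]) hp.le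
  have h2 : ‖f b - f c‖ ≤ Q / p * (b - a) ^ p := by
    rcases hc.2.eq_or_lt with rfl | hcb
    · simpa using mul_nonneg hQp (Real.rpow_nonneg (by linarith [hc.1]) p)
    have hev : ∀ᶠ x in 𝓝[>] c, ‖f b - f x‖ ≤ Q / p * (b - a) ^ p := by
      filter_upwards [Ioo_mem_nhdsGT hcb] with x hx
      have := norm_sub_le_rpow_of_left_pole (Q := Q) hp hx.1 hx.2.le
        (hf.mono (Icc_subset_Icc_left (hc.1.trans hx.1.le)))
        (fun y hy => hinc y ⟨(hc.1.trans hx.1.le).trans hy.1, hy.2⟩ (hx.1.trans_le hy.1).ne')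
      refine this.trans (mul_le_mul_of_nonneg_left ?_ hQp)
      have h3 : (b - c) ^ p ≤ (b - a) ^ p :=
        Real.rpow_le_rpow (by linarith) (by linarith [hc.1]) hp.le
      have h4 : 0 ≤ (x - c) ^ p := Real.rpow_nonneg (by linarith [hx.1]) p
      linarith
    have hlim : Filter.Tendsto f (𝓝[>] c) (𝓝 (f c)) :=
      ((hf c hc).mono_of_mem_nhdsWithin (mem_nhdsGT_iff_exists_Ioo_subset.2
        ⟨b, hcb, fun y hy => ⟨hc.1.trans hy.1.le, hy.2.le⟩⟩)).tendsto
    exact le_of_tendsto (tendsto_const_nhds.sub hlim).norm hev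
  calc ‖f b - f a‖ ≤ ‖f b - f c‖ + ‖f c - f a‖ := norm_sub_le_norm_sub_add_norm_sub _ _ _
    _ ≤ _ := by linarith

end Growth

/-- A plane curve whose speed is at least `c` and whose acceleration at `w` is at most
`K |w|^(p-1)` moves, near the origin, away from its point of closest approach at a definite speed:
`|w|²` is uniformly convex. -/
theorem exists_mul_abs_sub_le_norm {w : ℝ → ℂ} {a b K p c ε : ℝ} (hab : a ≤ b) (hp : 0 < p)
    (hK : 0 ≤ K) (hc : 0 ≤ c) (hε : K * ε ^ p ≤ c ^ 2 / 2)
    (hw : ContinuousOn w (Icc a b)) (hw0 : ∀ t ∈ Ioo a b, w t ≠ 0)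
    (hwε : ∀ t ∈ Icc a b, ‖w t‖ ≤ ε)
    (h2 : ∀ t ∈ Ioo a b, ∀ᶠ h in 𝓝[>] (0 : ℝ),
      ‖w (t + h) + w (t - h) - (2 : ℝ) • w t‖ ≤ K * ‖w t‖ ^ (p - 1) * h ^ 2)
    (h1 : ∀ t ∈ Ioo a b, ∀ᶠ h in 𝓝[>] (0 : ℝ),
      c * h ≤ ‖w (t + h) - w t‖ ∧ c * h ≤ ‖w (t - h) - w t‖) :
    ∃ τ ∈ Icc a b, ∀ t ∈ Icc a b, c / 2 * |t - τ| ≤ ‖w t‖ := by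
  have hconv : ConvexOn ℝ (Icc a b) (fun t => ‖w t‖ ^ 2 - c ^ 2 / 2 * t ^ 2) := by
    refine convexOn_Icc_of_secondDifference_nonneg (by fun_prop) fun t ht => ?_
    filter_upwards [h2 t ht, h1 t ht, self_mem_nhdsWithin] with h hh2 hh1 hpos
    have hpos : 0 < h := hpos
    set u := w (t + h) - w t with hu
    set v := w (t - h) - w t with hv
    have huv : w (t + h) + w (t - h) - (2 : ℝ) • w t = u + v := by
      rw [hu, hv, two_smul]; abel
    rw [huv] at hh2
    have e1 : ‖w (t + h)‖ ^ 2 = ‖w t‖ ^ 2 + 2 * inner ℝ (w t) u + ‖u‖ ^ 2 := by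
      rw [← norm_add_sq_real]; simp [hu]
    have e2 : ‖w (t - h)‖ ^ 2 = ‖w t‖ ^ 2 + 2 * inner ℝ (w t) v + ‖v‖ ^ 2 := by
      rw [← norm_add_sq_real]; simp [hv]
    have e3 : |inner ℝ (w t) (u + v)| ≤ K * ε ^ p * h ^ 2 := by
      refine (abs_real_inner_le_norm _ _).trans ?_
      have hwt : 0 < ‖w t‖ := norm_pos_iff.2 (hw0 t ht)
      have : ‖w t‖ * ‖w t‖ ^ (p - 1) = ‖w t‖ ^ p := by
        rw [Real.rpow_sub_one hwt.ne']; field_simp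
      calc ‖w t‖ * ‖u + v‖ ≤ ‖w t‖ * (K * ‖w t‖ ^ (p - 1) * h ^ 2) := by gcongr
        _ = K * ‖w t‖ ^ p * h ^ 2 := by rw [← this]; ring
        _ ≤ K * ε ^ p * h ^ 2 := by
          have := Real.rpow_le_rpow hwt.le (hwε t ⟨ht.1.le, ht.2.le⟩) hp.le
          gcongr
    rw [inner_add_right] at e3
    have e4 := (abs_le.1 e3).1
    have e5 : (c * h) ^ 2 ≤ ‖u‖ ^ 2 := pow_le_pow_left₀ (by positivity) hh1.1 2
    have e6 : (c * h) ^ 2 ≤ ‖v‖ ^ 2 := pow_le_pow_left₀ (by positivity) hh1.2 2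
    have e7 : K * ε ^ p * h ^ 2 ≤ c ^ 2 / 2 * h ^ 2 := by gcongr
    rw [e1, e2]
    nlinarith
  obtain ⟨τ, hτ, hmin⟩ := isCompact_Icc.exists_isMinOn (nonempty_Icc.2 hab)
    (f := fun t => ‖w t‖ ^ 2) (by fun_prop)
  refine ⟨τ, hτ, fun t ht => ?_⟩
  -- Uniform convexity at the minimum, used at the midpoint of `τ` and `t`.
  have hx := hconv.2 hτ ht (by norm_num : (0 : ℝ) ≤ 1 / 2) (by norm_num : (0 : ℝ) ≤ 1 / 2)
    (by norm_num)
  have hm : ‖w τ‖ ^ 2 ≤ ‖w ((1 / 2 : ℝ) • τ + (1 / 2 : ℝ) • t)‖ ^ 2 :=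
    hmin ((convex_Icc a b) hτ ht (by norm_num : (0 : ℝ) ≤ 1 / 2) (by norm_num : (0 : ℝ) ≤ 1 / 2)
      (by norm_num))
  simp only [smul_eq_mul] at hx hm
  refine abs_le_of_sq_le_sq' ?_ (norm_nonneg _) |>.2
  rw [mul_pow, sq_abs]
  nlinarith [sq_nonneg ‖w τ‖]

/-! ### Hölder estimate for the velocity of a bent curve -/

section Hoelder

variable {F : Type*} [NormedAddCommGroup F] [NormedSpace ℝ F]

/-- Data of a curve `γ` together with a plane curve `w` controlling its second differences:
on the open interval `γ` bends at most like `K |w|^(p-1)`. -/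
structure IsBentBy (γ : ℝ → F) (w : ℝ → ℂ) (L K p : ℝ) : Prop where
  continuousOn : ContinuousOn γ (Icc 0 L)
  ne_zero : ∀ t ∈ Ioo 0 L, w t ≠ 0
  continuousOn_w : ContinuousOn w (Icc 0 L)
  bend : ∀ t ∈ Ioo 0 L, ∀ᶠ h in 𝓝[>] (0 : ℝ),
    ‖γ (t + h) + γ (t - h) - (2 : ℝ) • γ t‖ ≤ K * ‖w t‖ ^ (p - 1) * h ^ 2

namespace IsBentBy

variable {γ : ℝ → F} {w : ℝ → ℂ} {L K p : ℝ}

theorem exists_Ioo_bend (H : IsBentBy γ w L K p) (hK : 0 < K) {t : ℝ} (ht : t ∈ Ioo 0 L) :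
    ∃ r > 0, Icc (t - r) (t + r) ⊆ Ioo 0 L ∧ ∀ s ∈ Ioo (t - r) (t + r),
      ∀ᶠ h in 𝓝[>] (0 : ℝ),
        ‖γ (s + h) + γ (s - h) - (2 : ℝ) • γ s‖ ≤ 2 * K * ‖w t‖ ^ (p - 1) * h ^ 2 := by
  have hwt : 0 < ‖w t‖ := norm_pos_iff.2 (H.ne_zero t ht)
  have hc : ContinuousAt (fun s => K * ‖w s‖ ^ (p - 1)) t := by
    have h1 : ContinuousAt w t := H.continuousOn_w.continuousAt (Icc_mem_nhds ht.1 ht.2)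
    exact continuousAt_const.mul (h1.norm.rpow_const (Or.inl hwt.ne'))
  have hpos : 0 < K * ‖w t‖ ^ (p - 1) := by positivity
  have hev : ∀ᶠ s in 𝓝 t, s ∈ Ioo 0 L ∧ K * ‖w s‖ ^ (p - 1) < 2 * K * ‖w t‖ ^ (p - 1) :=
    Filter.Eventually.and (Ioo_mem_nhds ht.1 ht.2) (hc.eventually_lt_const (by linarith))
  obtain ⟨r, hr, hball⟩ := Metric.nhds_basis_closedBall.eventually_iff.1 hev
  rw [Real.closedBall_eq_Icc] at hball
  refine ⟨r, hr, fun s hs => (hball hs).1, fun s hs => ?_⟩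
  have hs' := hball (Ioo_subset_Icc_self hs)
  filter_upwards [H.bend s hs'.1] with h hh
  exact hh.trans (mul_le_mul_of_nonneg_right hs'.2.le (sq_nonneg h))

variable [FiniteDimensional ℝ F]

theorem differentiableAt (H : IsBentBy γ w L K p) (hK : 0 < K) {t : ℝ} (ht : t ∈ Ioo 0 L) :
    DifferentiableAt ℝ γ t := by
  obtain ⟨r, hr, hsub, hb⟩ := H.exists_Ioo_bend hK ht
  exact differentiableAt_of_norm_secondDifference_le
    (H.continuousOn.mono (hsub.trans Ioo_subset_Icc_self)) hb ⟨by linarith, by linarith⟩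

theorem exists_norm_deriv_sub_le (H : IsBentBy γ w L K p) (hK : 0 < K) {t : ℝ} (ht : t ∈ Ioo 0 L) :
    ∃ r > 0, ∀ s ∈ Ioo (t - r) (t + r), ∀ s' ∈ Ioo (t - r) (t + r), s ≤ s' →
      ‖deriv γ s' - deriv γ s‖ ≤ 2 * K * ‖w t‖ ^ (p - 1) * (s' - s) := by
  obtain ⟨r, hr, hsub, hb⟩ := H.exists_Ioo_bend hK ht
  exact ⟨r, hr, fun s hs s' hs' hss => norm_deriv_sub_deriv_le_of_norm_secondDifference_le
    (H.continuousOn.mono (hsub.trans Ioo_subset_Icc_self)) (by positivity) hb hs hs' hss⟩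

theorem eventually_norm_deriv_sub_le (H : IsBentBy γ w L K p) (hK : 0 < K) {t : ℝ}
    (ht : t ∈ Ioo 0 L) :
    ∀ᶠ z in 𝓝[>] t, ‖deriv γ z - deriv γ t‖ ≤ 2 * K * ‖w t‖ ^ (p - 1) * (z - t) := by
  obtain ⟨r, hr, hb⟩ := H.exists_norm_deriv_sub_le hK ht
  filter_upwards [Ioo_mem_nhdsGT (show t < t + r by linarith)] with z hz
  exact hb t ⟨by linarith, by linarith⟩ z ⟨by linarith [hz.1], hz.2⟩ hz.1.le

theorem continuousOn_deriv (H : IsBentBy γ w L K p) (hK : 0 < K) :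
    ContinuousOn (deriv γ) (Ioo 0 L) := by
  intro t ht
  obtain ⟨r, hr, hb⟩ := H.exists_norm_deriv_sub_le hK ht
  refine ContinuousAt.continuousWithinAt ?_
  have hlip : LipschitzOnWith (2 * K * ‖w t‖ ^ (p - 1)).toNNReal (deriv γ)
      (Ioo (t - r) (t + r)) := by
    refine LipschitzOnWith.of_dist_le_mul fun x hx y hy => ?_
    rw [Real.coe_toNNReal _ (by positivity), dist_eq_norm, Real.dist_eq]
    rcases le_total x y with hxy | hxy
    · rw [norm_sub_rev, abs_sub_comm, abs_of_nonneg (sub_nonneg.2 hxy)]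
      exact hb x hx y hy hxy
    · rw [abs_of_nonneg (sub_nonneg.2 hxy)]
      exact hb y hy x hx hxy
  exact hlip.continuousOn.continuousAt (Ioo_mem_nhds (by linarith) (by linarith))

/-- The Hölder estimate in the interior: where `w` stays away from `0` the derivative is Lipschitz,
and near `0` the point `w` moves away from its closest approach at a definite speed, so that the
bound `K |w|^(p-1)` on the bending is integrable in time. -/
theorem norm_deriv_sub_le {c ε M : ℝ} (H : IsBentBy γ w L K p) (Hw : IsBentBy w w L K p)
    (hK : 0 < K) (hp : 0 < p) (hp1 : p ≤ 1) (hc : 0 < c) (hε : 0 < ε) (hM : 0 < M)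
    (hKε : K * ε ^ p ≤ c ^ 2 / 2)
    (h1 : ∀ t ∈ Ioo 0 L, ∀ᶠ h in 𝓝[>] (0 : ℝ),
      c * h ≤ ‖w (t + h) - w t‖ ∧ c * h ≤ ‖w (t - h) - w t‖)
    (hwM : ∀ t ∈ Ioo 0 L, ‖deriv w t‖ ≤ M) (hγM : ∀ t ∈ Ioo 0 L, ‖deriv γ t‖ ≤ M)
    {s t : ℝ} (hs : s ∈ Ioo 0 L) (ht : t ∈ Ioo 0 L) (hst : s ≤ t) :
    ‖deriv γ t - deriv γ s‖ ≤ (2 * M * (min 1 (ε / (2 * M))) ^ (-p) + 2 * K * (ε / 2) ^ (p - 1)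
      + 2 * ((2 * K * (c / 2) ^ (p - 1)) / p)) * (t - s) ^ p := by
  have hsub : Icc s t ⊆ Ioo 0 L := fun x hx => ⟨hs.1.trans_le hx.1, hx.2.trans_lt ht.2⟩
  have hts : 0 ≤ (t - s) ^ p := Real.rpow_nonneg (by linarith) p
  have hδ : 0 < min 1 (ε / (2 * M)) := lt_min one_pos (by positivity)
  have n1 : 0 ≤ 2 * M * (min 1 (ε / (2 * M))) ^ (-p) := by positivity
  have n2 : 0 ≤ 2 * K * (ε / 2) ^ (p - 1) := by positivity
  have n3 : 0 ≤ 2 * ((2 * K * (c / 2) ^ (p - 1)) / p) := by positivity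
  have hcont : ContinuousOn (deriv γ) (Icc s t) := (H.continuousOn_deriv hK).mono hsub
  rcases le_total (min 1 (ε / (2 * M))) (t - s) with hfar | hnear
  · have h2 : 1 ≤ (min 1 (ε / (2 * M))) ^ (-p) * (t - s) ^ p := by
      rw [Real.rpow_neg hδ.le, ← div_eq_inv_mul, one_le_div (by positivity)]
      exact Real.rpow_le_rpow hδ.le hfar hp.le
    calc ‖deriv γ t - deriv γ s‖ ≤ ‖deriv γ t‖ + ‖deriv γ s‖ := norm_sub_le _ _
      _ ≤ 2 * M * 1 := by linarith [hγM t ht, hγM s hs]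
      _ ≤ 2 * M * ((min 1 (ε / (2 * M))) ^ (-p) * (t - s) ^ p) := by gcongr
      _ ≤ _ := by nlinarith
  by_cases hfar0 : ∃ x ∈ Icc s t, ‖w x‖ < ε / 2
  · obtain ⟨x, hx, hwx⟩ := hfar0
    have hwε : ∀ y ∈ Icc s t, ‖w y‖ ≤ ε := by
      intro y hy
      have h3 : ‖w y - w x‖ ≤ M * ‖y - x‖ :=
        (convex_Icc s t).norm_image_sub_le_of_norm_deriv_le
          (fun z hz => Hw.differentiableAt hK (hsub hz)) (fun z hz => hwM z (hsub hz)) hx hy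
      have h4 : ‖y - x‖ ≤ ε / (2 * M) := by
        rw [Real.norm_eq_abs]
        refine le_trans ?_ (hnear.trans (min_le_right _ _))
        rw [abs_le]; constructor <;> linarith [hx.1, hx.2, hy.1, hy.2]
      have h5 : M * ‖y - x‖ ≤ ε / 2 := by
        calc M * ‖y - x‖ ≤ M * (ε / (2 * M)) := by gcongr
          _ = ε / 2 := by field_simp
      linarith [norm_le_norm_add_norm_sub' (w y) (w x)]
    have hsub' : Ioo s t ⊆ Ioo 0 L := Ioo_subset_Icc_self.trans hsub
    obtain ⟨τ, hτ, hlow⟩ := exists_mul_abs_sub_le_norm hst hp hK.le hc.le hKε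
      (Hw.continuousOn.mono (hsub.trans Ioo_subset_Icc_self)) (fun x hx => Hw.ne_zero x (hsub' hx))
      hwε (fun x hx => Hw.bend x (hsub' hx)) (fun x hx => h1 x (hsub' hx))
    have := norm_sub_le_rpow_of_pole (Q := 2 * K * (c / 2) ^ (p - 1)) (by positivity) hp hτ hcont
      (fun y hy hyτ => ?_)
    · refine this.trans ?_
      nlinarith
    · filter_upwards [H.eventually_norm_deriv_sub_le hK (hsub (Ico_subset_Icc_self hy)),
        self_mem_nhdsWithin] with z hz hyz
      have hyz : y < z := hyz
      refine hz.trans (mul_le_mul_of_nonneg_right ?_ (by linarith))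
      have h6 : 0 < |y - τ| := abs_pos.2 (sub_ne_zero.2 hyτ)
      have h7 : ‖w y‖ ^ (p - 1) ≤ (c / 2 * |y - τ|) ^ (p - 1) :=
        Real.rpow_le_rpow_of_nonpos (by positivity) (hlow y (Ico_subset_Icc_self hy)) (by linarith)
      rw [Real.mul_rpow (by positivity) h6.le] at h7
      calc 2 * K * ‖w y‖ ^ (p - 1) ≤ 2 * K * ((c / 2) ^ (p - 1) * |y - τ| ^ (p - 1)) := by gcongr
        _ = _ := by ring
  · push Not at hfar0
    have := norm_sub_le_sub_of_right_increment_le (f := deriv γ)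
      (B := fun x => 2 * K * (ε / 2) ^ (p - 1) * x) (B' := fun _ => 2 * K * (ε / 2) ^ (p - 1))
      hst hcont (by fun_prop)
      (fun x _ => by simpa using ((hasDerivAt_id x).const_mul _).hasDerivWithinAt)
      (fun x hx => by
        filter_upwards [H.eventually_norm_deriv_sub_le hK (hsub (Ico_subset_Icc_self hx)),
          self_mem_nhdsWithin] with z hz hxz
        have hxz : x < z := hxz
        refine hz.trans (mul_le_mul_of_nonneg_right ?_ (by linarith))
        have := Real.rpow_le_rpow_of_nonpos (by positivity) (hfar0 x (Ico_subset_Icc_self hx))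
          (by linarith : p - 1 ≤ 0)
        gcongr)
    have h8 : t - s ≤ (t - s) ^ p := by
      have h9 : t - s ≤ 1 := hnear.trans (min_le_left _ _)
      rcases (sub_nonneg.2 hst).eq_or_lt with h0 | h0
      · rw [← h0]; exact Real.rpow_nonneg le_rfl p
      · simpa using Real.rpow_le_rpow_of_exponent_ge h0 h9 hp1
    nlinarith

end IsBentBy

/-- A curve that is differentiable in the interior of an interval with `p`-Hölder derivative is
differentiable up to the end points, and its one-sided derivative is `p`-Hölder. -/
theorem differentiableWithinAt_and_norm_derivWithin_sub_le [FiniteDimensional ℝ F]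
    {γ : ℝ → F} {L H p M : ℝ} (hL : 0 < L)
    (hH : 0 ≤ H) (hp : 0 < p) (hγ : ContinuousOn γ (Icc 0 L))
    (hd : ∀ t ∈ Ioo 0 L, DifferentiableAt ℝ γ t) (hM : ∀ t ∈ Ioo 0 L, ‖deriv γ t‖ ≤ M)
    (hh : ∀ s ∈ Ioo 0 L, ∀ t ∈ Ioo 0 L, s ≤ t → ‖deriv γ t - deriv γ s‖ ≤ H * (t - s) ^ p) :
    (∀ t ∈ Icc 0 L, DifferentiableWithinAt ℝ γ (Icc 0 L) t) ∧
    (∀ t ∈ Icc 0 L, ‖derivWithin γ (Icc 0 L) t‖ ≤ M) ∧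
    ∀ s ∈ Icc 0 L, ∀ t ∈ Icc 0 L,
      ‖derivWithin γ (Icc 0 L) t - derivWithin γ (Icc 0 L) s‖ ≤ H * |t - s| ^ p := by
  have hh' : ∀ s ∈ Ioo 0 L, ∀ t ∈ Ioo 0 L, ‖deriv γ t - deriv γ s‖ ≤ H * |t - s| ^ p := by
    intro s hs t ht
    rcases le_total s t with hst | hst
    · rw [abs_of_nonneg (sub_nonneg.2 hst)]; exact hh s hs t ht hst
    · rw [norm_sub_rev, abs_sub_comm, abs_of_nonneg (sub_nonneg.2 hst)]; exact hh t ht s hs hst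
  have huc : UniformContinuousOn (deriv γ) (Ioo 0 L) := by
    have hhold : HolderOnWith H.toNNReal p.toNNReal (deriv γ) (Ioo 0 L) := by
      intro s hs t ht
      rw [edist_dist, edist_dist, ENNReal.ofReal_rpow_of_nonneg dist_nonneg (by positivity),
        ← ENNReal.ofReal_coe_nnreal, ← ENNReal.ofReal_mul (by positivity),
        Real.coe_toNNReal _ hH, Real.coe_toNNReal _ hp.le]
      refine ENNReal.ofReal_le_ofReal ?_
      rw [dist_eq_norm, Real.dist_eq]
      exact hh' t ht s hs
    exact hhold.uniformContinuousOn (by simpa using hp)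
  have hcl : ∀ t ∈ Icc 0 L, t ∈ closure (Ioo 0 L) := fun t ht => by rwa [closure_Ioo hL.ne]
  have hlim : ∀ t ∈ Icc 0 L, ∃ v, Filter.Tendsto (deriv γ) (𝓝[Ioo 0 L] t) (𝓝 v) := by
    intro t ht
    have : (𝓝[Ioo 0 L] t).NeBot := mem_closure_iff_nhdsWithin_neBot.1 (hcl t ht)
    have hcau : Cauchy (Filter.map (deriv γ) (𝓝[Ioo 0 L] t)) := by
      have h1 : Cauchy (𝓝[Ioo 0 L] t) := cauchy_nhds.mono inf_le_left
      exact h1.map_of_le huc inf_le_right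
    exact CompleteSpace.complete hcau
  choose! v hv using hlim
  have hdo : DifferentiableOn ℝ γ (Ioo 0 L) := fun t ht => (hd t ht).differentiableWithinAt
  have hder : ∀ t ∈ Icc 0 L, HasDerivWithinAt γ (v t) (Icc 0 L) t := by
    intro t ht
    have hc0 : ContinuousWithinAt γ (Ioo 0 L) t := (hγ t ht).mono Ioo_subset_Icc_self
    rcases ht.1.eq_or_lt with rfl | h0
    · have h2 := hv 0 ht
      rw [nhdsWithin_Ioo_eq_nhdsGT hL] at h2
      exact (hasDerivWithinAt_Ici_of_tendsto_deriv hdo hc0 (Ioo_mem_nhdsGT hL) h2).mono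
        Icc_subset_Ici_self
    rcases ht.2.eq_or_lt with rfl | h1
    · have h2 := hv t ht
      rw [nhdsWithin_Ioo_eq_nhdsLT hL] at h2
      exact (hasDerivWithinAt_Iic_of_tendsto_deriv hdo hc0 (Ioo_mem_nhdsLT hL) h2).mono
        Icc_subset_Iic_self
    · have h2 := hv t ht
      rw [isOpen_Ioo.nhdsWithin_eq ⟨h0, h1⟩] at h2
      have : deriv γ t = v t :=
        tendsto_nhds_unique (huc.continuousOn.continuousAt (Ioo_mem_nhds h0 h1)).tendsto h2
      rw [← this]
      exact (hd t ⟨h0, h1⟩).hasDerivAt.hasDerivWithinAt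
  have hdw : ∀ t ∈ Icc 0 L, derivWithin γ (Icc 0 L) t = v t := fun t ht =>
    (hder t ht).derivWithin (uniqueDiffOn_Icc hL t ht)
  refine ⟨fun t ht => (hder t ht).differentiableWithinAt, fun t ht => ?_, fun s hs t ht => ?_⟩
  · rw [hdw t ht]
    have : (𝓝[Ioo 0 L] t).NeBot := mem_closure_iff_nhdsWithin_neBot.1 (hcl t ht)
    exact le_of_tendsto (hv t ht).norm (eventually_mem_nhdsWithin.mono fun x hx => hM x hx)
  · rw [hdw t ht, hdw s hs]
    have i1 : (𝓝[Ioo 0 L] t).NeBot := mem_closure_iff_nhdsWithin_neBot.1 (hcl t ht)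
    have i2 : (𝓝[Ioo 0 L] s).NeBot := mem_closure_iff_nhdsWithin_neBot.1 (hcl s hs)
    have h3 : Filter.Tendsto (fun x : ℝ × ℝ => ‖deriv γ x.1 - deriv γ x.2‖)
        (𝓝[Ioo 0 L] t ×ˢ 𝓝[Ioo 0 L] s) (𝓝 ‖v t - v s‖) :=
      (((hv t ht).comp Filter.tendsto_fst).sub ((hv s hs).comp Filter.tendsto_snd)).norm
    have h4 : Filter.Tendsto (fun x : ℝ × ℝ => H * |x.1 - x.2| ^ p)
        (𝓝[Ioo 0 L] t ×ˢ 𝓝[Ioo 0 L] s) (𝓝 (H * |t - s| ^ p)) := by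
      have hcont : Continuous fun x : ℝ × ℝ => H * |x.1 - x.2| ^ p :=
        continuous_const.mul ((continuous_fst.sub continuous_snd).abs.rpow_const
          fun _ => Or.inr hp.le)
      refine (hcont.tendsto (t, s)).mono_left ?_
      rw [nhds_prod_eq]
      exact Filter.prod_mono inf_le_left inf_le_left
    refine le_of_tendsto_of_tendsto h3 h4 ?_
    exact (eventually_mem_nhdsWithin.prod_mk eventually_mem_nhdsWithin).mono
      fun x hx => hh' x.2 hx.2 x.1 hx.1

end Hoelder

/-! ### First variation for conformal distances -/

section FirstVariation

variable {V : Type*} [NormedAddCommGroup V]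

/-- On the ball of radius `η` about `x₀` the function `D` is a distance that is infinitesimally
`lam` times the Euclidean distance, where `lam` is `G`-Lipschitz with values in `[c, C]`. -/
structure IsConformalDist (D : V → V → ℝ) (lam : V → ℝ) (x₀ : V) (η G c C : ℝ) : Prop where
  triangle : ∀ a ∈ Metric.ball x₀ η, ∀ b ∈ Metric.ball x₀ η, ∀ e ∈ Metric.ball x₀ η,
    D a e ≤ D a b + D b e
  upper : ∀ a ∈ Metric.ball x₀ η, ∀ b ∈ Metric.ball x₀ η,
    D a b ≤ (lam a + G * ‖a - b‖) * ‖a - b‖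
  lower : ∀ a ∈ Metric.ball x₀ η, ∀ κ > 0, ∀ᶠ b in 𝓝 a, (lam a - κ) * ‖a - b‖ ≤ D a b
  lip : ∀ a ∈ Metric.ball x₀ η, ∀ b ∈ Metric.ball x₀ η, |lam a - lam b| ≤ G * ‖a - b‖
  le_lam : ∀ a ∈ Metric.ball x₀ η, c ≤ lam a
  lam_le : ∀ a ∈ Metric.ball x₀ η, lam a ≤ C

namespace IsConformalDist

variable {D : V → V → ℝ} {lam : V → ℝ} {x₀ : V} {η G c C : ℝ}

theorem continuousOn_right (H : IsConformalDist D lam x₀ η G c C) (hG : 0 ≤ G) {p : V}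
    (hp : p ∈ Metric.ball x₀ η) : ContinuousOn (D p) (Metric.ball x₀ η) := by
  have key : ∀ a ∈ Metric.ball x₀ η, ∀ b ∈ Metric.ball x₀ η,
      D p a - D p b ≤ (C + G * (2 * η)) * ‖a - b‖ := by
    intro a ha b hb
    have h1 := H.triangle p hp b hb a ha
    have h2 := H.upper b hb a ha
    have h3 : ‖b - a‖ ≤ 2 * η := by
      rw [← dist_eq_norm]
      linarith [dist_triangle_right b a x₀, Metric.mem_ball.1 ha, Metric.mem_ball.1 hb]
    rw [norm_sub_rev a b]
    have h4 : (lam b + G * ‖b - a‖) * ‖b - a‖ ≤ (C + G * (2 * η)) * ‖b - a‖ := by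
      gcongr
      exact H.lam_le b hb
    linarith
  have hlip : LipschitzOnWith (C + G * (2 * η)).toNNReal (D p) (Metric.ball x₀ η) := by
    refine LipschitzOnWith.of_dist_le_mul fun a ha b hb => ?_
    rw [Real.dist_eq, dist_eq_norm]
    refine le_trans ?_ (mul_le_mul_of_nonneg_right (Real.le_coe_toNNReal _) (norm_nonneg _))
    have k1 := key a ha b hb
    have k2 := key b hb a ha
    rw [norm_sub_rev b a] at k2
    rw [abs_le]; constructor <;> linarith
  exact hlip.continuousOn

variable [InnerProductSpace ℝ V]

/-- A unit speed minimising curve pushed sideways by the affine amount `(q s + k) v`: to first order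
the distance to a fixed point `p` grows at most at the rate given by the flat metric
`lam(x₀)² |·|²`. The energy inequality `lam |X| ≤ lam² |X|² / (2 δ) + δ / 2` makes the first
variation visible without dividing by the speed. -/
theorem dist_pushed_sub_le (H : IsConformalDist D lam x₀ η G c C) (hG : 0 ≤ G) (hc : 0 < c)
    {w : ℝ → V} {t h M : ℝ} (hM : 0 ≤ M) (hwt : w t = x₀)
    (hwL : ∀ s ∈ Icc (t - h) (t + h), ∀ s' ∈ Icc (t - h) (t + h), ‖w s - w s'‖ ≤ M * |s - s'|)
    (hgeo : ∀ s ∈ Icc (t - h) (t + h), ∀ s' ∈ Icc (t - h) (t + h), D (w s) (w s') = |s - s'|)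
    {ε q k : ℝ} (hη : M * h + ε < η) {v : V} (hv : ‖v‖ = 1) {s₀ s₁ : ℝ}
    (h0 : t - h ≤ s₀) (h01 : s₀ ≤ s₁) (h1 : s₁ ≤ t + h)
    (hqk : ∀ s ∈ Icc s₀ s₁, |q * s + k| ≤ ε) {p : V} (hp : p ∈ Metric.ball x₀ η) :
    D p (w s₁ + (q * s₁ + k) • v) - D p (w s₀ + (q * s₀ + k) • v)
      - q * lam x₀ ^ 2 * inner ℝ (w s₁ - w s₀) v
      ≤ (s₁ - s₀) * (1 + (2 * |q| * C * G * M ^ 2 * h + C ^ 2 * q ^ 2 / 2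
          + G * ε * (M + |q|))) := by
  have hsub : Icc s₀ s₁ ⊆ Icc (t - h) (t + h) := Icc_subset_Icc h0 h1
  have hε : 0 ≤ ε := (abs_nonneg _).trans (hqk s₀ (left_mem_Icc.2 h01))
  have htm : t ∈ Icc (t - h) (t + h) := by constructor <;> linarith
  have hh0 : 0 ≤ h := by linarith [htm.1]
  have hwc : ContinuousOn w (Icc (t - h) (t + h)) := by
    have : LipschitzOnWith M.toNNReal w (Icc (t - h) (t + h)) :=
      LipschitzOnWith.of_dist_le_mul fun a ha b hb => by
        rw [Real.coe_toNNReal _ hM, dist_eq_norm, Real.dist_eq]; exact hwL a ha b hb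
    exact this.continuousOn
  have hwx : ∀ s ∈ Icc (t - h) (t + h), ‖w s - x₀‖ ≤ M * h := by
    intro s hs
    rw [← hwt]
    refine (hwL s hs t htm).trans (mul_le_mul_of_nonneg_left ?_ hM)
    rw [abs_le]; constructor <;> linarith [hs.1, hs.2]
  have hwb : ∀ s ∈ Icc (t - h) (t + h), w s ∈ Metric.ball x₀ η := fun s hs => by
    rw [mem_ball_iff_norm]; linarith [hwx s hs]
  have hyb : ∀ s ∈ Icc s₀ s₁, w s + (q * s + k) • v ∈ Metric.ball x₀ η := fun s hs => by
    rw [mem_ball_iff_norm, add_sub_right_comm]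
    refine (norm_add_le _ _).trans_lt ?_
    rw [norm_smul, hv, mul_one, Real.norm_eq_abs]
    linarith [hwx s (hsub hs), hqk s hs]
  have hx₀ : x₀ ∈ Metric.ball x₀ η := hwt ▸ hwb t htm
  set E := 2 * |q| * C * G * M ^ 2 * h + C ^ 2 * q ^ 2 / 2 + G * ε * (M + |q|) with hE
  have main := image_le_of_liminf_slope_right_le_deriv_boundary
    (f := fun s => D p (w s + (q * s + k) • v) - q * lam x₀ ^ 2 * inner ℝ (w s) v)
    (a := s₀) (b := s₁)
    (B := fun s => D p (w s₀ + (q * s₀ + k) • v) - q * lam x₀ ^ 2 * inner ℝ (w s₀) v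
      + (s - s₀) * (1 + E)) (B' := fun _ => 1 + E) ?_ (by simp) (by fun_prop) ?_ ?_
    (right_mem_Icc.2 h01)
  · rw [inner_sub_left]
    have : D p (w s₁ + (q * s₁ + k) • v) - q * lam x₀ ^ 2 * inner ℝ (w s₁) v
      ≤ D p (w s₀ + (q * s₀ + k) • v) - q * lam x₀ ^ 2 * inner ℝ (w s₀) v
        + (s₁ - s₀) * (1 + E) := main
    linarith
  · have hw' := hwc.mono hsub
    refine ContinuousOn.sub ((H.continuousOn_right hG hp).comp (by fun_prop) hyb) ?_
    exact continuousOn_const.mul (hw'.inner continuousOn_const)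
  · intro x _
    simpa using ((((hasDerivAt_id x).sub_const s₀).mul_const (1 + E)).const_add
      (D p (w s₀ + (q * s₀ + k) • v) - q * lam x₀ ^ 2 * inner ℝ (w s₀) v)).hasDerivWithinAt
  intro s hs r hr
  refine Filter.Eventually.frequently ?_
  have hs' : s ∈ Icc (t - h) (t + h) := hsub (Ico_subset_Icc_self hs)
  have hsy := hyb s (Ico_subset_Icc_self hs)
  -- Slack in the infinitesimal comparison of `D` with the Euclidean distance.
  obtain ⟨κ, hκ, hκr⟩ : ∃ κ > 0, ((1 + κ * M) ^ 2 + 1) / 2 < 1 + (r - (1 + E)) / 2 := by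
    have hct : Filter.Tendsto (fun κ : ℝ => ((1 + κ * M) ^ 2 + 1) / 2) (𝓝[>] 0) (𝓝 1) := by
      have : Continuous (fun κ : ℝ => ((1 + κ * M) ^ 2 + 1) / 2) := by fun_prop
      have := this.tendsto 0
      norm_num at this
      exact this.mono_left inf_le_left
    have hr' : (1 : ℝ) < 1 + (r - (1 + E)) / 2 := by linarith
    obtain ⟨κ, h1, h2⟩ := ((hct.eventually_lt_const hr').and self_mem_nhdsWithin).exists
    exact ⟨κ, h2, h1⟩
  have hlow : ∀ᶠ z in 𝓝[>] s, (lam (w s) - κ) * ‖w s - w z‖ ≤ D (w s) (w z) := by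
    have hcw : ContinuousWithinAt w (Ioi s) s :=
      (hwc s hs').mono_of_mem_nhdsWithin (mem_nhdsGT_iff_exists_Ioo_subset.2
        ⟨s₁, hs.2, fun y hy => ⟨hs'.1.trans hy.1.le, hy.2.le.trans h1⟩⟩)
    exact hcw.tendsto.eventually (H.lower (w s) (hwb s hs') κ hκ)
  have hsmall : ∀ᶠ z in 𝓝[>] s, G * (M + |q|) ^ 2 * (z - s) < (r - (1 + E)) / 2 := by
    have : Continuous fun z : ℝ => G * (M + |q|) ^ 2 * (z - s) := by fun_prop
    have := this.tendsto s
    simp only [sub_self, mul_zero] at this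
    exact (this.mono_left inf_le_left).eventually_lt_const (by linarith)
  filter_upwards [hlow, hsmall, Ioo_mem_nhdsGT hs.2] with z hz1 hz2 hz3
  have hzm : z ∈ Icc s₀ s₁ := ⟨hs.1.trans hz3.1.le, hz3.2.le⟩
  have hz' := hsub hzm
  have hδ : 0 < z - s := sub_pos.2 hz3.1
  rw [slope_def_field, div_lt_iff₀ hδ]
  set δ := z - s with hδd
  set Δ := w z - w s with hΔ
  set X := Δ + (q * δ) • v with hX
  set l := lam (w s) with hl
  have hl0 : 0 < l := hc.trans_le (H.le_lam _ (hwb s hs'))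
  have hlC : l ≤ C := H.lam_le _ (hwb s hs')
  have hΔM : ‖Δ‖ ≤ M * δ := by
    have := hwL z hz' s hs'
    rwa [abs_of_pos hδ] at this
  have hXn : ‖X‖ ≤ (M + |q|) * δ := by
    refine (norm_add_le _ _).trans ?_
    rw [norm_smul, hv, mul_one, Real.norm_eq_abs, abs_mul, abs_of_pos hδ]
    linarith
  have hyz : w s + (q * s + k) • v - (w z + (q * z + k) • v) = -X := by
    rw [hX, hΔ, hδd, ← sub_eq_zero]
    module
  have t1 := H.triangle p hp _ hsy _ (hyb z hzm)
  have t2 := H.upper _ hsy _ (hyb z hzm)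
  rw [hyz, norm_neg] at t2
  have t3 : lam (w s + (q * s + k) • v) ≤ l + G * ε := by
    have := H.lip _ hsy _ (hwb s hs')
    rw [add_sub_cancel_left, norm_smul, hv, mul_one, Real.norm_eq_abs] at this
    have h3 : G * |q * s + k| ≤ G * ε :=
      mul_le_mul_of_nonneg_left (hqk s (Ico_subset_Icc_self hs)) hG
    linarith [le_abs_self (lam (w s + (q * s + k) • v) - lam (w s))]
  have t4 : D (w s + (q * s + k) • v) (w z + (q * z + k) • v) ≤
      l * ‖X‖ + (G * ε + G * ((M + |q|) * δ)) * ((M + |q|) * δ) := by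
    have h5 : (G * ε + G * ‖X‖) * ‖X‖ ≤ (G * ε + G * ((M + |q|) * δ)) * ((M + |q|) * δ) := by
      gcongr
    have h6 : (lam (w s + (q * s + k) • v) + G * ‖X‖) * ‖X‖ ≤ (l + G * ε + G * ‖X‖) * ‖X‖ := by
      gcongr
    linarith
  have t5 : l * ‖X‖ * δ ≤ l ^ 2 * ‖X‖ ^ 2 / 2 + δ ^ 2 / 2 := by
    nlinarith [sq_nonneg (l * ‖X‖ - δ)]
  have t6 : ‖X‖ ^ 2 = ‖Δ‖ ^ 2 + 2 * (q * δ) * inner ℝ Δ v + (q * δ) ^ 2 := by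
    rw [hX, norm_add_sq_real, inner_smul_right, norm_smul, hv, mul_one, Real.norm_eq_abs, sq_abs]
    ring
  have t7 : l * ‖Δ‖ ≤ δ * (1 + κ * M) := by
    rw [hgeo s hs' z hz', norm_sub_rev, abs_sub_comm, abs_of_pos hδ] at hz1
    have : κ * ‖Δ‖ ≤ κ * (M * δ) := by gcongr
    linarith
  have t8 : l ^ 2 * ‖Δ‖ ^ 2 ≤ δ ^ 2 * (1 + κ * M) ^ 2 := by
    rw [← mul_pow, ← mul_pow]
    exact pow_le_pow_left₀ (by positivity) t7 2
  have t9 : q * l ^ 2 * inner ℝ Δ v ≤ q * lam x₀ ^ 2 * inner ℝ Δ v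
      + δ * (2 * |q| * C * G * M ^ 2 * h) := by
    have i1 : |inner ℝ Δ v| ≤ M * δ := by
      have := abs_real_inner_le_norm Δ v
      rw [hv, mul_one] at this
      exact this.trans hΔM
    have i2 : |l ^ 2 - lam x₀ ^ 2| ≤ 2 * C * (G * (M * h)) := by
      have j1 := H.lip _ (hwb s hs') _ hx₀
      have j2 : G * ‖w s - x₀‖ ≤ G * (M * h) := mul_le_mul_of_nonneg_left (hwx s hs') hG
      have j3 : 0 < lam x₀ := hc.trans_le (H.le_lam _ hx₀)
      have j4 : lam x₀ ≤ C := H.lam_le _ hx₀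
      rw [sq_sub_sq, abs_mul, abs_of_pos (by linarith : 0 < l + lam x₀)]
      exact mul_le_mul (by linarith) (j1.trans j2) (abs_nonneg _) (by linarith)
    have i3 : q * (l ^ 2 - lam x₀ ^ 2) * inner ℝ Δ v ≤ |q| * (2 * C * (G * (M * h))) * (M * δ) := by
      refine (le_abs_self _).trans ?_
      rw [abs_mul, abs_mul]
      have : 0 ≤ C := hl0.le.trans hlC
      gcongr
    have i4 : q * l ^ 2 * inner ℝ Δ v = q * lam x₀ ^ 2 * inner ℝ Δ v
      + q * (l ^ 2 - lam x₀ ^ 2) * inner ℝ Δ v := by ring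
    have i5 : |q| * (2 * C * (G * (M * h))) * (M * δ)
      = δ * (2 * |q| * C * G * M ^ 2 * h) := by ring
    linarith
  have t10 : l ^ 2 * (q * δ) ^ 2 ≤ C ^ 2 * q ^ 2 * δ ^ 2 := by
    rw [mul_pow]
    have : l ^ 2 ≤ C ^ 2 := by gcongr
    rw [mul_assoc]
    gcongr
  -- Divide the energy inequality by the time step.
  have t11 : l * ‖X‖ ≤ q * lam x₀ ^ 2 * inner ℝ Δ v + δ * (((1 + κ * M) ^ 2 + 1) / 2
      + 2 * |q| * C * G * M ^ 2 * h + C ^ 2 * q ^ 2 / 2) := by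
    have : l * ‖X‖ * δ ≤ (q * lam x₀ ^ 2 * inner ℝ Δ v + δ * (((1 + κ * M) ^ 2 + 1) / 2
        + 2 * |q| * C * G * M ^ 2 * h + C ^ 2 * q ^ 2 / 2)) * δ := by
      rw [t6] at t5
      have k1 := mul_le_mul_of_nonneg_right t9 hδ.le
      have k2 : l ^ 2 * (‖Δ‖ ^ 2 + 2 * (q * δ) * inner ℝ Δ v + (q * δ) ^ 2) / 2
        = l ^ 2 * ‖Δ‖ ^ 2 / 2 + q * l ^ 2 * inner ℝ Δ v * δ + l ^ 2 * (q * δ) ^ 2 / 2 := by ring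
      have k3 : (q * lam x₀ ^ 2 * inner ℝ Δ v + δ * (((1 + κ * M) ^ 2 + 1) / 2
        + 2 * |q| * C * G * M ^ 2 * h + C ^ 2 * q ^ 2 / 2)) * δ
        = (q * lam x₀ ^ 2 * inner ℝ Δ v + δ * (2 * |q| * C * G * M ^ 2 * h)) * δ
          + δ ^ 2 * (1 + κ * M) ^ 2 / 2 + δ ^ 2 / 2 + C ^ 2 * q ^ 2 * δ ^ 2 / 2 := by ring
      rw [k3]
      rw [k2] at t5
      linarith
    exact le_of_mul_le_mul_right this hδ
  have t12 : inner ℝ Δ v = inner ℝ (w z) v - inner ℝ (w s) v := inner_sub_left _ _ _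
  rw [t12] at t11
  have t13 : δ * (((1 + κ * M) ^ 2 + 1) / 2 + G * (M + |q|) ^ 2 * δ
      + 2 * |q| * C * G * M ^ 2 * h + C ^ 2 * q ^ 2 / 2 + G * ε * (M + |q|)) < δ * r := by
    refine mul_lt_mul_of_pos_left ?_ hδ
    linarith
  have t14 : (G * ε + G * ((M + |q|) * δ)) * ((M + |q|) * δ)
    = δ * (G * (M + |q|) ^ 2 * δ + G * ε * (M + |q|)) := by ring
  have t15 : q * lam x₀ ^ 2 * (inner ℝ (w z) v - inner ℝ (w s) v)
    = q * lam x₀ ^ 2 * inner ℝ (w z) v - q * lam x₀ ^ 2 * inner ℝ (w s) v := by ring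
  rw [mul_comm r δ]
  linarith

/-- The second differences of a unit speed minimising curve are bounded by the gradient `G` of the
conformal factor: compare the curve with its deformation by a small tent. -/
theorem norm_secondDifference_le (H : IsConformalDist D lam x₀ η G c C) (hG : 0 ≤ G) (hc : 0 < c)
    {w : ℝ → V} {t h M : ℝ} (hh : 0 < h) (hM : 0 ≤ M) (hwt : w t = x₀)
    (hwL : ∀ s ∈ Icc (t - h) (t + h), ∀ s' ∈ Icc (t - h) (t + h), ‖w s - w s'‖ ≤ M * |s - s'|)
    (hgeo : ∀ s ∈ Icc (t - h) (t + h), ∀ s' ∈ Icc (t - h) (t + h), D (w s) (w s') = |s - s'|)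
    (hη : M * h < η) :
    ‖w (t + h) + w (t - h) - (2 : ℝ) • w t‖ ≤ 2 * (2 * C * M ^ 2 + M) / c ^ 2 * G * h ^ 2 := by
  set S := w (t + h) + w (t - h) - (2 : ℝ) • w t with hS
  rcases eq_or_ne S 0 with h0 | hS0
  · have hx₀ : x₀ ∈ Metric.ball x₀ η := Metric.mem_ball_self (by nlinarith)
    have : 0 ≤ C := by linarith [H.le_lam x₀ hx₀, H.lam_le x₀ hx₀]
    rw [h0, norm_zero]; positivity
  have hSn : 0 < ‖S‖ := norm_pos_iff.2 hS0
  set v := ‖S‖⁻¹ • S with hvd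
  have hv : ‖v‖ = 1 := by rw [hvd, norm_smul, norm_inv, norm_norm, inv_mul_cancel₀ hSn.ne']
  have hSv : inner ℝ S v = ‖S‖ := by
    rw [hvd, inner_smul_right, real_inner_self_eq_norm_sq]; field_simp
  have hm : t - h ∈ Icc (t - h) (t + h) := by constructor <;> linarith
  have hm' : t + h ∈ Icc (t - h) (t + h) := by constructor <;> linarith
  have htm : t ∈ Icc (t - h) (t + h) := by constructor <;> linarith
  have hp : w (t - h) ∈ Metric.ball x₀ η := by
    rw [mem_ball_iff_norm, ← hwt]
    refine (hwL _ hm t htm).trans_lt ?_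
    rwa [sub_sub_cancel_left, abs_neg, abs_of_pos hh]
  have hx₀ : x₀ ∈ Metric.ball x₀ η := Metric.mem_ball_self (by nlinarith)
  have key : ∀ ε : ℝ, 0 < ε → M * h + ε < η → c ^ 2 * ‖S‖ ≤
      2 * (2 * C * M ^ 2 + M) * G * h ^ 2 + ε * (C ^ 2 + 2 * G * h) := by
    intro ε hε hεη
    have a1 := H.dist_pushed_sub_le hG hc hM hwt hwL hgeo hεη (q := ε / h) (k := ε - ε / h * t) hv
      (s₀ := t - h) (s₁ := t) le_rfl (by linarith) (by linarith) (fun s hs => by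
        have : ε / h * s + (ε - ε / h * t) = ε * (1 - (t - s) / h) := by field_simp; ring
        rw [this, abs_mul, abs_of_pos hε]
        refine mul_le_of_le_one_right hε.le ?_
        have i1 : 0 ≤ (t - s) / h := div_nonneg (by linarith [hs.2]) hh.le
        have i2 : (t - s) / h ≤ 1 := (div_le_one hh).2 (by linarith [hs.1])
        rw [abs_le]; constructor <;> linarith) hp
    have a2 := H.dist_pushed_sub_le hG hc hM hwt hwL hgeo hεη (q := -(ε / h)) (k := ε + ε / h * t) hv
      (s₀ := t) (s₁ := t + h) (by linarith) (by linarith) le_rfl (fun s hs => by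
        have : -(ε / h) * s + (ε + ε / h * t) = ε * (1 - (s - t) / h) := by field_simp; ring
        rw [this, abs_mul, abs_of_pos hε]
        refine mul_le_of_le_one_right hε.le ?_
        have i1 : 0 ≤ (s - t) / h := div_nonneg (by linarith [hs.1]) hh.le
        have i2 : (s - t) / h ≤ 1 := (div_le_one hh).2 (by linarith [hs.2])
        rw [abs_le]; constructor <;> linarith) hp
    have e1 : ε / h * (t - h) + (ε - ε / h * t) = 0 := by field_simp; ring
    have e2 : ε / h * t + (ε - ε / h * t) = ε := by ring
    have e3 : -(ε / h) * t + (ε + ε / h * t) = ε := by ring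
    have e4 : -(ε / h) * (t + h) + (ε + ε / h * t) = 0 := by field_simp; ring
    rw [e1, e2, zero_smul, add_zero, hgeo _ hm _ hm, sub_self, abs_zero,
      abs_of_pos (by positivity)] at a1
    rw [e3, e4, zero_smul, add_zero, hgeo _ hm _ hm', abs_neg, abs_of_pos (by positivity : 0 < ε / h),
      abs_sub_comm, abs_of_pos (by linarith)] at a2
    have e5 : inner ℝ (w (t + h) - w t) v - inner ℝ (w t - w (t - h)) v = ‖S‖ := by
      rw [← hSv, ← inner_sub_left]
      congr 1
      rw [hS, two_smul]; abel
    have a3 : ε / h * lam x₀ ^ 2 * ‖S‖ ≤ 2 * h * (2 * (ε / h) * C * G * M ^ 2 * h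
        + C ^ 2 * (ε / h) ^ 2 / 2 + G * ε * (M + ε / h)) := by
      rw [← e5]
      nlinarith
    have a4 : ε / h * (lam x₀ ^ 2 * ‖S‖) ≤ ε / h * (2 * (2 * C * M ^ 2 + M) * G * h ^ 2
        + ε * (C ^ 2 + 2 * G * h)) := by
      calc ε / h * (lam x₀ ^ 2 * ‖S‖) = ε / h * lam x₀ ^ 2 * ‖S‖ := by ring
        _ ≤ _ := a3
        _ = _ := by field_simp; ring
    have a5 := le_of_mul_le_mul_left a4 (by positivity)
    refine le_trans ?_ a5
    have := H.le_lam x₀ hx₀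
    gcongr
  have hlim : c ^ 2 * ‖S‖ ≤ 2 * (2 * C * M ^ 2 + M) * G * h ^ 2 := by
    have hct : Filter.Tendsto (fun ε : ℝ => 2 * (2 * C * M ^ 2 + M) * G * h ^ 2
        + ε * (C ^ 2 + 2 * G * h)) (𝓝[>] 0) (𝓝 (2 * (2 * C * M ^ 2 + M) * G * h ^ 2)) := by
      have : Continuous (fun ε : ℝ => 2 * (2 * C * M ^ 2 + M) * G * h ^ 2
        + ε * (C ^ 2 + 2 * G * h)) := by fun_prop
      have := this.tendsto 0
      rw [zero_mul, add_zero] at this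
      exact this.mono_left inf_le_left
    refine ge_of_tendsto hct ?_
    filter_upwards [Ioo_mem_nhdsGT (show (0 : ℝ) < η - M * h by linarith)] with ε hε
    exact key ε hε.1 (by linarith [hε.2])
  rw [div_mul_eq_mul_div, div_mul_eq_mul_div, le_div_iff₀ (by positivity)]
  linarith

end IsConformalDist

end FirstVariation

/-! ### Alternating forms and piecewise `C¹` paths -/

section HermitianForm

variable {n : ℕ}

local notation "𝔼" => EuclideanSpace ℂ (Fin n)

theorem alternating_two_swap (a : 𝔼 [⋀^Fin 2]→L[ℝ] ℝ) (v w : 𝔼) : a ![v, w] = -a ![w, v] := by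
  have h := a.toAlternatingMap.map_swap ![w, v] (show (0 : Fin 2) ≠ 1 by decide)
  have h2 : (![w, v] ∘ ⇑(Equiv.swap (0 : Fin 2) 1) : Fin 2 → 𝔼) = ![v, w] := by
    ext i; fin_cases i <;> simp
  rw [h2] at h
  exact h

theorem alternating_two_add_left (a : 𝔼 [⋀^Fin 2]→L[ℝ] ℝ) (u v w : 𝔼) :
    a ![u + v, w] = a ![u, w] + a ![v, w] := a.vecCons_add ![w] u v

theorem alternating_two_add_right (a : 𝔼 [⋀^Fin 2]→L[ℝ] ℝ) (u v w : 𝔼) :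
    a ![w, u + v] = a ![w, u] + a ![w, v] := by
  rw [alternating_two_swap, alternating_two_add_left, alternating_two_swap a w u,
    alternating_two_swap a w v, neg_add]

theorem alternating_two_smul_left (a : 𝔼 [⋀^Fin 2]→L[ℝ] ℝ) (c : ℝ) (v w : 𝔼) :
    a ![c • v, w] = c * a ![v, w] := a.vecCons_smul ![w] c v

theorem alternating_two_smul_right (a : 𝔼 [⋀^Fin 2]→L[ℝ] ℝ) (c : ℝ) (v w : 𝔼) :
    a ![w, c • v] = c * a ![w, v] := by
  rw [alternating_two_swap, alternating_two_smul_left, alternating_two_swap a w v, mul_neg]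

theorem alternating_two_self (a : 𝔼 [⋀^Fin 2]→L[ℝ] ℝ) (v : 𝔼) : a ![v, v] = 0 := by
  linarith [alternating_two_swap a v v]

theorem abs_alternating_two_le (a : 𝔼 [⋀^Fin 2]→L[ℝ] ℝ) (v w : 𝔼) :
    |a ![v, w]| ≤ ‖a‖ * (‖v‖ * ‖w‖) := by
  have := a.le_opNorm ![v, w]
  simpa [Fin.prod_univ_two] using this

/-- The form `ω(v, J v)` is conformal: it scales by `|c|²` under multiplication by `c ∈ ℂ`. -/
theorem kahlerMetric_smul_smul (ω : 𝔼 → 𝔼 [⋀^Fin 2]→L[ℝ] ℝ) (x v : 𝔼) (c : ℂ) :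
    kahlerMetric ω x (c • v) (c • v) = ‖c‖ ^ 2 * kahlerMetric ω x v v := by
  have h1 : c • v = c.re • v + c.im • (Complex.I • v) := by
    rw [← Complex.coe_smul, ← Complex.coe_smul, smul_smul, ← add_smul, Complex.re_add_im]
  have h2 : Complex.I • c • v = c.re • (Complex.I • v) + (-c.im) • v := by
    rw [← Complex.coe_smul, ← Complex.coe_smul, smul_smul, smul_smul, ← add_smul]
    congr 1
    apply Complex.ext <;> simp
  unfold kahlerMetric
  rw [h2, h1, alternating_two_add_left, alternating_two_add_right, alternating_two_add_right]
  simp only [alternating_two_smul_left, alternating_two_smul_right, alternating_two_self]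
  rw [alternating_two_swap (ω x) (Complex.I • v) v, Complex.sq_norm, Complex.normSq_apply]
  ring

theorem abs_kahlerMetric_self_le (ω : 𝔼 → 𝔼 [⋀^Fin 2]→L[ℝ] ℝ) (x v : 𝔼) :
    |kahlerMetric ω x v v| ≤ ‖ω x‖ * ‖v‖ ^ 2 := by
  have := abs_alternating_two_le (ω x) v (Complex.I • v)
  rwa [norm_smul, Complex.norm_I, one_mul, ← sq] at this

theorem abs_kahlerMetric_sub_le (ω : 𝔼 → 𝔼 [⋀^Fin 2]→L[ℝ] ℝ) (x y v w : 𝔼) :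
    |kahlerMetric ω x v v - kahlerMetric ω y w w| ≤
      ‖ω x - ω y‖ * ‖v‖ ^ 2 + ‖ω y‖ * ((‖v‖ + ‖w‖) * ‖v - w‖) := by
  have e : kahlerMetric ω x v v - kahlerMetric ω y w w = (ω x - ω y) ![v, Complex.I • v]
      + (ω y ![v - w, Complex.I • v] + ω y ![w, Complex.I • (v - w)]) := by
    have h1 : ω y ![v, Complex.I • v] = ω y ![v - w, Complex.I • v] + ω y ![w, Complex.I • v] := by
      rw [← alternating_two_add_left, sub_add_cancel]
    have h2 : ω y ![w, Complex.I • v]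
        = ω y ![w, Complex.I • (v - w)] + ω y ![w, Complex.I • w] := by
      rw [← alternating_two_add_right, ← smul_add, sub_add_cancel]
    have h3 : (ω x - ω y) ![v, Complex.I • v]
        = ω x ![v, Complex.I • v] - ω y ![v, Complex.I • v] := rfl
    unfold kahlerMetric
    linarith
  have n1 := abs_alternating_two_le (ω x - ω y) v (Complex.I • v)
  have n2 := abs_alternating_two_le (ω y) (v - w) (Complex.I • v)
  have n3 := abs_alternating_two_le (ω y) w (Complex.I • (v - w))
  rw [norm_smul, Complex.norm_I, one_mul] at n1 n2 n3
  rw [e]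
  refine (abs_add_le _ _).trans (add_le_add (by rwa [sq]) ((abs_add_le _ _).trans ?_))
  linarith

theorem continuous_alternating_two_eval :
    Continuous fun q : (𝔼 [⋀^Fin 2]→L[ℝ] ℝ) × 𝔼 => q.1 ![q.2, Complex.I • q.2] := by
  have h2 : Continuous fun q : (𝔼 [⋀^Fin 2]→L[ℝ] ℝ) × 𝔼 => (![q.2, Complex.I • q.2] : Fin 2 → 𝔼) := by
    have h3 : Continuous fun q : (𝔼 [⋀^Fin 2]→L[ℝ] ℝ) × 𝔼 => q.2 := continuous_snd
    exact continuous_pi (Fin.forall_fin_two.2 ⟨h3, h3.const_smul Complex.I⟩)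
  have h1 : Continuous fun q : (𝔼 [⋀^Fin 2]→L[ℝ] ℝ) × 𝔼 => q.1 := continuous_fst
  exact h1.eval h2

end HermitianForm

section PiecewiseC1

variable {n : ℕ}

local notation "𝔼" => EuclideanSpace ℂ (Fin n)

theorem isPiecewiseC1_iff_nat {α : ℝ → 𝔼} :
    IsPiecewiseC1 α ↔ ContinuousOn α (Icc 0 1) ∧ ∃ (N : ℕ) (t : ℕ → ℝ), Monotone t ∧ t 0 = 0 ∧
      t N = 1 ∧ ∀ i < N, ContDiffOn ℝ 1 α (Icc (t i) (t (i + 1))) := by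
  refine and_congr_right fun _ => ⟨?_, ?_⟩
  · rintro ⟨N, t, ht, h0, h1, hd⟩
    refine ⟨N, fun i => t ⟨min i N, by omega⟩, fun i j hij => ht ?_, ?_, ?_, fun i hi => ?_⟩
    · simp only [Fin.mk_le_mk]; omega
    · simp only [Nat.zero_min]; exact h0
    · simp only [min_self]; exact h1
    · have := hd ⟨i, hi⟩
      have e1 : (⟨min i N, by omega⟩ : Fin (N + 1)) = (⟨i, hi⟩ : Fin N).castSucc := by
        ext; simp; omega
      have e2 : (⟨min (i + 1) N, by omega⟩ : Fin (N + 1)) = (⟨i, hi⟩ : Fin N).succ := by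
        ext; simp; omega
      simp only [e1, e2]
      exact this
  · rintro ⟨N, t, ht, h0, h1, hd⟩
    exact ⟨N, fun i => t i, fun i j hij => ht hij, by simpa using h0, by simpa using h1,
      fun i => by simpa using hd i i.2⟩

theorem exists_mem_Ioo_of_partition {N : ℕ} {t : ℕ → ℝ} (h0 : t 0 = 0) (h1 : t N = 1) {x : ℝ}
    (hx : x ∈ Icc (0 : ℝ) 1) (hxt : ∀ i ≤ N, x ≠ t i) : ∃ i < N, x ∈ Ioo (t i) (t (i + 1)) := by
  classical
  have hex : ∃ i, x < t i := ⟨N, lt_of_le_of_ne (h1 ▸ hx.2) (hxt N le_rfl)⟩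
  have hle : Nat.find hex ≤ N := Nat.find_min' hex (lt_of_le_of_ne (h1 ▸ hx.2) (hxt N le_rfl))
  have hne : Nat.find hex ≠ 0 := by
    intro h
    have := Nat.find_spec hex
    rw [h, h0] at this
    linarith [hx.1]
  obtain ⟨i, hi⟩ := Nat.exists_eq_succ_of_ne_zero hne
  refine ⟨i, by omega, ?_, ?_⟩
  · have : ¬ x < t i := Nat.find_min hex (by omega)
    exact lt_of_le_of_ne (not_lt.1 this) (Ne.symm (hxt i (by omega)))
  · have := Nat.find_spec hex
    rwa [hi] at this

/-- Off finitely many times a piecewise `C¹` path is differentiable, with bounded derivative. -/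
theorem IsPiecewiseC1.exists_finite_differentiableAt {α : ℝ → 𝔼} (hα : IsPiecewiseC1 α) :
    ∃ (S : Set ℝ) (M : ℝ), S.Finite ∧ 0 ≤ M ∧ ∀ x ∈ Icc (0 : ℝ) 1 \ S,
      x ∈ Ioo (0 : ℝ) 1 ∧ DifferentiableAt ℝ α x ∧ ‖deriv α x‖ ≤ M := by
  obtain ⟨-, N, t, ht, h0, h1, hd⟩ := isPiecewiseC1_iff_nat.1 hα
  have hb : ∀ i < N, ∃ M, 0 ≤ M ∧ ∀ x ∈ Ioo (t i) (t (i + 1)),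
      DifferentiableAt ℝ α x ∧ ‖deriv α x‖ ≤ M := by
    intro i hi
    rcases (ht i.le_succ).eq_or_lt with heq | hlt
    · exact ⟨0, le_rfl, fun x hx => absurd (hx.1.trans hx.2) (by simp [heq])⟩
    have hc : ContinuousOn (derivWithin α (Icc (t i) (t (i + 1)))) (Icc (t i) (t (i + 1))) :=
      (hd i hi).continuousOn_derivWithin (uniqueDiffOn_Icc hlt) le_rfl
    obtain ⟨M, hM⟩ := isCompact_Icc.exists_bound_of_continuousOn hc
    refine ⟨M, (norm_nonneg _).trans (hM (t i) (left_mem_Icc.2 hlt.le)), fun x hx => ?_⟩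
    have hnhds : Icc (t i) (t (i + 1)) ∈ 𝓝 x := Icc_mem_nhds hx.1 hx.2
    refine ⟨((hd i hi).differentiableOn one_ne_zero).differentiableAt hnhds, ?_⟩
    rw [← derivWithin_of_mem_nhds hnhds]
    exact hM x (Ioo_subset_Icc_self hx)
  choose! M hM0 hM using hb
  refine ⟨t '' (Finset.range (N + 1)), ∑ i ∈ Finset.range N, M i, (Finset.finite_toSet _).image t,
    Finset.sum_nonneg fun i hi => hM0 i (Finset.mem_range.1 hi), fun x hx => ?_⟩
  have hxt : ∀ i ≤ N, x ≠ t i := fun i hi he => hx.2 ⟨i, by simp; omega, he.symm⟩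
  obtain ⟨i, hi, hxi⟩ := exists_mem_Ioo_of_partition h0 h1 hx.1 hxt
  refine ⟨⟨lt_of_le_of_ne hx.1.1 (h0 ▸ (hxt 0 (Nat.zero_le _)).symm),
    lt_of_le_of_ne hx.1.2 (h1 ▸ hxt N le_rfl)⟩, (hM i hi x hxi).1, (hM i hi x hxi).2.trans ?_⟩
  exact Finset.single_le_sum (fun j hj => hM0 j (Finset.mem_range.1 hj)) (Finset.mem_range.2 hi)

/-- The path that runs through `α` and then through `β`, each at double speed. -/
noncomputable def concatPath (α β : ℝ → 𝔼) (t : ℝ) : 𝔼 :=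
  if t ≤ 1 / 2 then α (2 * t) else β (2 * t - 1)

theorem concatPath_eqOn_left (α β : ℝ → 𝔼) :
    EqOn (concatPath α β) (fun t => α (2 * t)) (Iic (1 / 2)) := fun _ ht => if_pos ht

theorem concatPath_eqOn_right {α β : ℝ → 𝔼} (h : α 1 = β 0) :
    EqOn (concatPath α β) (fun t => β (2 * t - 1)) (Ici (1 / 2)) := by
  intro t ht
  rcases (mem_Ici.1 ht).eq_or_lt with rfl | h'
  · simp [concatPath, h]
  · simp only [concatPath, if_neg (not_le.2 h')]

theorem IsPiecewiseC1.concat {α β : ℝ → 𝔼} (hα : IsPiecewiseC1 α) (hβ : IsPiecewiseC1 β)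
    (h : α 1 = β 0) : IsPiecewiseC1 (concatPath α β) := by
  obtain ⟨cα, N, t, ht, t0, t1, hd⟩ := isPiecewiseC1_iff_nat.1 hα
  obtain ⟨cβ, N', t', ht', t0', t1', hd'⟩ := isPiecewiseC1_iff_nat.1 hβ
  refine isPiecewiseC1_iff_nat.2 ⟨?_, N + N',
    fun i => if i ≤ N then t i / 2 else (1 + t' (i - N)) / 2, ?_, ?_, ?_, ?_⟩
  · have e : Icc (0 : ℝ) 1 = Icc 0 (1 / 2) ∪ Icc (1 / 2) 1 :=
      (Icc_union_Icc_eq_Icc (by norm_num) (by norm_num)).symm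
    rw [e]
    refine ContinuousOn.union_of_isClosed ?_ ?_ isClosed_Icc isClosed_Icc
    · refine ContinuousOn.congr ?_ ((concatPath_eqOn_left α β).mono Icc_subset_Iic_self)
      exact cα.comp (by fun_prop) fun x hx => ⟨by linarith [hx.1], by linarith [hx.2]⟩
    · refine ContinuousOn.congr ?_ ((concatPath_eqOn_right h).mono Icc_subset_Ici_self)
      exact cβ.comp (by fun_prop) fun x hx => ⟨by linarith [hx.1], by linarith [hx.2]⟩
  · refine monotone_nat_of_le_succ fun i => ?_
    rcases lt_trichotomy i N with hi | rfl | hi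
    · simp only [if_pos hi.le, if_pos (Nat.succ_le_of_lt hi)]
      linarith [ht i.le_succ]
    · simp only [le_refl, if_true, if_neg (Nat.not_succ_le_self i), t1]
      linarith [ht' (Nat.zero_le (i + 1 - i))]
    · simp only [if_neg (by omega : ¬ i ≤ N), if_neg (by omega : ¬ i + 1 ≤ N)]
      linarith [ht' (show i - N ≤ i + 1 - N by omega)]
  · simp [t0]
  · rcases Nat.eq_zero_or_pos N' with rfl | hN'
    · linarith
    · simp only [if_neg (by omega : ¬ N + N' ≤ N), Nat.add_sub_cancel_left, t1']
      norm_num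
  · intro i hi
    have hd2 : ContDiff ℝ 1 fun s : ℝ => 2 * s := by fun_prop
    have hd3 : ContDiff ℝ 1 fun s : ℝ => 2 * s - 1 := by fun_prop
    rcases lt_or_ge i N with hiN | hiN
    · simp only [if_pos hiN.le, if_pos (Nat.succ_le_of_lt hiN)]
      have hle : t (i + 1) ≤ 1 := t1 ▸ ht (Nat.succ_le_of_lt hiN)
      refine ContDiffOn.congr ?_ ((concatPath_eqOn_left α β).mono fun x hx => ?_)
      · exact (hd i hiN).comp hd2.contDiffOn fun x hx => ⟨by linarith [hx.1], by linarith [hx.2]⟩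
      · exact mem_Iic.2 (by linarith [hx.2])
    · have e1 : (if i ≤ N then t i / 2 else (1 + t' (i - N)) / 2) = (1 + t' (i - N)) / 2 := by
        split_ifs with hc
        · obtain rfl : i = N := le_antisymm hc hiN
          simp [t1, t0']
        · rfl
      have e2 : i + 1 - N = i - N + 1 := by omega
      simp only [e1, if_neg (by omega : ¬ i + 1 ≤ N), e2]
      have hge : 0 ≤ t' (i - N) := t0' ▸ ht' (Nat.zero_le _)
      refine ContDiffOn.congr ?_ ((concatPath_eqOn_right h).mono fun x hx => ?_)
      · exact (hd' (i - N) (by omega)).comp hd3.contDiffOn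
          fun x hx => ⟨by linarith [hx.1], by linarith [hx.2]⟩
      · exact mem_Ici.2 (by linarith [hx.1])

end PiecewiseC1

/-! ### The intrinsic distance -/

section IntrinsicDistance

variable {n : ℕ}

local notation "𝔼" => EuclideanSpace ℂ (Fin n)

/-- A set on which `ω` is continuous, whose only singular point is `0`, and any two points of which
are joined by a piecewise `C¹` path. -/
structure IsPathSpace (ω : 𝔼 → 𝔼 [⋀^Fin 2]→L[ℝ] ℝ) (X : Set 𝔼) : Prop where
  continuousOn : ContinuousOn ω X
  regularPart_eq : regularPart X = X \ {0}
  exists_path : ∀ x ∈ X, ∀ y ∈ X, ∃ α : ℝ → 𝔼, IsPiecewiseC1 α ∧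
    (∀ t ∈ Icc (0 : ℝ) 1, α t ∈ X) ∧ α 0 = x ∧ α 1 = y

/-- The speed of `α` at time `t`, set to zero at the times when `α` is at the origin. -/
noncomputable def arcSpeed (ω : 𝔼 → 𝔼 [⋀^Fin 2]→L[ℝ] ℝ) (α : ℝ → 𝔼) : ℝ → ℝ :=
  (α ⁻¹' {0}ᶜ).indicator fun t => Real.sqrt (kahlerMetric ω (α t) (deriv α t) (deriv α t))

variable {ω : EuclideanSpace ℂ (Fin n) → EuclideanSpace ℂ (Fin n) [⋀^Fin 2]→L[ℝ] ℝ}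
  {X : Set (EuclideanSpace ℂ (Fin n))}

theorem arcSpeed_nonneg (α : ℝ → 𝔼) (t : ℝ) : 0 ≤ arcSpeed ω α t :=
  indicator_nonneg (fun _ _ => Real.sqrt_nonneg _) t

theorem arcSpeed_of_ne_zero {α : ℝ → 𝔼} {t : ℝ} (h : α t ≠ 0) :
    arcSpeed ω α t = Real.sqrt (kahlerMetric ω (α t) (deriv α t) (deriv α t)) :=
  indicator_of_mem (by simpa using h) _

theorem indicator_Icc_inter_eqOn_arcSpeed (α : ℝ → 𝔼) :
    EqOn ((Icc (0 : ℝ) 1 ∩ α ⁻¹' {0}ᶜ).indicator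
      fun t => Real.sqrt (kahlerMetric ω (α t) (deriv α t) (deriv α t))) (arcSpeed ω α)
      (Icc (0 : ℝ) 1) := by
  intro t ht
  by_cases h : t ∈ α ⁻¹' {0}ᶜ
  · rw [arcSpeed, indicator_of_mem h, indicator_of_mem (show t ∈ Icc (0 : ℝ) 1 ∩ _ from ⟨ht, h⟩)]
  · rw [arcSpeed, indicator_of_notMem h, indicator_of_notMem fun hc => h hc.2]

theorem arcSpeed_congr {α β : ℝ → 𝔼} {t : ℝ} (h : α =ᶠ[𝓝 t] β) :
    arcSpeed ω α t = arcSpeed ω β t := by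
  simp only [arcSpeed, indicator, mem_preimage, h.eq_of_nhds, h.deriv_eq]

/-- Affine reparametrisation multiplies the speed. -/
theorem arcSpeed_comp_mul_sub (α : ℝ → 𝔼) {k : ℝ} (hk : 0 ≤ k) (b t : ℝ) :
    arcSpeed ω (fun s => α (k * s - b)) t = k * arcSpeed ω α (k * t - b) := by
  have hd : deriv (fun s => α (k * s - b)) t = (k : ℂ) • deriv α (k * t - b) := by
    rw [deriv_comp_mul_left k (fun s => α (s - b)) t, deriv_comp_sub_const, Complex.coe_smul]
  by_cases h : α (k * t - b) = 0
  · simp [arcSpeed, h]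
  · rw [arcSpeed_of_ne_zero h, arcSpeed_of_ne_zero (α := fun s => α (k * s - b)) h, hd,
      kahlerMetric_smul_smul, Real.sqrt_mul (sq_nonneg _), Real.sqrt_sq (norm_nonneg _)]
    simp [abs_of_nonneg hk]

theorem IsPiecewiseC1.measurableSet_ne_zero {α : ℝ → 𝔼} (hα : IsPiecewiseC1 α) :
    MeasurableSet (Icc (0 : ℝ) 1 ∩ α ⁻¹' {0}ᶜ) := by
  obtain ⟨u, hu, he⟩ := continuousOn_iff'.1 hα.1 {0}ᶜ isOpen_compl_singleton
  rw [inter_comm, he]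
  exact hu.measurableSet.inter measurableSet_Icc

theorem intrinsicDist_le_pathLength {α : ℝ → 𝔼} (hα : IsPiecewiseC1 α) (hX : ∀ t ∈ Icc (0 : ℝ) 1, α t ∈ X) :
    intrinsicDist ω X (α 0) (α 1) ≤ pathLength ω X α := by
  refine csInf_le ⟨0, ?_⟩ ⟨α, hα, hX, rfl, rfl, rfl⟩
  rintro l ⟨β, -, -, -, -, rfl⟩
  exact integral_nonneg fun _ => Real.sqrt_nonneg _

theorem intrinsicDist_nonneg (x y : 𝔼) : 0 ≤ intrinsicDist ω X x y := by
  refine Real.sInf_nonneg ?_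
  rintro l ⟨β, -, -, -, -, rfl⟩
  exact integral_nonneg fun _ => Real.sqrt_nonneg _

namespace IsPathSpace

variable (H : IsPathSpace ω X)
include H

theorem integrableOn_speed {α : ℝ → 𝔼} (hα : IsPiecewiseC1 α)
    (hX : ∀ t ∈ Icc (0 : ℝ) 1, α t ∈ X) :
    IntegrableOn (fun t => Real.sqrt (kahlerMetric ω (α t) (deriv α t) (deriv α t)))
      (Icc (0 : ℝ) 1) := by
  have hc : ContinuousOn (fun t => ω (α t)) (Icc (0 : ℝ) 1) := H.continuousOn.comp hα.1 hX
  obtain ⟨B, hB⟩ := isCompact_Icc.exists_bound_of_continuousOn hc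
  obtain ⟨S, M, hS, hM, hd⟩ := hα.exists_finite_differentiableAt
  have hm : AEStronglyMeasurable
      (fun t => Real.sqrt (kahlerMetric ω (α t) (deriv α t) (deriv α t)))
      (volume.restrict (Icc (0 : ℝ) 1)) := by
    have h1 := hc.aestronglyMeasurable (μ := volume) measurableSet_Icc
    have h2 : AEStronglyMeasurable (deriv α) (volume.restrict (Icc (0 : ℝ) 1)) :=
      (stronglyMeasurable_deriv α).aestronglyMeasurable
    exact Real.continuous_sqrt.comp_aestronglyMeasurable
      (continuous_alternating_two_eval.comp_aestronglyMeasurable (h1.prodMk h2))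
  refine IntegrableOn.of_bound (by simp) hm (Real.sqrt (B * M ^ 2)) ?_
  have hae : ∀ᵐ t ∂(volume.restrict (Icc (0 : ℝ) 1)), t ∉ S :=
    ae_restrict_of_ae (hS.countable.ae_notMem volume)
  filter_upwards [hae, ae_restrict_mem measurableSet_Icc] with t ht htm
  rw [Real.norm_of_nonneg (Real.sqrt_nonneg _)]
  refine Real.sqrt_le_sqrt ((le_abs_self _).trans ((abs_kahlerMetric_self_le _ _ _).trans ?_))
  have h1 := hB t htm
  have h2 := (hd t ⟨htm, ht⟩).2.2
  have h3 : 0 ≤ B := (norm_nonneg _).trans h1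
  gcongr

theorem integrableOn_arcSpeed {α : ℝ → 𝔼} (hα : IsPiecewiseC1 α)
    (hX : ∀ t ∈ Icc (0 : ℝ) 1, α t ∈ X) : IntegrableOn (arcSpeed ω α) (Icc (0 : ℝ) 1) := by
  have h1 := (H.integrableOn_speed hα hX).indicator₀ (s := Icc (0 : ℝ) 1 ∩ α ⁻¹' {0}ᶜ)
    hα.measurableSet_ne_zero.nullMeasurableSet
  exact IntegrableOn.congr_fun h1 (indicator_Icc_inter_eqOn_arcSpeed α) measurableSet_Icc

theorem intervalIntegrable_arcSpeed {α : ℝ → 𝔼} (hα : IsPiecewiseC1 α)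
    (hX : ∀ t ∈ Icc (0 : ℝ) 1, α t ∈ X) {a b : ℝ} (ha : 0 ≤ a) (hab : a ≤ b) (hb : b ≤ 1) :
    IntervalIntegrable (arcSpeed ω α) volume a b := by
  rw [intervalIntegrable_iff_integrableOn_Icc_of_le hab]
  exact (H.integrableOn_arcSpeed hα hX).mono_set (Icc_subset_Icc ha hb)

theorem pathLength_eq {α : ℝ → 𝔼} (hα : IsPiecewiseC1 α) (hX : ∀ t ∈ Icc (0 : ℝ) 1, α t ∈ X) :
    pathLength ω X α = ∫ t in (0 : ℝ)..1, arcSpeed ω α t := by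
  have hset : Icc (0 : ℝ) 1 ∩ α ⁻¹' regularPart X
      = Icc (0 : ℝ) 1 ∩ (Icc (0 : ℝ) 1 ∩ α ⁻¹' {0}ᶜ) := by
    rw [H.regularPart_eq]
    ext t
    constructor
    · exact fun ht => ⟨ht.1, ht.1, ht.2.2⟩
    · exact fun ht => ⟨ht.1, hX t ht.1, ht.2.2⟩
  rw [pathLength, hset, ← setIntegral_indicator hα.measurableSet_ne_zero,
    intervalIntegral.integral_of_le zero_le_one, ← integral_Icc_eq_integral_Ioc]
  exact setIntegral_congr_fun measurableSet_Icc (indicator_Icc_inter_eqOn_arcSpeed α)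

theorem pathLength_concat {α β : ℝ → 𝔼} (hα : IsPiecewiseC1 α)
    (hαX : ∀ t ∈ Icc (0 : ℝ) 1, α t ∈ X) (hβ : IsPiecewiseC1 β)
    (hβX : ∀ t ∈ Icc (0 : ℝ) 1, β t ∈ X) (h : α 1 = β 0) :
    (∀ t ∈ Icc (0 : ℝ) 1, concatPath α β t ∈ X) ∧
    pathLength ω X (concatPath α β) = pathLength ω X α + pathLength ω X β := by
  have hX : ∀ t ∈ Icc (0 : ℝ) 1, concatPath α β t ∈ X := by
    intro t ht
    rcases le_total t (1 / 2) with h' | h'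
    · rw [concatPath_eqOn_left α β h']
      exact hαX _ ⟨by linarith [ht.1], by linarith⟩
    · rw [concatPath_eqOn_right h h']
      exact hβX _ ⟨by linarith, by linarith [ht.2]⟩
  refine ⟨hX, ?_⟩
  have hc := hα.concat hβ h
  rw [H.pathLength_eq hc hX, H.pathLength_eq hα hαX, H.pathLength_eq hβ hβX,
    ← intervalIntegral.integral_add_adjacent_intervals
      (H.intervalIntegrable_arcSpeed hc hX le_rfl (by norm_num : (0 : ℝ) ≤ 1 / 2) (by norm_num))
      (H.intervalIntegrable_arcSpeed hc hX (by norm_num) (by norm_num : (1 / 2 : ℝ) ≤ 1) le_rfl)]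
  have hne : ∀ᵐ t : ℝ, t ≠ 1 / 2 := by
    simpa using (countable_singleton (1 / 2 : ℝ)).ae_notMem volume
  congr 1
  · have e : ∫ t in (0 : ℝ)..1 / 2, arcSpeed ω (concatPath α β) t
        = ∫ t in (0 : ℝ)..1 / 2, 2 * arcSpeed ω α (2 * t - 0) := by
      refine intervalIntegral.integral_congr_ae' ?_ ?_
      · filter_upwards [hne] with t ht htm
        rw [← arcSpeed_comp_mul_sub α zero_le_two]
        refine arcSpeed_congr ?_
        filter_upwards [Iio_mem_nhds (lt_of_le_of_ne htm.2 ht)] with s hs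
        rw [concatPath_eqOn_left α β (mem_Iic.2 (le_of_lt hs)), sub_zero]
      · exact .of_forall fun t ht => absurd (ht.1.trans_le ht.2) (by norm_num)
    rw [e, intervalIntegral.integral_const_mul, intervalIntegral.integral_comp_mul_sub _ two_ne_zero,
      smul_eq_mul, ← mul_assoc]
    norm_num
  · have e : ∫ t in (1 / 2 : ℝ)..1, arcSpeed ω (concatPath α β) t
        = ∫ t in (1 / 2 : ℝ)..1, 2 * arcSpeed ω β (2 * t - 1) := by
      refine intervalIntegral.integral_congr_ae' ?_ ?_
      · refine .of_forall fun t htm => ?_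
        rw [← arcSpeed_comp_mul_sub β zero_le_two]
        refine arcSpeed_congr ?_
        filter_upwards [Ioi_mem_nhds htm.1] with s hs
        rw [concatPath_eqOn_right h (mem_Ici.2 (le_of_lt hs))]
      · exact .of_forall fun t ht => absurd (ht.1.trans_le ht.2) (by norm_num)
    rw [e, intervalIntegral.integral_const_mul, intervalIntegral.integral_comp_mul_sub _ two_ne_zero,
      smul_eq_mul, ← mul_assoc]
    norm_num

theorem le_intrinsicDist {x y : 𝔼} (hx : x ∈ X) (hy : y ∈ X) {B : ℝ}
    (hB : ∀ α : ℝ → 𝔼, IsPiecewiseC1 α → (∀ t ∈ Icc (0 : ℝ) 1, α t ∈ X) → α 0 = x → α 1 = y →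
      B ≤ pathLength ω X α) : B ≤ intrinsicDist ω X x y := by
  obtain ⟨α, h1, h2, h3, h4⟩ := H.exists_path x hx y hy
  refine le_csInf ⟨_, α, h1, h2, h3, h4, rfl⟩ ?_
  rintro l ⟨β, k1, k2, k3, k4, rfl⟩
  exact hB β k1 k2 k3 k4

theorem intrinsicDist_triangle {x y z : 𝔼} (hx : x ∈ X) (hy : y ∈ X) (hz : z ∈ X) :
    intrinsicDist ω X x z ≤ intrinsicDist ω X x y + intrinsicDist ω X y z := by
  rw [← sub_le_iff_le_add']
  refine H.le_intrinsicDist hy hz fun β k1 k2 k3 k4 => ?_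
  rw [sub_le_comm]
  refine H.le_intrinsicDist hx hy fun α h1 h2 h3 h4 => ?_
  rw [sub_le_iff_le_add]
  have hab : α 1 = β 0 := h4.trans k3.symm
  obtain ⟨hX, hl⟩ := H.pathLength_concat h1 h2 k1 k2 hab
  rw [← hl]
  have := intrinsicDist_le_pathLength (ω := ω) (h1.concat k1 hab) hX
  have e0 : concatPath α β 0 = x := by simp [concatPath, h3]
  have e1 : concatPath α β 1 = z := by
    rw [concatPath_eqOn_right hab (by simp; norm_num)]
    norm_num [k4]
  rwa [e0, e1] at this

/-- A lower bound for the speed on an initial time interval bounds the length of the path below. -/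
theorem mul_norm_sub_le_pathLength {F : Type*} [NormedAddCommGroup F] [NormedSpace ℝ F]
    [CompleteSpace F] {α : ℝ → 𝔼} (hα : IsPiecewiseC1 α) (hX : ∀ t ∈ Icc (0 : ℝ) 1, α t ∈ X)
    (ℓ : 𝔼 →L[ℝ] F) {k s : ℝ} (hk : 0 ≤ k) (hs : s ∈ Icc (0 : ℝ) 1)
    (hsp : ∀ t ∈ Ioo 0 s, DifferentiableAt ℝ α t → k * ‖ℓ (deriv α t)‖ ≤ arcSpeed ω α t) :
    k * ‖ℓ (α s - α 0)‖ ≤ pathLength ω X α := by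
  obtain ⟨S, M, hS, hM, hd⟩ := hα.exists_finite_differentiableAt
  have hint : IntervalIntegrable (fun t => ℓ (deriv α t)) volume 0 s := by
    rw [intervalIntegrable_iff_integrableOn_Icc_of_le hs.1]
    refine IntegrableOn.of_bound (by simp)
      (ℓ.continuous.comp_aestronglyMeasurable (stronglyMeasurable_deriv α).aestronglyMeasurable)
      (‖ℓ‖ * M) ?_
    have hae : ∀ᵐ t ∂(volume.restrict (Icc (0 : ℝ) s)), t ∉ S :=
      ae_restrict_of_ae (hS.countable.ae_notMem volume)
    filter_upwards [hae, ae_restrict_mem measurableSet_Icc] with t ht htm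
    have := (hd t ⟨⟨htm.1, htm.2.trans hs.2⟩, ht⟩).2.2
    exact (ℓ.le_opNorm _).trans (by gcongr)
  have hftc : ∫ t in (0 : ℝ)..s, ℓ (deriv α t) = ℓ (α s) - ℓ (α 0) := by
    refine integral_eq_of_hasDerivAt_off_countable (fun t => ℓ (α t)) _ hS.countable ?_ ?_ hint
    · rw [uIcc_of_le hs.1]
      exact ℓ.continuous.comp_continuousOn (hα.1.mono (Icc_subset_Icc_right hs.2))
    · intro t ht
      rw [min_eq_left hs.1, max_eq_right hs.1] at ht
      exact ℓ.hasFDerivAt.comp_hasDerivAt t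
        (hd t ⟨⟨ht.1.1.le, ht.1.2.le.trans hs.2⟩, ht.2⟩).2.1.hasDerivAt
  rw [map_sub, ← hftc, H.pathLength_eq hα hX]
  calc k * ‖∫ t in (0 : ℝ)..s, ℓ (deriv α t)‖
      ≤ k * ∫ t in (0 : ℝ)..s, ‖ℓ (deriv α t)‖ := by
        gcongr
        exact intervalIntegral.norm_integral_le_integral_norm hs.1
    _ = ∫ t in (0 : ℝ)..s, k * ‖ℓ (deriv α t)‖ := (intervalIntegral.integral_const_mul _ _).symm
    _ ≤ ∫ t in (0 : ℝ)..s, arcSpeed ω α t := by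
        rw [intervalIntegral.integral_of_le hs.1, intervalIntegral.integral_of_le hs.1]
        refine setIntegral_mono_on_ae ((hint.norm.const_mul k).1)
          (H.intervalIntegrable_arcSpeed hα hX le_rfl hs.1 hs.2).1 measurableSet_Ioc ?_
        have hne : ∀ᵐ t : ℝ, t ≠ s := by
          simpa using (countable_singleton s).ae_notMem volume
        filter_upwards [hS.countable.ae_notMem volume, hne] with t ht hts htm
        exact hsp t ⟨htm.1, lt_of_le_of_ne htm.2 hts⟩
          (hd t ⟨⟨htm.1.le, htm.2.trans hs.2⟩, ht⟩).2.1
    _ ≤ ∫ t in (0 : ℝ)..1, arcSpeed ω α t := by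
        rw [← intervalIntegral.integral_add_adjacent_intervals
          (H.intervalIntegrable_arcSpeed hα hX le_rfl hs.1 hs.2)
          (H.intervalIntegrable_arcSpeed hα hX hs.1 hs.2 le_rfl)]
        have := intervalIntegral.integral_nonneg (μ := volume) hs.2
          (fun t _ => arcSpeed_nonneg (ω := ω) α t)
        linarith

end IsPathSpace

theorem pathLength_le_of_speed_le {α : ℝ → 𝔼} {B : ℝ} (hB : ∀ t ∈ Icc (0 : ℝ) 1,
    Real.sqrt (kahlerMetric ω (α t) (deriv α t) (deriv α t)) ≤ B) : pathLength ω X α ≤ B := by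
  have hB0 : 0 ≤ B := (Real.sqrt_nonneg _).trans (hB 0 (by simp))
  have hfin : volume (Icc (0 : ℝ) 1 ∩ α ⁻¹' regularPart X) ≤ 1 :=
    (measure_mono inter_subset_left).trans (by simp)
  have h1 := norm_setIntegral_le_of_norm_le_const (μ := volume) (C := B)
    (f := fun t => Real.sqrt (kahlerMetric ω (α t) (deriv α t) (deriv α t)))
    (hfin.trans_lt ENNReal.one_lt_top)
    (fun t ht => by rw [Real.norm_of_nonneg (Real.sqrt_nonneg _)]; exact hB t ht.1)
  have h2 : volume.real (Icc (0 : ℝ) 1 ∩ α ⁻¹' regularPart X) ≤ 1 :=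
    ENNReal.toReal_mono ENNReal.one_ne_top hfin
  calc pathLength ω X α ≤ ‖pathLength ω X α‖ := Real.le_norm_self _
    _ ≤ B * volume.real (Icc (0 : ℝ) 1 ∩ α ⁻¹' regularPart X) := h1
    _ ≤ B := mul_le_of_le_one_right hB0 h2

/-- The first time at which a path starting at `x` leaves the open ball of radius `R` about `x`. -/
theorem exists_exit_time {α : ℝ → 𝔼} (hα : ContinuousOn α (Icc (0 : ℝ) 1)) (R : ℝ) :
    ∃ s ∈ Icc (0 : ℝ) 1, (∀ t ∈ Ico 0 s, α t ∈ Metric.ball (α 0) R) ∧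
      (s = 1 ∨ R ≤ ‖α s - α 0‖) := by
  set Z := Icc (0 : ℝ) 1 ∩ (fun t => ‖α t - α 0‖) ⁻¹' Ici R with hZ
  rcases Z.eq_empty_or_nonempty with he | hne
  · refine ⟨1, by simp, fun t ht => ?_, Or.inl rfl⟩
    by_contra hcon
    rw [mem_ball_iff_norm, not_lt] at hcon
    have : t ∈ Z := ⟨⟨ht.1, ht.2.le⟩, hcon⟩
    rw [he] at this
    exact this
  · have hcl : IsClosed Z :=
      (show ContinuousOn (fun t => ‖α t - α 0‖) (Icc (0 : ℝ) 1) by fun_prop).preimage_isClosed_of_isClosed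
        isClosed_Icc isClosed_Ici
    have hbdd : BddBelow Z := ⟨0, fun t ht => ht.1.1⟩
    have hmem := hcl.csInf_mem hne hbdd
    refine ⟨sInf Z, hmem.1, fun t ht => ?_, Or.inr hmem.2⟩
    by_contra hcon
    rw [mem_ball_iff_norm, not_lt] at hcon
    exact absurd (csInf_le hbdd (⟨⟨ht.1, ht.2.le.trans hmem.1.2⟩, hcon⟩ : t ∈ Z)) (not_le.2 ht.2)

end IntrinsicDistance

/-! ### Charts and distances on a branched curve -/

section BranchedCurve

variable {n : ℕ} [NeZero n]

/-- A curve `X`, the image of the unit disc under `φ`, on which the coordinate `x₀` is the `m`-th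
power of the parameter, with tangent field `T` normalised by `T₀ = 1` and conformal factor `Λ` of
the metric with respect to `x₀`. The constants control `T` and `Λ` uniformly. -/
structure IsBranchedCurve (m : ℕ) (ω : EuclideanSpace ℂ (Fin n) →
      EuclideanSpace ℂ (Fin n) [⋀^Fin 2]→L[ℝ] ℝ) (X : Set (EuclideanSpace ℂ (Fin n)))
    (φ T : ℂ → EuclideanSpace ℂ (Fin n)) (Λ : ℂ → ℝ) (c C K : ℝ) : Prop where
  m_pos : 0 < m
  continuousOn : ContinuousOn ω X
  image_eq : φ '' Metric.ball 0 1 = X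
  regularPart_eq : regularPart X = X \ {0}
  map_zero : φ 0 = 0
  coord : ∀ z ∈ Metric.ball (0 : ℂ) 1, φ z 0 = z ^ m
  hasDerivAt : ∀ z ∈ Metric.ball (0 : ℂ) 1, HasDerivAt φ ((m * z ^ (m - 1)) • T z) z
  coord_tangent : ∀ z ∈ Metric.ball (0 : ℂ) 1, T z 0 = 1
  tangent_lip : ∀ z ∈ Metric.ball (0 : ℂ) 1, ∀ z' ∈ Metric.ball (0 : ℂ) 1,
    ‖T z - T z'‖ ≤ K * ‖z - z'‖
  norm_tangent_le : ∀ z ∈ Metric.ball (0 : ℂ) 1, ‖T z‖ ≤ C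
  metric_tangent : ∀ z ∈ Metric.ball (0 : ℂ) 1, kahlerMetric ω (φ z) (T z) (T z) = Λ z ^ 2
  le_factor : ∀ z ∈ Metric.ball (0 : ℂ) 1, c ≤ Λ z
  factor_le : ∀ z ∈ Metric.ball (0 : ℂ) 1, Λ z ≤ C
  factor_lip : ∀ z ∈ Metric.ball (0 : ℂ) 1, ∀ z' ∈ Metric.ball (0 : ℂ) 1,
    |Λ z - Λ z'| ≤ K * ‖z - z'‖
  c_pos : 0 < c
  K_nonneg : 0 ≤ K
  inverse_continuous : ∀ z₀ ∈ Metric.ball (0 : ℂ) 1, z₀ ≠ 0 → ∀ ε > 0, ∃ ρ > 0,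
    ∀ z ∈ Metric.ball (0 : ℂ) 1, ‖φ z - φ z₀‖ < ρ → ‖z - z₀‖ < ε

/-- A local branch `g` of the `m`-th root at `w₀ = z₀ ^ m`, on the ball of radius `η`: the map
`φ ∘ g` parametrises `X` near `φ z₀` by the coordinate `x₀`. -/
structure IsRootChart (m : ℕ) (X : Set (EuclideanSpace ℂ (Fin n)))
    (φ T : ℂ → EuclideanSpace ℂ (Fin n)) (z₀ : ℂ) (g : ℂ → ℂ) (η : ℝ) : Prop where
  pos : 0 < η
  apply_center : g (z₀ ^ m) = z₀
  mem_ball : ∀ w ∈ Metric.ball (z₀ ^ m) η, g w ∈ Metric.ball (0 : ℂ) 1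
  ne_zero : ∀ w ∈ Metric.ball (z₀ ^ m) η, g w ≠ 0
  pow_eq : ∀ w ∈ Metric.ball (z₀ ^ m) η, g w ^ m = w
  hasDerivAt : ∀ w ∈ Metric.ball (z₀ ^ m) η, HasDerivAt (fun w => φ (g w)) (T (g w)) w
  lip : ∀ w ∈ Metric.ball (z₀ ^ m) η, ∀ w' ∈ Metric.ball (z₀ ^ m) η,
    ‖g w - g w'‖ ≤ 2 * (‖z₀‖ ^ (m - 1))⁻¹ * ‖w - w'‖
  exists_radius : ∃ ρ > 0, ∀ x ∈ X, ‖x - φ z₀‖ < ρ →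
    x 0 ∈ Metric.ball (z₀ ^ m) η ∧ φ (g (x 0)) = x

namespace IsBranchedCurve

variable {m : ℕ} {ω : EuclideanSpace ℂ (Fin n) → EuclideanSpace ℂ (Fin n) [⋀^Fin 2]→L[ℝ] ℝ}
  {X : Set (EuclideanSpace ℂ (Fin n))} {φ T : ℂ → EuclideanSpace ℂ (Fin n)} {Λ : ℂ → ℝ}
  {c C K : ℝ} (H : IsBranchedCurve m ω X φ T Λ c C K)
include H

theorem map_ne_zero {z : ℂ} (hz : z ∈ Metric.ball (0 : ℂ) 1) (h0 : z ≠ 0) : φ z ≠ 0 := by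
  intro h
  have := H.coord z hz
  rw [h] at this
  exact pow_ne_zero m h0 this.symm

theorem C_pos : 0 < C :=
  H.c_pos.trans_le ((H.le_factor 0 (by simp)).trans (H.factor_le 0 (by simp)))

theorem isPathSpace : IsPathSpace ω X where
  continuousOn := H.continuousOn
  regularPart_eq := H.regularPart_eq
  exists_path := by
    rw [← H.image_eq]
    rintro _ ⟨a, ha, rfl⟩ _ ⟨b, hb, rfl⟩
    have hmem : ∀ t ∈ Icc (0 : ℝ) 1, a + (t : ℂ) * (b - a) ∈ Metric.ball (0 : ℂ) 1 := by
      intro t ht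
      have := (convex_ball (0 : ℂ) 1).add_smul_sub_mem ha hb ht
      simpa using this
    have hd : ContDiffOn ℝ 1 φ (Metric.ball (0 : ℂ) 1) := by
      have h1 : DifferentiableOn ℂ φ (Metric.ball (0 : ℂ) 1) := fun z hz =>
        (H.hasDerivAt z hz).differentiableAt.differentiableWithinAt
      exact (h1.contDiffOn Metric.isOpen_ball).restrict_scalars ℝ
    have hs : ContDiff ℝ 1 fun t : ℝ => a + (t : ℂ) * (b - a) :=
      contDiff_const.add (Complex.ofRealCLM.contDiff.mul contDiff_const)
    have hc : ContDiffOn ℝ 1 (fun t : ℝ => φ (a + (t : ℂ) * (b - a))) (Icc 0 1) :=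
      hd.comp hs.contDiffOn hmem
    refine ⟨fun t => φ (a + (t : ℂ) * (b - a)), ?_, fun t ht => mem_image_of_mem _ (hmem t ht),
      by simp, by simp⟩
    exact isPiecewiseC1_iff_nat.2 ⟨hc.continuousOn, 1, fun i => i, Nat.mono_cast, by simp, by simp,
      fun i hi => by
        obtain rfl : i = 0 := by omega
        simpa using hc⟩

/-- Charts exist at every point other than the singular one. -/
theorem exists_isRootChart {z₀ : ℂ} (hz : z₀ ∈ Metric.ball (0 : ℂ) 1) (h0 : z₀ ≠ 0) :
    ∃ (g : ℂ → ℂ) (η : ℝ), IsRootChart m X φ T z₀ g η := by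
  have hm : (m : ℂ) ≠ 0 := Nat.cast_ne_zero.2 H.m_pos.ne'
  have hf : HasStrictDerivAt (fun z : ℂ => z ^ m) (m * z₀ ^ (m - 1)) z₀ := hasStrictDerivAt_pow m z₀
  have hf' : (m : ℂ) * z₀ ^ (m - 1) ≠ 0 := mul_ne_zero hm (pow_ne_zero _ h0)
  set g := hf.localInverse _ _ _ hf' with hg
  have hgd : HasStrictDerivAt g (m * z₀ ^ (m - 1))⁻¹ (z₀ ^ m) := hf.to_localInverse hf'
  have hright : ∀ᶠ w in 𝓝 (z₀ ^ m), g w ^ m = w := (hf.hasStrictFDerivAt_equiv hf').eventually_right_inverse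
  have hleft : ∀ᶠ z in 𝓝 z₀, g (z ^ m) = z := (hf.hasStrictFDerivAt_equiv hf').eventually_left_inverse
  have hg0 : g (z₀ ^ m) = z₀ := hleft.self_of_nhds
  have hz0n : 0 < ‖z₀‖ := norm_pos_iff.2 h0
  have hlip : ∃ s ∈ 𝓝 (z₀ ^ m), LipschitzOnWith (2 * (‖z₀‖ ^ (m - 1))⁻¹).toNNReal g s := by
    refine hgd.hasStrictFDerivAt.exists_lipschitzOnWith_of_nnnorm_lt _ ?_
    rw [← NNReal.coe_lt_coe, Real.coe_toNNReal _ (by positivity), coe_nnnorm,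
      ContinuousLinearMap.norm_toSpanSingleton, norm_inv, norm_mul, norm_pow, mul_inv]
    have h1 : ‖(m : ℂ)‖⁻¹ ≤ 1 := by
      rw [Complex.norm_natCast]
      exact inv_le_one_of_one_le₀ (by exact_mod_cast H.m_pos)
    have h2 : 0 < (‖z₀‖ ^ (m - 1))⁻¹ := by positivity
    nlinarith
  obtain ⟨s, hs, hlip⟩ := hlip
  have hgc : ContinuousAt g (z₀ ^ m) := hgd.hasDerivAt.continuousAt
  have hb : ∀ᶠ w in 𝓝 (z₀ ^ m), g w ∈ Metric.ball (0 : ℂ) 1 ∧ g w ≠ 0 := by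
    have : Metric.ball (0 : ℂ) 1 ∩ {0}ᶜ ∈ 𝓝 (g (z₀ ^ m)) := by
      rw [hg0]
      exact (Metric.isOpen_ball.inter isOpen_compl_singleton).mem_nhds ⟨hz, h0⟩
    exact hgc.eventually_mem this
  obtain ⟨η, hη, hball⟩ := Metric.eventually_nhds_iff_ball.1
    (hright.and (hb.and (show ∀ᶠ w in 𝓝 (z₀ ^ m), w ∈ s from hs)))
  refine ⟨g, η, hη, hg0, fun w hw => (hball w hw).2.1.1, fun w hw => (hball w hw).2.1.2,
    fun w hw => (hball w hw).1, fun w hw => ?_, fun w hw w' hw' => ?_, ?_⟩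
  · have hc : ContinuousAt g w :=
      hlip.continuousOn.continuousAt (Filter.mem_of_superset (Metric.isOpen_ball.mem_nhds hw)
        fun y hy => (hball y hy).2.2)
    have hne : (m : ℂ) * g w ^ (m - 1) ≠ 0 :=
      mul_ne_zero hm (pow_ne_zero _ (hball w hw).2.1.2)
    have hgw : HasDerivAt g (m * g w ^ (m - 1))⁻¹ w :=
      HasDerivAt.of_local_left_inverse hc (hasDerivAt_pow m (g w)) hne
        (Filter.mem_of_superset (Metric.isOpen_ball.mem_nhds hw) fun y hy => (hball y hy).1)
    have := (H.hasDerivAt (g w) (hball w hw).2.1.1).scomp w hgw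
    rwa [smul_smul, inv_mul_cancel₀ hne, one_smul] at this
  · have := hlip.dist_le_mul w (hball w hw).2.2 w' (hball w' hw').2.2
    rwa [dist_eq_norm, dist_eq_norm, Real.coe_toNNReal _ (by positivity)] at this
  · have hpow : ∀ᶠ z in 𝓝 z₀, z ^ m ∈ Metric.ball (z₀ ^ m) η :=
      (continuous_pow m).continuousAt.eventually_mem (Metric.ball_mem_nhds _ hη)
    obtain ⟨ε, hε, hεb⟩ := Metric.eventually_nhds_iff_ball.1 (hleft.and hpow)
    obtain ⟨ρ, hρ, hρb⟩ := H.inverse_continuous z₀ hz h0 ε hε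
    refine ⟨ρ, hρ, fun x hx hxρ => ?_⟩
    rw [← H.image_eq] at hx
    obtain ⟨z, hz', rfl⟩ := hx
    have := hεb z (mem_ball_iff_norm.2 (hρb z hz' hxρ))
    rw [H.coord z hz', this.1]
    exact ⟨this.2, rfl⟩

/-- At a regular point the velocity of a path in `X` is a complex multiple of the tangent field. -/
theorem exists_deriv_eq_smul {α : ℝ → EuclideanSpace ℂ (Fin n)}
    (hX : ∀ t ∈ Icc (0 : ℝ) 1, α t ∈ X) {t : ℝ} (ht : t ∈ Ioo (0 : ℝ) 1)
    (hd : DifferentiableAt ℝ α t) (h0 : α t ≠ 0) :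
    ∃ z ∈ Metric.ball (0 : ℂ) 1, φ z = α t ∧ ∃ a : ℂ, deriv α t = a • T z ∧
      arcSpeed ω α t = ‖a‖ * Λ z := by
  have hXt := hX t (Ioo_subset_Icc_self ht)
  rw [← H.image_eq] at hXt
  obtain ⟨z, hz, hzα⟩ := hXt
  have hz0 : z ≠ 0 := fun h => h0 (by rw [← hzα, h, H.map_zero])
  obtain ⟨g, η, hc⟩ := H.exists_isRootChart hz hz0
  obtain ⟨ρ, hρ, hρb⟩ := hc.exists_radius
  set π : EuclideanSpace ℂ (Fin n) →L[ℝ] ℂ :=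
    (EuclideanSpace.proj (0 : Fin n) : EuclideanSpace ℂ (Fin n) →L[ℂ] ℂ).restrictScalars ℝ with hπ
  have hu : HasDerivAt (fun s => α s 0) (π (deriv α t)) t :=
    π.hasFDerivAt.comp_hasDerivAt t hd.hasDerivAt
  have ht0 : α t 0 = z ^ m := by rw [← hzα, H.coord z hz]
  have hP := hc.hasDerivAt (α t 0) (by rw [ht0]; exact Metric.mem_ball_self hc.pos)
  have hcomp := hP.scomp t hu
  have hev : α =ᶠ[𝓝 t] (fun w => φ (g w)) ∘ fun s => α s 0 := by
    have h1 : ∀ᶠ s in 𝓝 t, α s ∈ Metric.ball (φ z) ρ := by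
      refine hd.continuousAt.eventually_mem ?_
      rw [← hzα]
      exact Metric.ball_mem_nhds _ hρ
    filter_upwards [h1, Icc_mem_nhds ht.1 ht.2] with s hs1 hs2
    exact (hρb (α s) (hX s hs2) (mem_ball_iff_norm.1 hs1)).2.symm
  have hder := (hcomp.congr_of_eventuallyEq hev).deriv
  rw [ht0, hc.apply_center] at hder
  refine ⟨z, hz, hzα, π (deriv α t), hder, ?_⟩
  rw [arcSpeed_of_ne_zero h0, hder, ← hzα, kahlerMetric_smul_smul, H.metric_tangent z hz,
    Real.sqrt_mul (sq_nonneg _), Real.sqrt_sq (norm_nonneg _),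
    Real.sqrt_sq (H.c_pos.le.trans (H.le_factor z hz)), ← hder]

/-- Lower bounds for the length of a path from `x` to `y` in terms of the point `y'` where the path
leaves a ball about `x` that avoids the singular point. -/
theorem exists_exit_point {x y : EuclideanSpace ℂ (Fin n)} {R k : ℝ} (hRx : R ≤ ‖x‖)
    (hk : 0 ≤ k) (hkΛ : ∀ z ∈ Metric.ball (0 : ℂ) 1, φ z ∈ Metric.ball x R → k ≤ Λ z)
    {α : ℝ → EuclideanSpace ℂ (Fin n)} (hα : IsPiecewiseC1 α) (hX : ∀ t ∈ Icc (0 : ℝ) 1, α t ∈ X)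
    (h0 : α 0 = x) (h1 : α 1 = y) :
    ∃ y', (y' = y ∨ R ≤ ‖y' - x‖) ∧ k * ‖y' 0 - x 0‖ ≤ pathLength ω X α ∧
      c / C * ‖y' - x‖ ≤ pathLength ω X α := by
  obtain ⟨s, hs, hball, hexit⟩ := exists_exit_time hα.1 R
  rw [h0] at hball hexit
  have hC := H.C_pos
  set π : EuclideanSpace ℂ (Fin n) →L[ℝ] ℂ :=
    (EuclideanSpace.proj (0 : Fin n) : EuclideanSpace ℂ (Fin n) →L[ℂ] ℂ).restrictScalars ℝ with hπ
  have hne : ∀ t ∈ Ioo 0 s, α t ≠ 0 := by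
    intro t ht h
    have := hball t ⟨ht.1.le, ht.2⟩
    rw [h, mem_ball_iff_norm, zero_sub, norm_neg] at this
    linarith
  have key : ∀ t ∈ Ioo 0 s, DifferentiableAt ℝ α t →
      ∃ z ∈ Metric.ball (0 : ℂ) 1, φ z ∈ Metric.ball x R ∧ ∃ a : ℂ, deriv α t = a • T z ∧
      arcSpeed ω α t = ‖a‖ * Λ z := by
    intro t ht hd
    obtain ⟨z, hz, hzα, h⟩ := H.exists_deriv_eq_smul hX ⟨ht.1, ht.2.trans_le hs.2⟩ hd (hne t ht)
    exact ⟨z, hz, hzα ▸ hball t ⟨ht.1.le, ht.2⟩, h⟩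
  refine ⟨α s, hexit.imp (fun h => by rw [h, h1]) id, ?_, ?_⟩
  · have := H.isPathSpace.mul_norm_sub_le_pathLength hα hX π hk hs fun t ht hd => by
      obtain ⟨z, hz, hzR, a, ha, hsp⟩ := key t ht hd
      have e : π (deriv α t) = a := by
        rw [ha]
        simp [hπ, H.coord_tangent z hz]
      rw [e, hsp, mul_comm]
      exact mul_le_mul_of_nonneg_left (hkΛ z hz hzR) (norm_nonneg _)
    rw [h0] at this
    exact this
  · have := H.isPathSpace.mul_norm_sub_le_pathLength hα hX
      (ContinuousLinearMap.id ℝ (EuclideanSpace ℂ (Fin n))) (div_nonneg H.c_pos.le hC.le) hs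
      fun t ht hd => by
        obtain ⟨z, hz, hzR, a, ha, hsp⟩ := key t ht hd
        rw [hsp, ContinuousLinearMap.id_apply, ha, norm_smul]
        calc c / C * (‖a‖ * ‖T z‖) ≤ c / C * (‖a‖ * C) := by
              have := H.norm_tangent_le z hz
              have := H.c_pos
              gcongr
          _ = ‖a‖ * c := by field_simp
          _ ≤ ‖a‖ * Λ z := mul_le_mul_of_nonneg_left (H.le_factor z hz) (norm_nonneg _)
    rw [h0] at this
    exact this

theorem mul_min_le_intrinsicDist {x y : EuclideanSpace ℂ (Fin n)} (hx : x ∈ X) (hy : y ∈ X) :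
    c / C * min ‖y - x‖ ‖x‖ ≤ intrinsicDist ω X x y := by
  refine H.isPathSpace.le_intrinsicDist hx hy fun α h1 h2 h3 h4 => ?_
  obtain ⟨y', hy', -, hl⟩ := H.exists_exit_point (k := 0) le_rfl le_rfl
    (fun z hz _ => H.c_pos.le.trans (H.le_factor z hz)) h1 h2 h3 h4
  refine le_trans ?_ hl
  have : 0 ≤ c / C := div_nonneg H.c_pos.le H.C_pos.le
  gcongr
  rcases hy' with rfl | h
  · exact min_le_left _ _
  · exact (min_le_right _ _).trans h

/-- Infinitesimally the intrinsic distance is at least `Λ` times the distance of the coordinates. -/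
theorem exists_forall_mul_norm_le_intrinsicDist {z₀ : ℂ} (hz : z₀ ∈ Metric.ball (0 : ℂ) 1)
    (h0 : z₀ ≠ 0) {κ : ℝ} (hκ : 0 < κ) :
    ∃ ρ > 0, ∀ y ∈ X, ‖y - φ z₀‖ < ρ →
      (Λ z₀ - κ) * ‖φ z₀ 0 - y 0‖ ≤ intrinsicDist ω X (φ z₀) y := by
  have hx : φ z₀ ∈ X := H.image_eq ▸ mem_image_of_mem φ hz
  rcases le_total (Λ z₀ - κ) 0 with hneg | hk
  · exact ⟨1, one_pos, fun y _ _ =>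
      (mul_nonpos_of_nonpos_of_nonneg hneg (norm_nonneg _)).trans (intrinsicDist_nonneg _ _)⟩
  have hφ0 : 0 < ‖φ z₀‖ := norm_pos_iff.2 (H.map_ne_zero hz h0)
  have hC := H.C_pos
  have hc := H.c_pos
  have hK := H.K_nonneg
  obtain ⟨ρ₁, hρ₁, hb⟩ := H.inverse_continuous z₀ hz h0 (κ / (K + 1)) (by positivity)
  have hR : 0 < min ρ₁ ‖φ z₀‖ := lt_min hρ₁ hφ0
  refine ⟨c / C * min ρ₁ ‖φ z₀‖ / (C + 1), by positivity, fun y hy hyρ => ?_⟩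
  refine H.isPathSpace.le_intrinsicDist hx hy fun α h1 h2 h3 h4 => ?_
  obtain ⟨y', hy', hl1, hl2⟩ := H.exists_exit_point (R := min ρ₁ ‖φ z₀‖) (k := Λ z₀ - κ)
    (min_le_right _ _) hk
    (fun z hz' hzR => by
      have h5 := hb z hz' ((mem_ball_iff_norm.1 hzR).trans_le (min_le_left _ _))
      have h6 := H.factor_lip z₀ hz z hz'
      rw [norm_sub_rev] at h6
      have h7 : K * ‖z - z₀‖ ≤ κ := by
        calc K * ‖z - z₀‖ ≤ (K + 1) * (κ / (K + 1)) := by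
              have := norm_nonneg (z - z₀)
              gcongr
              linarith
          _ = κ := by field_simp
      linarith [(abs_le.1 h6).2]) h1 h2 h3 h4
  rcases hy' with rfl | h
  · rwa [norm_sub_rev]
  · refine le_trans ?_ hl2
    have h8 : ‖φ z₀ 0 - y 0‖ ≤ ‖y - φ z₀‖ := by
      rw [norm_sub_rev]
      exact PiLp.norm_apply_le (y - φ z₀) 0
    rw [lt_div_iff₀ (by positivity)] at hyρ
    have h9 : Λ z₀ - κ ≤ C + 1 := by linarith [H.factor_le z₀ hz]
    calc (Λ z₀ - κ) * ‖φ z₀ 0 - y 0‖ ≤ (C + 1) * ‖y - φ z₀‖ := by gcongr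
      _ ≤ c / C * min ρ₁ ‖φ z₀‖ := by linarith
      _ ≤ c / C * ‖y' - φ z₀‖ := by gcongr

/-- In a chart, the length of the image of a segment bounds the distance of its end points. -/
theorem intrinsicDist_le_of_chart {z₀ : ℂ} {g : ℂ → ℂ} {η : ℝ} (hc : IsRootChart m X φ T z₀ g η)
    {a b : ℂ} (ha : a ∈ Metric.ball (z₀ ^ m) η) (hb : b ∈ Metric.ball (z₀ ^ m) η) :
    intrinsicDist ω X (φ (g a)) (φ (g b)) ≤
      (Λ (g a) + K * (2 * (‖z₀‖ ^ (m - 1))⁻¹) * ‖a - b‖) * ‖a - b‖ := by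
  have hmem : ∀ t ∈ Icc (0 : ℝ) 1, a + (t : ℂ) * (b - a) ∈ Metric.ball (z₀ ^ m) η := by
    intro t ht
    have := (convex_ball (z₀ ^ m) η).add_smul_sub_mem ha hb ht
    simpa using this
  have hd : ContDiffOn ℝ 1 (fun w => φ (g w)) (Metric.ball (z₀ ^ m) η) := by
    have h1 : DifferentiableOn ℂ (fun w => φ (g w)) (Metric.ball (z₀ ^ m) η) := fun w hw =>
      (hc.hasDerivAt w hw).differentiableAt.differentiableWithinAt
    exact (h1.contDiffOn Metric.isOpen_ball).restrict_scalars ℝ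
  have hs : ContDiff ℝ 1 fun t : ℝ => a + (t : ℂ) * (b - a) :=
    contDiff_const.add (Complex.ofRealCLM.contDiff.mul contDiff_const)
  set α : ℝ → EuclideanSpace ℂ (Fin n) := fun t => φ (g (a + (t : ℂ) * (b - a))) with hα
  have hcd : ContDiffOn ℝ 1 α (Icc 0 1) := hd.comp hs.contDiffOn hmem
  have hαp : IsPiecewiseC1 α :=
    isPiecewiseC1_iff_nat.2 ⟨hcd.continuousOn, 1, fun i => i, Nat.mono_cast, by simp, by simp,
      fun i hi => by
        obtain rfl : i = 0 := by omega
        simpa using hcd⟩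
  have hαX : ∀ t ∈ Icc (0 : ℝ) 1, α t ∈ X := fun t ht =>
    H.image_eq ▸ mem_image_of_mem φ (hc.mem_ball _ (hmem t ht))
  have hle := intrinsicDist_le_pathLength (ω := ω) hαp hαX
  have e0 : α 0 = φ (g a) := by simp [hα]
  have e1 : α 1 = φ (g b) := by simp [hα]
  rw [e0, e1] at hle
  refine hle.trans (pathLength_le_of_speed_le fun t ht => ?_)
  have hw := hmem t ht
  have hgw := hc.mem_ball _ hw
  have hu : HasDerivAt (fun t : ℝ => a + (t : ℂ) * (b - a)) (b - a) t := by
    simpa using ((Complex.ofRealCLM.hasDerivAt (x := t)).mul_const (b - a)).const_add a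
  have hcomp := (hc.hasDerivAt _ hw).scomp t hu
  have hder : deriv α t = (b - a) • T (g (a + (t : ℂ) * (b - a))) := hcomp.deriv
  have hΛ0 : 0 ≤ Λ (g (a + (t : ℂ) * (b - a))) := H.c_pos.le.trans (H.le_factor _ hgw)
  rw [hder, kahlerMetric_smul_smul, H.metric_tangent _ hgw, Real.sqrt_mul (sq_nonneg _),
    Real.sqrt_sq (norm_nonneg _), Real.sqrt_sq hΛ0, mul_comm, norm_sub_rev b a]
  refine mul_le_mul_of_nonneg_right ?_ (norm_nonneg _)
  have l1 := H.factor_lip _ hgw _ (hc.mem_ball a ha)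
  have l2 := hc.lip _ hw a ha
  have l3 : ‖a + (t : ℂ) * (b - a) - a‖ ≤ ‖a - b‖ := by
    rw [add_sub_cancel_left, norm_mul, Complex.norm_real, Real.norm_of_nonneg ht.1, norm_sub_rev b a]
    exact mul_le_of_le_one_left (norm_nonneg _) ht.2
  have l4 : K * ‖g (a + (t : ℂ) * (b - a)) - g a‖ ≤
      K * (2 * (‖z₀‖ ^ (m - 1))⁻¹ * ‖a - b‖) := by
    refine mul_le_mul_of_nonneg_left (l2.trans ?_) H.K_nonneg
    gcongr
  linarith [(abs_le.1 l1).2]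

/-- In a chart the intrinsic distance is conformal, with factor `Λ ∘ g`. -/
theorem isConformalDist {z₀ : ℂ} {g : ℂ → ℂ} {η : ℝ} (hc : IsRootChart m X φ T z₀ g η) :
    IsConformalDist (fun a b => intrinsicDist ω X (φ (g a)) (φ (g b))) (fun w => Λ (g w))
      (z₀ ^ m) η (K * (2 * (‖z₀‖ ^ (m - 1))⁻¹)) c C where
  triangle a ha b hb e he := by
    have hX : ∀ w ∈ Metric.ball (z₀ ^ m) η, φ (g w) ∈ X := fun w hw =>
      H.image_eq ▸ mem_image_of_mem φ (hc.mem_ball w hw)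
    exact H.isPathSpace.intrinsicDist_triangle (hX a ha) (hX b hb) (hX e he)
  upper a ha b hb := H.intrinsicDist_le_of_chart hc ha hb
  lower a ha κ hκ := by
    obtain ⟨ρ, hρ, h⟩ := H.exists_forall_mul_norm_le_intrinsicDist (hc.mem_ball a ha)
      (hc.ne_zero a ha) hκ
    have hcont := (hc.hasDerivAt a ha).continuousAt
    filter_upwards [hcont.eventually_mem (Metric.ball_mem_nhds (φ (g a)) hρ),
      Metric.isOpen_ball.mem_nhds ha] with b hb1 hb2
    have := h _ (H.image_eq ▸ mem_image_of_mem φ (hc.mem_ball b hb2)) (mem_ball_iff_norm.1 hb1)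
    rwa [H.coord _ (hc.mem_ball a ha), H.coord _ (hc.mem_ball b hb2), hc.pow_eq a ha,
      hc.pow_eq b hb2] at this
  lip a ha b hb := by
    have l1 := H.factor_lip _ (hc.mem_ball a ha) _ (hc.mem_ball b hb)
    rw [mul_assoc]
    exact l1.trans (mul_le_mul_of_nonneg_left (hc.lip a ha b hb) H.K_nonneg)
  le_lam a ha := H.le_factor _ (hc.mem_ball a ha)
  lam_le a ha := H.factor_le _ (hc.mem_ball a ha)

end IsBranchedCurve

end BranchedCurve

/-! ### Geodesics on a branched curve -/

section Geodesics

variable {n : ℕ}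

theorem IsUnitSpeedGeodesic.eventually_dist_eq
    {ω : EuclideanSpace ℂ (Fin n) → EuclideanSpace ℂ (Fin n) [⋀^Fin 2]→L[ℝ] ℝ}
    {X : Set (EuclideanSpace ℂ (Fin n))} {L : ℝ} {γ : ℝ → EuclideanSpace ℂ (Fin n)}
    (hγ : IsUnitSpeedGeodesic ω X L γ) {t : ℝ} (ht : t ∈ Icc 0 L) :
    ∃ U ∈ 𝓝[Icc 0 L] t, t ∈ U ∧ ∀ s ∈ U, ∀ s' ∈ U,
      intrinsicDist ω X (γ s) (γ s') = |s - s'| := by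
  obtain ⟨a, b, -, hU, hd⟩ := hγ.2 t ht
  exact ⟨Icc a b, hU, mem_of_mem_nhdsWithin ht hU, hd⟩

namespace IsBranchedCurve

variable [NeZero n] {m : ℕ} {ω : EuclideanSpace ℂ (Fin n) → EuclideanSpace ℂ (Fin n) [⋀^Fin 2]→L[ℝ] ℝ}
  {X : Set (EuclideanSpace ℂ (Fin n))} {φ T : ℂ → EuclideanSpace ℂ (Fin n)} {Λ : ℂ → ℝ}
  {c C K : ℝ} (H : IsBranchedCurve m ω X φ T Λ c C K)
  {L : ℝ} {γ : ℝ → EuclideanSpace ℂ (Fin n)} (hγ : IsUnitSpeedGeodesic ω X L γ)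
include H hγ

theorem eventually_norm_sub_le {t : ℝ} (ht : t ∈ Icc 0 L) :
    ∀ᶠ s in 𝓝[Icc 0 L] t, ‖γ s - γ t‖ ≤ C / c * |s - t| := by
  have hC := H.C_pos
  have hc := H.c_pos
  obtain ⟨U, hU, htU, hd⟩ := hγ.eventually_dist_eq ht
  have hmul : ∀ a b : ℝ, c / C * a ≤ b → a ≤ C / c * b := by
    intro a b hab
    calc a = C / c * (c / C * a) := by field_simp
      _ ≤ C / c * b := by gcongr
  rcases eq_or_ne (γ t) 0 with h0 | h0
  · filter_upwards [hU, self_mem_nhdsWithin] with s hs hsL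
    have := H.mul_min_le_intrinsicDist (hγ.1 s hsL) (hγ.1 t ht)
    rw [hd s hs t htU, h0, zero_sub, norm_neg, min_self] at this
    rw [h0, sub_zero]
    exact hmul _ _ this
  · have hn : 0 < ‖γ t‖ := norm_pos_iff.2 h0
    have hsmall : ∀ᶠ s in 𝓝[Icc 0 L] t, C / c * |s - t| < ‖γ t‖ := by
      have h1 : Continuous fun s : ℝ => C / c * |s - t| := by fun_prop
      have h2 := h1.tendsto t
      rw [sub_self, abs_zero, mul_zero] at h2
      exact (h2.mono_left inf_le_left).eventually_lt_const hn
    filter_upwards [hU, self_mem_nhdsWithin, hsmall] with s hs hsL hsm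
    have := hmul _ _ (H.mul_min_le_intrinsicDist (hγ.1 t ht) (hγ.1 s hsL))
    rw [hd t htU s hs, abs_sub_comm] at this
    rcases min_choice ‖γ s - γ t‖ ‖γ t‖ with h | h
    · rwa [h] at this
    · rw [h] at this
      linarith

theorem continuousOn_geodesic : ContinuousOn γ (Icc 0 L) := by
  intro t ht
  rw [ContinuousWithinAt, tendsto_iff_norm_sub_tendsto_zero]
  refine squeeze_zero' (.of_forall fun _ => norm_nonneg _) (H.eventually_norm_sub_le hγ ht) ?_
  have h1 : Continuous fun s : ℝ => C / c * |s - t| := by fun_prop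
  have h2 := h1.tendsto t
  rw [sub_self, abs_zero, mul_zero] at h2
  exact h2.mono_left inf_le_left

/-- Near an interior time a geodesic in the regular part is minimising and Lipschitz, and runs in
any given neighbourhood of its base point. -/
theorem exists_radius_geodesic {t : ℝ} (ht : t ∈ Ioo 0 L) (h0 : γ t ≠ 0) {ρ : ℝ} (hρ : 0 < ρ) :
    ∃ r > 0, ∀ s ∈ Icc (t - r) (t + r), s ∈ Icc 0 L ∧ ‖γ s - γ t‖ < ρ ∧
      ∀ s' ∈ Icc (t - r) (t + r), intrinsicDist ω X (γ s) (γ s') = |s - s'| ∧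
        ‖γ s - γ s'‖ ≤ C / c * |s - s'| := by
  have hC := H.C_pos
  have hc := H.c_pos
  have hn : 0 < ‖γ t‖ := norm_pos_iff.2 h0
  have ht' := Ioo_subset_Icc_self ht
  obtain ⟨U, hU, -, hd⟩ := hγ.eventually_dist_eq ht'
  have hnh : 𝓝[Icc 0 L] t = 𝓝 t := nhdsWithin_eq_nhds.2 (Icc_mem_nhds ht.1 ht.2)
  rw [hnh] at hU
  have hcont : ContinuousAt γ t := (H.continuousOn_geodesic hγ).continuousAt (Icc_mem_nhds ht.1 ht.2)
  have hev : ∀ᶠ s in 𝓝 t, s ∈ U ∧ s ∈ Icc 0 L ∧ γ s ∈ Metric.ball (γ t) (min ρ (‖γ t‖ / 2)) :=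
    Filter.Eventually.and hU (Filter.Eventually.and (Icc_mem_nhds ht.1 ht.2)
      (hcont.eventually_mem (Metric.ball_mem_nhds _ (lt_min hρ (by positivity)))))
  obtain ⟨r₀, hr₀, hball⟩ := Metric.nhds_basis_closedBall.eventually_iff.1 hev
  rw [Real.closedBall_eq_Icc] at hball
  set r := min r₀ (c / C * (‖γ t‖ / 8)) with hr
  have hr0 : r ≤ r₀ := min_le_left _ _
  have hsub : Icc (t - r) (t + r) ⊆ Icc (t - r₀) (t + r₀) :=
    Icc_subset_Icc (by linarith) (by linarith)
  refine ⟨r, lt_min hr₀ (by positivity), fun s hs => ?_⟩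
  obtain ⟨hsU, hsL, hsb⟩ := hball (hsub hs)
  rw [mem_ball_iff_norm, lt_min_iff] at hsb
  refine ⟨hsL, hsb.1, fun s' hs' => ?_⟩
  obtain ⟨hsU', hsL', -⟩ := hball (hsub hs')
  refine ⟨hd s hsU s' hsU', ?_⟩
  have h1 := H.mul_min_le_intrinsicDist (hγ.1 s hsL) (hγ.1 s' hsL')
  rw [hd s hsU s' hsU', norm_sub_rev] at h1
  have h2 : |s - s'| ≤ 2 * r := by
    rw [abs_le]; constructor <;> linarith [hs.1, hs.2, hs'.1, hs'.2]
  have h3 : 2 * r ≤ c / C * (‖γ t‖ / 4) := by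
    have : r ≤ c / C * (‖γ t‖ / 8) := min_le_right _ _
    linarith
  have h4 : ‖γ t‖ / 2 < ‖γ s‖ := by
    have := norm_le_norm_add_norm_sub (γ s) (γ t)
    linarith
  have h5 : min ‖γ s - γ s'‖ ‖γ s‖ ≤ C / c * |s - s'| := by
    calc min ‖γ s - γ s'‖ ‖γ s‖ = C / c * (c / C * min ‖γ s - γ s'‖ ‖γ s‖) := by field_simp
      _ ≤ _ := by gcongr
  rcases min_choice ‖γ s - γ s'‖ ‖γ s‖ with h | h
  · rwa [h] at h5
  · rw [h] at h5
    have h6 : C / c * |s - s'| ≤ C / c * (c / C * (‖γ t‖ / 4)) := by gcongr; linarith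
    have h7 : C / c * (c / C * (‖γ t‖ / 4)) = ‖γ t‖ / 4 := by field_simp
    linarith

theorem norm_deriv_geodesic_le {t : ℝ} (ht : t ∈ Ioo 0 L) :
    ‖deriv γ t‖ ≤ C / c ∧ ‖deriv (fun s => γ s 0) t‖ ≤ C / c := by
  have hCc : 0 ≤ C / c := div_nonneg H.C_pos.le H.c_pos.le
  have h := H.eventually_norm_sub_le hγ (Ioo_subset_Icc_self ht)
  rw [nhdsWithin_eq_nhds.2 (Icc_mem_nhds ht.1 ht.2)] at h
  refine ⟨norm_deriv_le_of_lip' hCc h, norm_deriv_le_of_lip' hCc ?_⟩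
  filter_upwards [h] with s hs
  exact (PiLp.norm_apply_le (γ s - γ t) 0).trans hs

/-- The quantitative heart of the matter: at each interior time `t`, with `γ t = φ z₀`, the second
differences of the geodesic and of its coordinate are of order `|z₀|^(1-m) h²`, while the
coordinate moves at a definite speed. -/
theorem eventually_norm_secondDifference_le {t : ℝ} (ht : t ∈ Ioo 0 L) (h0 : γ t ≠ 0) :
    ∀ᶠ h in 𝓝[>] (0 : ℝ),
      ‖γ (t + h) + γ (t - h) - (2 : ℝ) • γ t‖ ≤
        (2 * (C / c) ^ 2 + C * (2 * (2 * C * (C / c) ^ 2 + C / c) / c ^ 2)) *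
          (2 * K * ‖γ t 0‖ ^ ((m : ℝ)⁻¹ - 1)) * h ^ 2 ∧
      ‖γ (t + h) 0 + γ (t - h) 0 - (2 : ℝ) • γ t 0‖ ≤
        2 * (2 * C * (C / c) ^ 2 + C / c) / c ^ 2 *
          (2 * K * ‖γ t 0‖ ^ ((m : ℝ)⁻¹ - 1)) * h ^ 2 ∧
      1 / (2 * C) * h ≤ ‖γ (t + h) 0 - γ t 0‖ ∧ 1 / (2 * C) * h ≤ ‖γ (t - h) 0 - γ t 0‖ := by
  have hC := H.C_pos
  have hc := H.c_pos
  have hK := H.K_nonneg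
  have hM : 0 ≤ C / c := by positivity
  have htX := hγ.1 t (Ioo_subset_Icc_self ht)
  rw [← H.image_eq] at htX
  obtain ⟨z₀, hz, hzγ⟩ := htX
  have hz0 : z₀ ≠ 0 := fun h => h0 (by rw [← hzγ, h, H.map_zero])
  have hz0n : 0 < ‖z₀‖ := norm_pos_iff.2 hz0
  obtain ⟨g, η, hch⟩ := H.exists_isRootChart hz hz0
  obtain ⟨ρ, hρ, hρb⟩ := hch.exists_radius
  obtain ⟨r, hr, hloc⟩ := H.exists_radius_geodesic hγ ht h0 hρ
  have hw0 : γ t 0 = z₀ ^ m := by rw [← hzγ, H.coord z₀ hz]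
  have hpow : (‖z₀‖ ^ (m - 1))⁻¹ = ‖γ t 0‖ ^ ((m : ℝ)⁻¹ - 1) := by
    have hm : (m : ℝ) ≠ 0 := Nat.cast_ne_zero.2 H.m_pos.ne'
    rw [hw0, norm_pow, ← Real.rpow_natCast ‖z₀‖ m, ← Real.rpow_mul hz0n.le, ← Real.rpow_natCast,
      ← Real.rpow_neg hz0n.le, Nat.cast_sub H.m_pos]
    congr 1
    field_simp
    push_cast
    ring
  set G := 2 * K * ‖γ t 0‖ ^ ((m : ℝ)⁻¹ - 1) with hG
  have hG' : K * (2 * (‖z₀‖ ^ (m - 1))⁻¹) = G := by rw [hG, hpow]; ring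
  have hG0 : 0 ≤ G := by rw [hG]; positivity
  have hconf := H.isConformalDist hch
  rw [hG'] at hconf
  set w : ℝ → ℂ := fun s => γ s 0 with hw
  have hchart : ∀ s ∈ Icc (t - r) (t + r), w s ∈ Metric.ball (z₀ ^ m) η ∧ φ (g (w s)) = γ s := by
    intro s hs
    obtain ⟨hsL, hsρ, -⟩ := hloc s hs
    exact hρb (γ s) (hγ.1 s hsL) (by rwa [hzγ])
  have hlip : ∀ s ∈ Icc (t - r) (t + r), ∀ s' ∈ Icc (t - r) (t + r),
      ‖w s - w s'‖ ≤ C / c * |s - s'| := fun s hs s' hs' =>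
    (PiLp.norm_apply_le (γ s - γ s') 0).trans ((hloc s hs).2.2 s' hs').2
  have hgeo : ∀ s ∈ Icc (t - r) (t + r), ∀ s' ∈ Icc (t - r) (t + r),
      intrinsicDist ω X (φ (g (w s))) (φ (g (w s'))) = |s - s'| := fun s hs s' hs' => by
    rw [(hchart s hs).2, (hchart s' hs').2]
    exact ((hloc s hs).2.2 s' hs').1
  have hη : ∀ᶠ h in 𝓝[>] (0 : ℝ), C / c * h < η := by
    have h1 : Continuous fun h : ℝ => C / c * h := by fun_prop
    have h2 := h1.tendsto 0
    rw [mul_zero] at h2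
    exact (h2.mono_left inf_le_left).eventually_lt_const hch.pos
  have hGs : ∀ᶠ h in 𝓝[>] (0 : ℝ), G * (C / c * h) < C := by
    have h1 : Continuous fun h : ℝ => G * (C / c * h) := by fun_prop
    have h2 := h1.tendsto 0
    rw [mul_zero, mul_zero] at h2
    exact (h2.mono_left inf_le_left).eventually_lt_const hC
  have htm : t ∈ Icc (t - r) (t + r) := by constructor <;> linarith
  filter_upwards [hη, hGs, Ioo_mem_nhdsGT hr] with h hh1 hh2 hh3
  have hhr : Icc (t - h) (t + h) ⊆ Icc (t - r) (t + r) :=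
    Icc_subset_Icc (by linarith [hh3.2]) (by linarith [hh3.2])
  have hp : t + h ∈ Icc (t - r) (t + r) := hhr ⟨by linarith [hh3.1], le_rfl⟩
  have hq : t - h ∈ Icc (t - r) (t + r) := hhr ⟨le_rfl, by linarith [hh3.1]⟩
  have hΔw : ‖w (t + h) + w (t - h) - (2 : ℝ) • w t‖ ≤
      2 * (2 * C * (C / c) ^ 2 + C / c) / c ^ 2 * G * h ^ 2 :=
    hconf.norm_secondDifference_le hG0 hc hh3.1 hM hw0
      (fun s hs s' hs' => hlip s (hhr hs) s' (hhr hs'))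
      (fun s hs s' hs' => hgeo s (hhr hs) s' (hhr hs')) hh1
  have hstep : ∀ s ∈ Icc (t - r) (t + r), |s - t| = h → ‖w s - w t‖ ≤ C / c * h ∧
      1 / (2 * C) * h ≤ ‖w s - w t‖ ∧
      ‖γ s - γ t - (w s - w t) • T z₀‖ ≤ G * (C / c * h) ^ 2 := by
    intro s hs hsh
    have k1 := hlip s hs t htm
    rw [hsh] at k1
    refine ⟨k1, ?_, ?_⟩
    · have k2 := hconf.upper (w s) (hchart s hs).1 (w t) (hchart t htm).1
      rw [hgeo s hs t htm, hsh] at k2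
      have k3 := hconf.lam_le (w s) (hchart s hs).1
      have k4 : (Λ (g (w s)) + G * ‖w s - w t‖) * ‖w s - w t‖ ≤ 2 * C * ‖w s - w t‖ := by
        have : G * ‖w s - w t‖ ≤ G * (C / c * h) := by gcongr
        gcongr
        linarith
      rw [one_div, inv_mul_le_iff₀ (by positivity)]
      linarith
    · -- `φ ∘ g` minus its linear part at `w t` has small derivative on the segment to `w s`.
      have hball : Metric.closedBall (w t) ‖w s - w t‖ ⊆ Metric.ball (z₀ ^ m) η := by
        refine Metric.closedBall_subset_ball' ?_
        rw [show w t = z₀ ^ m from hw0, dist_self, add_zero, ← show w t = z₀ ^ m from hw0]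
        exact k1.trans_lt hh1
      have hder : ∀ x ∈ Metric.closedBall (w t) ‖w s - w t‖,
          HasDerivWithinAt (fun x => φ (g x) - x • T z₀) (T (g x) - T z₀)
            (Metric.closedBall (w t) ‖w s - w t‖) x := fun x hx => by
        have h1 := (hch.hasDerivAt x (hball hx)).sub ((hasDerivAt_id x).smul_const (T z₀))
        rw [one_smul] at h1
        exact h1.hasDerivWithinAt
      have hbd : ∀ x ∈ Metric.closedBall (w t) ‖w s - w t‖, ‖T (g x) - T z₀‖ ≤ G * (C / c * h) := by
        intro x hx
        have h1 := H.tangent_lip _ (hch.mem_ball x (hball hx)) _ hz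
        have h2 := hch.lip x (hball hx) (z₀ ^ m) (Metric.mem_ball_self hch.pos)
        rw [hch.apply_center] at h2
        have h3 : ‖x - z₀ ^ m‖ ≤ C / c * h := by
          rw [← show w t = z₀ ^ m from hw0]
          exact (mem_closedBall_iff_norm.1 hx).trans k1
        calc ‖T (g x) - T z₀‖ ≤ K * (2 * (‖z₀‖ ^ (m - 1))⁻¹ * ‖x - z₀ ^ m‖) :=
              h1.trans (mul_le_mul_of_nonneg_left h2 hK)
          _ = G * ‖x - z₀ ^ m‖ := by rw [← hG']; ring
          _ ≤ _ := by gcongr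
      have hmv := (convex_closedBall (w t) ‖w s - w t‖).norm_image_sub_le_of_norm_hasDerivWithin_le
        hder hbd (Metric.mem_closedBall_self (norm_nonneg _))
        (mem_closedBall_iff_norm.2 le_rfl)
      have he : φ (g (w s)) - w s • T z₀ - (φ (g (w t)) - w t • T z₀)
          = γ s - γ t - (w s - w t) • T z₀ := by
        rw [(hchart s hs).2, (hchart t htm).2, sub_smul]
        abel
      rw [he] at hmv
      calc _ ≤ G * (C / c * h) * ‖w s - w t‖ := hmv
        _ ≤ G * (C / c * h) * (C / c * h) := by
          have := hh3.1
          gcongr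
        _ = _ := by ring
  have sp := hstep _ hp (by rw [add_sub_cancel_left, abs_of_pos hh3.1])
  have sq := hstep _ hq (by rw [sub_sub_cancel_left, abs_neg, abs_of_pos hh3.1])
  refine ⟨?_, hΔw, sp.2.1, sq.2.1⟩
  have he : γ (t + h) + γ (t - h) - (2 : ℝ) • γ t
      = (γ (t + h) - γ t - (w (t + h) - w t) • T z₀) + (γ (t - h) - γ t - (w (t - h) - w t) • T z₀)
        + (w (t + h) + w (t - h) - (2 : ℝ) • w t) • T z₀ := by
    have : (2 : ℝ) • w t = w t + w t := two_smul _ _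
    rw [this, two_smul]
    module
  rw [he]
  calc _ ≤ G * (C / c * h) ^ 2 + G * (C / c * h) ^ 2
        + 2 * (2 * C * (C / c) ^ 2 + C / c) / c ^ 2 * G * h ^ 2 * C := by
        refine (norm_add_le _ _).trans (add_le_add ((norm_add_le _ _).trans
          (add_le_add sp.2.2 sq.2.2)) ?_)
        rw [norm_smul]
        exact mul_le_mul hΔw (H.norm_tangent_le z₀ hz) (norm_nonneg _)
          ((norm_nonneg _).trans hΔw)
    _ = _ := by ring

omit hγ in
/-- Geodesics in the regular part have uniformly bounded velocity, with uniform Hölder bound of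
exponent `1 / m`. -/
theorem exists_hoelder_bound : ∃ B M : ℝ, 0 ≤ B ∧ 0 ≤ M ∧ ∀ (L : ℝ), 0 < L →
    ∀ γ : ℝ → EuclideanSpace ℂ (Fin n), IsUnitSpeedGeodesic ω X L γ → (∀ t ∈ Ioo 0 L, γ t ≠ 0) →
      (∀ t ∈ Icc 0 L, DifferentiableWithinAt ℝ γ (Icc 0 L) t) ∧
      (∀ t ∈ Icc 0 L, ‖derivWithin γ (Icc 0 L) t‖ ≤ M) ∧
      ∀ s ∈ Icc 0 L, ∀ t ∈ Icc 0 L,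
        ‖derivWithin γ (Icc 0 L) t - derivWithin γ (Icc 0 L) s‖ ≤ B * |t - s| ^ (m : ℝ)⁻¹ := by
  have hC := H.C_pos
  have hc := H.c_pos
  have hK := H.K_nonneg
  have hM : 0 < C / c := by positivity
  set p : ℝ := (m : ℝ)⁻¹ with hp
  have hp0 : 0 < p := inv_pos.2 (Nat.cast_pos.2 H.m_pos)
  have hp1 : p ≤ 1 := inv_le_one_of_one_le₀ (by exact_mod_cast H.m_pos)
  set K₁ := 2 * (2 * C * (C / c) ^ 2 + C / c) / c ^ 2 with hK₁
  have hK₁0 : 0 < K₁ := by positivity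
  -- A common positive constant for the bending of the geodesic and of its coordinate.
  set Kb := (2 * (C / c) ^ 2 + C * K₁ + K₁) * (2 * (K + 1)) with hKb
  have hKb0 : 0 < Kb := by positivity
  set c₁ := 1 / (2 * C) with hc₁
  have hc₁0 : 0 < c₁ := by positivity
  set ε := (c₁ ^ 2 / (2 * Kb)) ^ m with hε
  have hε0 : 0 < ε := by positivity
  have hKε : Kb * ε ^ p ≤ c₁ ^ 2 / 2 := by
    rw [hε, hp, Real.pow_rpow_inv_natCast (by positivity) H.m_pos.ne']
    exact le_of_eq (by field_simp)
  set B := 2 * (C / c) * (min 1 (ε / (2 * (C / c)))) ^ (-p) + 2 * Kb * (ε / 2) ^ (p - 1)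
      + 2 * ((2 * Kb * (c₁ / 2) ^ (p - 1)) / p) with hB
  have hB0 : 0 ≤ B := by positivity
  refine ⟨B, C / c, hB0, hM.le, fun L hL γ hγ h0 => ?_⟩
  have hcont := H.continuousOn_geodesic hγ
  have hcontw : ContinuousOn (fun s => γ s 0) (Icc 0 L) :=
    (EuclideanSpace.proj (0 : Fin n) : EuclideanSpace ℂ (Fin n) →L[ℂ] ℂ).continuous.comp_continuousOn
      hcont
  have hw0 : ∀ t ∈ Ioo 0 L, γ t 0 ≠ 0 := by
    intro t ht
    have htX := hγ.1 t (Ioo_subset_Icc_self ht)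
    rw [← H.image_eq] at htX
    obtain ⟨z, hz, hzγ⟩ := htX
    rw [← hzγ, H.coord z hz]
    exact pow_ne_zero m fun h => h0 t ht (by rw [← hzγ, h, H.map_zero])
  have hle : ∀ (k : ℝ) (t h : ℝ), 0 ≤ k → k ≤ 2 * (C / c) ^ 2 + C * K₁ + K₁ →
      k * (2 * K * ‖γ t 0‖ ^ (p - 1)) * h ^ 2 ≤ Kb * ‖γ t 0‖ ^ (p - 1) * h ^ 2 := by
    intro k t h hk0 hk
    have h1 : k * (2 * K) ≤ Kb := by
      rw [hKb]
      gcongr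
      linarith
    have h2 : 0 ≤ ‖γ t 0‖ ^ (p - 1) := by positivity
    calc _ = k * (2 * K) * ‖γ t 0‖ ^ (p - 1) * h ^ 2 := by ring
      _ ≤ _ := by gcongr
  have hev := fun t ht => H.eventually_norm_secondDifference_le hγ (t := t) ht (h0 t ht)
  have Hγ : IsBentBy γ (fun s => γ s 0) L Kb p := ⟨hcont, hw0, hcontw, fun t ht => by
    filter_upwards [hev t ht] with h hh
    exact hh.1.trans (hle _ t h (by positivity) (by linarith))⟩
  have Hw : IsBentBy (fun s => γ s 0) (fun s => γ s 0) L Kb p := ⟨hcontw, hw0, hcontw,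
    fun t ht => by
      filter_upwards [hev t ht] with h hh
      refine hh.2.1.trans (hle _ t h hK₁0.le ?_)
      have : 0 ≤ 2 * (C / c) ^ 2 + C * K₁ := by positivity
      linarith⟩
  refine differentiableWithinAt_and_norm_derivWithin_sub_le hL hB0 hp0 hcont
    (fun t ht => Hγ.differentiableAt hKb0 ht)
    (fun t ht => (H.norm_deriv_geodesic_le hγ ht).1)
    (fun s hs t ht hst => Hγ.norm_deriv_sub_le Hw hKb0 hp0 hp1 hc₁0 hε0 hM hKε
      (fun t ht => by
        filter_upwards [hev t ht] with h hh
        exact hh.2.2)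
      (fun t ht => (H.norm_deriv_geodesic_le hγ ht).2)
      (fun t ht => (H.norm_deriv_geodesic_le hγ ht).1) hs ht hst)

end IsBranchedCurve

end Geodesics

/-! ### Normalised analytic curves -/

section Normalization

variable {n : ℕ}

theorem mem_regularPart_of_inter_eq {Y Y' W : Set (EuclideanSpace ℂ (Fin n))}
    (hW : IsOpen W) (h : Y ∩ W = Y' ∩ W) {x : EuclideanSpace ℂ (Fin n)} (hxW : x ∈ W)
    (hx : x ∈ regularPart Y) : x ∈ regularPart Y' := by
  obtain ⟨hxY, U, D, p, k, hU, hxU, hD, hp, hk, himg, hinv⟩ := hx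
  refine ⟨(h ▸ (⟨hxY, hxW⟩ : x ∈ Y ∩ W) : x ∈ Y' ∩ W).1, U ∩ W, D ∩ p ⁻¹' W, p, k, hU.inter hW,
    ⟨hxU, hxW⟩, hp.continuousOn.isOpen_inter_preimage hD hW, hp.mono inter_subset_left,
    hk.mono inter_subset_left, ?_, fun w hw => hinv w hw.1⟩
  rw [image_inter_preimage, himg, inter_assoc, inter_comm U W, ← inter_assoc, h, inter_assoc]

/-- The regular part depends only on the germ of the set. -/
theorem mem_regularPart_iff_of_inter_eq {Y Y' W : Set (EuclideanSpace ℂ (Fin n))}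
    (hW : IsOpen W) (h : Y ∩ W = Y' ∩ W) {x : EuclideanSpace ℂ (Fin n)} (hxW : x ∈ W) :
    x ∈ regularPart Y ↔ x ∈ regularPart Y' :=
  ⟨mem_regularPart_of_inter_eq hW h hxW, mem_regularPart_of_inter_eq hW h.symm hxW⟩

/-- The tangent field `ψ + (z / m) ψ'`, which is `φ' / (m z^(m-1))` for `φ = z^m ψ`. -/
noncomputable def tangentField (m : ℕ) (ψ : ℂ → EuclideanSpace ℂ (Fin n)) (z : ℂ) :
    EuclideanSpace ℂ (Fin n) :=
  ψ z + (z / m) • deriv ψ z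

theorem differentiableOn_tangentField {m : ℕ} {ψ : ℂ → EuclideanSpace ℂ (Fin n)} {D : Set ℂ}
    (hD : IsOpen D) (hψ : DifferentiableOn ℂ ψ D) : DifferentiableOn ℂ (tangentField m ψ) D := by
  have h1 := hψ.deriv hD
  exact hψ.add (((differentiable_id.div_const (m : ℂ)).differentiableOn).smul h1)

theorem hasDerivAt_pow_smul {m : ℕ} (hm : 0 < m) {φ ψ : ℂ → EuclideanSpace ℂ (Fin n)} {D : Set ℂ}
    (hD : IsOpen D) (hψ : DifferentiableOn ℂ ψ D) (hφψ : ∀ z ∈ D, φ z = z ^ m • ψ z)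
    {z : ℂ} (hz : z ∈ D) : HasDerivAt φ ((m * z ^ (m - 1)) • tangentField m ψ z) z := by
  have h1 : HasDerivAt ψ (deriv ψ z) z := (hψ.differentiableAt (hD.mem_nhds hz)).hasDerivAt
  have h2 := (hasDerivAt_pow m z).smul h1
  have h3 : φ =ᶠ[𝓝 z] fun z => z ^ m • ψ z := Filter.mem_of_superset (hD.mem_nhds hz) hφψ
  refine (h2.congr_of_eventuallyEq h3).congr_deriv ?_
  have hm' : (m : ℂ) ≠ 0 := Nat.cast_ne_zero.2 hm.ne'
  rw [tangentField, smul_add, smul_smul, add_comm]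
  congr 2
  obtain ⟨k, rfl⟩ := Nat.exists_eq_succ_of_ne_zero hm.ne'
  simp only [Nat.succ_eq_add_one, Nat.add_sub_cancel]
  field_simp
  rw [pow_succ]

/-- The conformal factor of a Kähler metric along a normalised tangent field is bounded above and
below and Lipschitz on the closed unit disc. -/
theorem exists_bounds_sqrt_kahlerMetric {r : Fin n → ℝ}
    {ω : EuclideanSpace ℂ (Fin n) → EuclideanSpace ℂ (Fin n) [⋀^Fin 2]→L[ℝ] ℝ}
    (hω : IsKahlerForm (polydisc r) ω) {D : Set ℂ} (hD : IsOpen D)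
    (hDball : Metric.closedBall (0 : ℂ) 1 ⊆ D) {φ T : ℂ → EuclideanSpace ℂ (Fin n)}
    (hφ : DifferentiableOn ℂ φ D) (hφr : ∀ z ∈ D, φ z ∈ polydisc r) (hT : DifferentiableOn ℂ T D)
    (hT0 : ∀ z ∈ D, T z ≠ 0) :
    ∃ c C K : ℝ, 0 < c ∧ 0 ≤ K ∧ ∀ z ∈ Metric.closedBall (0 : ℂ) 1,
      ‖T z‖ ≤ C ∧ c ≤ √(kahlerMetric ω (φ z) (T z) (T z)) ∧
      √(kahlerMetric ω (φ z) (T z) (T z)) ≤ C ∧ ∀ z' ∈ Metric.closedBall (0 : ℂ) 1,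
        ‖T z - T z'‖ ≤ K * ‖z - z'‖ ∧
        |√(kahlerMetric ω (φ z) (T z) (T z)) - √(kahlerMetric ω (φ z') (T z') (T z'))|
          ≤ K * ‖z - z'‖ := by
  set Q := Metric.closedBall (0 : ℂ) 1 with hQ
  have hQc : IsCompact Q := isCompact_closedBall 0 1
  have hQv : Convex ℝ Q := convex_closedBall 0 1
  have hQn : Q.Nonempty := ⟨0, by simp [hQ]⟩
  have hTd : ContDiffOn ℝ 1 T Q := ((hT.contDiffOn hD).restrict_scalars ℝ).mono hDball
  have hωd : ContDiffOn ℝ 1 (fun z => ω (φ z)) Q := by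
    have h1 : ContDiffOn ℝ 1 ω (polydisc r) := hω.smooth.of_le (by exact_mod_cast le_top)
    have h2 : ContDiffOn ℝ 1 φ Q := ((hφ.contDiffOn hD).restrict_scalars ℝ).mono hDball
    exact h1.comp h2 fun z hz => hφr z (hDball hz)
  obtain ⟨K₁, hK₁⟩ := hTd.exists_lipschitzOnWith one_ne_zero hQv hQc
  obtain ⟨K₂, hK₂⟩ := hωd.exists_lipschitzOnWith one_ne_zero hQv hQc
  obtain ⟨B₁, hB₁⟩ := hQc.exists_bound_of_continuousOn hTd.continuousOn
  obtain ⟨B₂, hB₂⟩ := hQc.exists_bound_of_continuousOn hωd.continuousOn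
  obtain ⟨z₁, hz₁⟩ := hQn
  have hB₁0 : 0 ≤ B₁ := (norm_nonneg _).trans (hB₁ z₁ hz₁)
  have hB₂0 : 0 ≤ B₂ := (norm_nonneg _).trans (hB₂ z₁ hz₁)
  set q : ℂ → ℝ := fun z => kahlerMetric ω (φ z) (T z) (T z) with hq
  have hqpos : ∀ z ∈ Q, 0 < q z := fun z hz =>
    hω.positive _ (hφr z (hDball hz)) _ (hT0 z (hDball hz))
  have hqc : ContinuousOn (fun z => √(q z)) Q :=
    Real.continuous_sqrt.comp_continuousOn
      (continuous_alternating_two_eval.comp_continuousOn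
        (hωd.continuousOn.prodMk hTd.continuousOn))
  obtain ⟨z₂, hz₂, hmin⟩ := hQc.exists_isMinOn ⟨z₁, hz₁⟩ hqc
  have hc : 0 < √(q z₂) := Real.sqrt_pos.2 (hqpos z₂ hz₂)
  set K₃ : ℝ := K₂ * B₁ ^ 2 + B₂ * ((B₁ + B₁) * K₁) with hK₃
  have hK₃0 : 0 ≤ K₃ := by positivity
  refine ⟨√(q z₂), max B₁ √(B₂ * B₁ ^ 2), max K₁ (K₃ / √(q z₂)), hc, le_max_of_le_left K₁.2,
    fun z hz => ⟨(hB₁ z hz).trans (le_max_left _ _), hmin hz, ?_, fun z' hz' => ⟨?_, ?_⟩⟩⟩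
  · refine le_trans (Real.sqrt_le_sqrt ?_) (le_max_right _ _)
    refine (le_abs_self _).trans ((abs_kahlerMetric_self_le _ _ _).trans ?_)
    have h1 := hB₁ z hz
    have h2 := hB₂ z hz
    gcongr
  · have := hK₁.dist_le_mul z hz z' hz'
    rw [dist_eq_norm, dist_eq_norm] at this
    exact this.trans (mul_le_mul_of_nonneg_right (le_max_left _ _) (norm_nonneg _))
  · refine le_trans ?_ (mul_le_mul_of_nonneg_right (le_max_right _ _) (norm_nonneg _))
    have d1 := hK₁.dist_le_mul z hz z' hz'
    have d2 := hK₂.dist_le_mul z hz z' hz'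
    rw [dist_eq_norm, dist_eq_norm] at d1 d2
    have h3 : |q z - q z'| ≤ K₃ * ‖z - z'‖ := by
      refine (abs_kahlerMetric_sub_le ω (φ z) (φ z') (T z) (T z')).trans ?_
      have h1 := hB₁ z hz
      have h1' := hB₁ z' hz'
      have h2 := hB₂ z' hz'
      calc _ ≤ K₂ * ‖z - z'‖ * B₁ ^ 2 + B₂ * ((B₁ + B₁) * (K₁ * ‖z - z'‖)) := by gcongr
        _ = K₃ * ‖z - z'‖ := by rw [hK₃]; ring
    -- `√a - √b = (a - b) / (√a + √b)`, and the denominator is bounded below.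
    have h4 : (√(q z) - √(q z')) * (√(q z) + √(q z')) = q z - q z' := by
      have e1 := Real.sq_sqrt (hqpos z hz).le
      have e2 := Real.sq_sqrt (hqpos z' hz').le
      linear_combination e1 - e2
    have h5 : √(q z₂) ≤ √(q z) + √(q z') := (hmin hz).trans (by
      have := Real.sqrt_nonneg (q z')
      linarith)
    rw [div_mul_eq_mul_div, le_div_iff₀ hc]
    calc |√(q z) - √(q z')| * √(q z₂) ≤ |√(q z) - √(q z')| * (√(q z) + √(q z')) := by gcongr
      _ = |q z - q z'| := by
        rw [← h4, abs_mul, abs_of_pos (hc.trans_le h5)]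
      _ ≤ _ := h3

/-- A uniform bound and a uniform Hölder estimate bound the Hölder norm. -/
theorem holderNormOn_le {q : ℝ≥0} {s : Set ℝ} {f : ℝ → EuclideanSpace ℂ (Fin n)} {M B : ℝ}
    (hB : 0 ≤ B) (hfM : ∀ t ∈ s, ‖f t‖ ≤ M)
    (hfB : ∀ x ∈ s, ∀ y ∈ s, ‖f x - f y‖ ≤ B * |x - y| ^ (q : ℝ)) :
    holderNormOn q s f ≤ (M.toNNReal + B.toNNReal : ℝ≥0) := by
  rw [holderNormOn, ENNReal.coe_add]
  refine add_le_add (iSup₂_le fun t ht => ?_) ?_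
  · rw [← ofReal_norm, ENNReal.ofReal]
    exact_mod_cast Real.toNNReal_le_toNNReal (hfM t ht)
  · refine HolderWith.eHolderNorm_le fun x y => ?_
    rw [edist_dist, edist_dist, ENNReal.ofReal_rpow_of_nonneg dist_nonneg (by positivity),
      ← ENNReal.ofReal_coe_nnreal, ← ENNReal.ofReal_mul (by positivity),
      Real.coe_toNNReal _ hB]
    refine ENNReal.ofReal_le_ofReal ?_
    rw [dist_eq_norm, Subtype.dist_eq, Real.dist_eq]
    exact hfB x x.2 y y.2

variable [NeZero n]

theorem tangentField_coord_zero {m : ℕ} {ψ : ℂ → EuclideanSpace ℂ (Fin n)} {D : Set ℂ}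
    (hD : IsOpen D) (hψ : DifferentiableOn ℂ ψ D) (hψ1 : ∀ z ∈ D, ψ z 0 = 1) {z : ℂ} (hz : z ∈ D) :
    tangentField m ψ z 0 = 1 := by
  have h1 : HasDerivAt ψ (deriv ψ z) z := (hψ.differentiableAt (hD.mem_nhds hz)).hasDerivAt
  have h2 : HasDerivAt (fun z => ψ z 0) (deriv ψ z 0) z :=
    (EuclideanSpace.proj (0 : Fin n) : EuclideanSpace ℂ (Fin n) →L[ℂ] ℂ).hasFDerivAt.comp_hasDerivAt
      z h1
  have h3 : (fun z => ψ z 0) =ᶠ[𝓝 z] fun _ => (1 : ℂ) :=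
    Filter.mem_of_superset (hD.mem_nhds hz) hψ1
  have h4 : deriv ψ z 0 = 0 := by
    rw [← h2.deriv, h3.deriv_eq, deriv_const]
  simp [tangentField, h4, hψ1 z hz]

/-- A normalised analytic curve `φ = z^m ψ` with its only singular point at `0` satisfies the
uniform estimates of `IsBranchedCurve`. -/
theorem exists_isBranchedCurve {m : ℕ} (hm : 0 < m) {r : Fin n → ℝ}
    {A : Set (EuclideanSpace ℂ (Fin n))} (hA : A ⊆ polydisc r)
    {ω : EuclideanSpace ℂ (Fin n) → EuclideanSpace ℂ (Fin n) [⋀^Fin 2]→L[ℝ] ℝ}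
    (hω : IsKahlerForm (polydisc r) ω) {Ω V : Set (EuclideanSpace ℂ (Fin n))} (hΩ : IsOpen Ω)
    (hV : IsOpen V) (hsing : singularPart (A ∩ V) = {0}) {Δ' : Set ℂ}
    (hΔ' : Metric.closedBall (0 : ℂ) 1 ⊆ Δ') {φ : ℂ → EuclideanSpace ℂ (Fin n)}
    (hφ : IsNormalizationMap Δ' (A ∩ V) φ) (hX : φ '' Metric.ball (0 : ℂ) 1 = A ∩ Ω)
    {ψ : ℂ → EuclideanSpace ℂ (Fin n)} (hψ : DifferentiableOn ℂ ψ Δ')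
    (hφψ : ∀ z ∈ Δ', φ z = z ^ m • ψ z) (hψ1 : ∀ z ∈ Δ', ψ z 0 = 1) :
    ∃ (T : ℂ → EuclideanSpace ℂ (Fin n)) (Λ : ℂ → ℝ) (c C K : ℝ),
      IsBranchedCurve m ω (A ∩ Ω) φ T Λ c C K := by
  have hD := hφ.isOpen
  have hmap : ∀ z ∈ Δ', φ z ∈ A ∩ V := fun z hz => hφ.image_eq ▸ mem_image_of_mem φ hz
  have hball : Metric.ball (0 : ℂ) 1 ⊆ Δ' := Metric.ball_subset_closedBall.trans hΔ'
  have hcoordT : ∀ z ∈ Δ', tangentField m ψ z 0 = 1 := fun z hz =>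
    tangentField_coord_zero hD hψ hψ1 hz
  have hcoord : ∀ z ∈ Δ', φ z 0 = z ^ m := fun z hz => by simp [hφψ z hz, hψ1 z hz]
  have hzero : φ 0 = 0 := by simp [hφψ 0 (hΔ' (by simp)), hm.ne']
  have hne : ∀ z ∈ Δ', z ≠ 0 → φ z ≠ 0 := fun z hz h0 h => by
    have := hcoord z hz
    rw [h] at this
    exact pow_ne_zero m h0 this.symm
  obtain ⟨c, C, K, hc, hK, hb⟩ := exists_bounds_sqrt_kahlerMetric hω hD hΔ' hφ.holomorphic
    (fun z hz => hA (hmap z hz).1) (differentiableOn_tangentField (m := m) hD hψ)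
    (fun z hz h => by
      have := hcoordT z hz
      rw [h] at this
      simp at this)
  have hb' := fun z (hz : z ∈ Metric.ball (0 : ℂ) 1) => hb z (Metric.ball_subset_closedBall hz)
  have hreg : ∀ x ∈ A ∩ V, x ≠ 0 → x ∈ regularPart (A ∩ V) := by
    intro x hx h0
    by_contra hcon
    have : x ∈ singularPart (A ∩ V) := ⟨hx, hcon⟩
    rw [hsing] at this
    exact h0 this
  have h0sing : (0 : EuclideanSpace ℂ (Fin n)) ∈ singularPart (A ∩ V) := hsing ▸ mem_singleton _
  have hsub : A ∩ Ω ⊆ A ∩ V := by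
    rw [← hX]
    rintro _ ⟨z, hz, rfl⟩
    exact hmap z (hball hz)
  have hgerm : (A ∩ Ω) ∩ (Ω ∩ V) = (A ∩ V) ∩ (Ω ∩ V) := by
    ext x
    simp only [mem_inter_iff]
    tauto
  have h0Ω : (0 : EuclideanSpace ℂ (Fin n)) ∈ A ∩ Ω := by
    rw [← hX, ← hzero]
    exact mem_image_of_mem φ (by simp)
  refine ⟨tangentField m ψ, _, c, C, K, ⟨hm, ?_, hX, ?_, hzero, fun z hz => hcoord z (hball hz),
    fun z hz => hasDerivAt_pow_smul hm hD hψ hφψ (hball hz), fun z hz => hcoordT z (hball hz),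
    fun z hz z' hz' => ((hb' z hz).2.2.2 z' (Metric.ball_subset_closedBall hz')).1,
    fun z hz => (hb' z hz).1, fun z hz => ?_, fun z hz => (hb' z hz).2.1,
    fun z hz => (hb' z hz).2.2.1,
    fun z hz z' hz' => ((hb' z hz).2.2.2 z' (Metric.ball_subset_closedBall hz')).2, hc, hK, ?_⟩⟩
  · exact hω.smooth.continuousOn.mono (inter_subset_left.trans hA)
  · ext x
    constructor
    · refine fun hx => ⟨hx.1, fun h0 => ?_⟩
      rw [mem_singleton_iff] at h0
      subst h0
      exact h0sing.2 ((mem_regularPart_iff_of_inter_eq (hΩ.inter hV) hgerm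
        ⟨h0Ω.2, h0sing.1.2⟩).1 hx)
    · exact fun hx => (mem_regularPart_iff_of_inter_eq (hΩ.inter hV) hgerm
        ⟨hx.1.2, (hsub hx.1).2⟩).2 (hreg x (hsub hx.1) hx.2)
  · have h1 := (hb' z hz).2.1
    rw [Real.sq_sqrt (Real.sqrt_pos.1 (hc.trans_le h1)).le]
  · intro z₀ hz₀ h0 ε hε
    have hx₀ := hne z₀ (hball hz₀) h0
    have hxr := hreg _ (hmap z₀ (hball hz₀)) hx₀
    obtain ⟨U, h, hU, hxU, hh, hinv⟩ := hφ.inverse _ hxr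
    have hhc : ContinuousAt h (φ z₀) := (hh.differentiableAt (hU.mem_nhds hxU)).continuousAt
    have hh0 : h (φ z₀) = z₀ := hinv z₀ (hball hz₀) hxU hxr
    have hev : ∀ᶠ x in 𝓝 (φ z₀), x ∈ U ∧ x ≠ 0 ∧ h x ∈ Metric.ball z₀ ε :=
      Filter.Eventually.and (hU.mem_nhds hxU) (Filter.Eventually.and
        (isOpen_compl_singleton.mem_nhds hx₀)
        (hhc.eventually_mem (hh0.symm ▸ Metric.ball_mem_nhds _ hε)))
    obtain ⟨ρ, hρ, hρb⟩ := Metric.eventually_nhds_iff_ball.1 hev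
    refine ⟨ρ, hρ, fun z hz hzρ => ?_⟩
    obtain ⟨k1, k2, k3⟩ := hρb (φ z) (mem_ball_iff_norm.2 hzρ)
    rw [hinv z (hball hz) k1 (hreg _ (hmap z (hball hz)) k2)] at k3
    exact mem_ball_iff_norm.1 k3

end Normalization

theorem mainTheorem8 {n : ℕ} [NeZero n] (m : ℕ) (hm : 0 < m)
    (r : Fin n → ℝ) (hr : ∀ i, 0 < r i)
    (A : Set (EuclideanSpace ℂ (Fin n))) (hA : IsAnalyticCurve (polydisc r) A)
    (ω : EuclideanSpace ℂ (Fin n) → EuclideanSpace ℂ (Fin n) [⋀^Fin 2]→L[ℝ] ℝ)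
    (hω : IsKahlerForm (polydisc r) ω)
    (hω0 : ∀ v w, kahlerMetric ω 0 v w = (inner ℂ v w).re)
    (Ω : Set (EuclideanSpace ℂ (Fin n))) (hΩ : IsOpen Ω) (hΩr : closure Ω ⊆ polydisc r)
    (V : Set (EuclideanSpace ℂ (Fin n))) (hV : IsOpen V) (hsing : singularPart (A ∩ V) = {0})
    (Δ' : Set ℂ) (hΔ' : Metric.closedBall (0 : ℂ) 1 ⊆ Δ')
    (φ : ℂ → EuclideanSpace ℂ (Fin n)) (hφ : IsNormalizationMap Δ' (A ∩ V) φ)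
    (hX : φ '' Metric.ball (0 : ℂ) 1 = A ∩ Ω)
    (ψ : ℂ → EuclideanSpace ℂ (Fin n)) (hψ : DifferentiableOn ℂ ψ Δ')
    (hφψ : ∀ z ∈ Δ', φ z = z ^ m • ψ z) (hψ1 : ∀ z ∈ Δ', ψ z 0 = 1)
    (hψ0 : ∀ j, j ≠ 0 → ψ 0 j = 0) :
    ∃ c₃ : ℝ≥0, ∀ L : ℝ, 0 < L → ∀ γ : ℝ → EuclideanSpace ℂ (Fin n),
      IsUnitSpeedGeodesic ω (A ∩ Ω) L γ →
      (∀ t ∈ Ioc 0 L, γ t ∈ regularPart (A ∩ Ω)) →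
        (∀ t ∈ Icc 0 L, DifferentiableWithinAt ℝ γ (Icc 0 L) t) ∧
        holderNormOn (1 / (m : ℝ≥0)) (Icc 0 L) (derivWithin γ (Icc 0 L)) ≤ c₃ := by

  obtain ⟨T, Λ, c, C, K, H⟩ := exists_isBranchedCurve hm hA.1.1 hω hΩ hV hsing hΔ' hφ hX hψ hφψ hψ1
  obtain ⟨B, M, hB, -, hmain⟩ := H.exists_hoelder_bound
  refine ⟨M.toNNReal + B.toNNReal, fun L hL γ hγ hreg => ?_⟩
  have h0 : ∀ t ∈ Ioo 0 L, γ t ≠ 0 := fun t ht => by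
    have := hreg t ⟨ht.1, ht.2.le⟩
    rw [H.regularPart_eq] at this
    exact this.2
  obtain ⟨hd, hbd, hho⟩ := hmain L hL γ hγ h0
  refine ⟨hd, holderNormOn_le hB hbd fun x hx y hy => ?_⟩
  have e : ((1 / (m : ℝ≥0) : ℝ≥0) : ℝ) = (m : ℝ)⁻¹ := by simp
  rw [e]
  exact hho y hy x hx
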